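/- A \emph{nondeterministic streaming string transducer} (NSST) is a tuple $\mathcal T=(Q,\Sigma,\Omega,\mathcal R,\Delta,I,F)$ with a finite set $Q$ of states, finite input and output alphabets $\Sigma=\Sigma(\mathcal T)$ and $\Omega=\Omega(\mathcal T)$, a finite set $\mathcal R$ of registers, a finite bag (multiset) $\Delta$ of transitions $(p,a,\sigma,q)\in Q\times\Sigma\times\operatorname{Asg}(\mathcal R,\Omega)\times Q$, a partial function $I$ from $Q$ to valuations, and a partial function $F:Q\rightharpoonup(\mathcal R\cup\Omega)^*$ such that every register occurs at most once in each $F(q)$. Here a \emph{valuation} is a partial function $\mathcal R\rightharpoonup\Omega^*$, and $\operatorname{Asg}(\mathcal R,\Omega)$ is the set of \emph{copyless assignments}, i.e. partial functions $\sigma:\mathcal R\rightharpoonup(\mathcal R\cup\Omega)^*$ such that every register occurs at most once in all strings $\sigma(Y)$, $Y\in\mathcal R$, together. A valuation $\nu$ extends to strings $u\in(\mathcal R\cup\Omega)^*$ by replacing each register by its value; $\nu(u)$ is undefined if $\nu$ is undefined on some register of $u$; and $(\nu\circ\sigma)(X)=\nu(\sigma(X))$. A \emph{run} over $a_1\cdots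 a_n\in\Sigma^*$ is a sequence $(q_0,\nu_0)\xrightarrow{a_1/\sigma_1}\cdots\xrightarrow{a_n/\sigma_n}(q_n,\nu_n)$ such that $I(q_0)$ is defined, $\nu_0=I(q_0)$, $(q_i,a_{i+1},\sigma_{i+1},q_{i+1})\in\Delta$ and $\nu_{i+1}=\nu_i\circ\sigma_{i+1}$ for all $i<n$. It is \emph{accepting}, with output $\nu_n(F(q_n))$, if $\nu_n(F(q_n))$ is defined. The semantics $[\![\mathcal T]\!](D)$ is the bag of the outputs of all accepting runs over $D\in\Sigma^*$, where choosing different elements (copies) of the bag $\Delta$ counts as different runs. The size $|\mathcal T|$ is the number of symbols needed to write $\mathcal T$ down: the number of states, registers and letters of both alphabets, plus the total length of the descriptions of $\Delta$ (transitions counted with multiplicity), $I$ and $F$, including all their strings. \textbf{Theorem.} For every pair of NSSTs $\mathcal T_1,\mathcal T_2$ with $\Omega(\mathcal T_1)\subseteq\Sigma(\mathcal T_2)$ there is an NSST $\mathcal T$ with input alphabet $\Sigma(\mathcal T_1)$ and output alphabet $\Omega(\mathcal T_2)$ such that, for every $D\in\Sigma(\mathcal T_1)^*$, \[ [\![\mathcal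 T]\!](D)\;=\;\bigcup_{D'\in[\![\mathcal T_1]\!](D)}[\![\mathcal T_2]\!](D'), \] where $\bigcup$ is the (additive) union of bags and $D'$ ranges over the elements of the bag $[\![\mathcal T_1]\!](D)$ with multiplicity. Moreover, $\mathcal T$ is computable from $\mathcal T_1$ and $\mathcal T_2$ (with respect to the natural finite descriptions of NSSTs), and $|\mathcal T|\le C\cdot 2^{P(|\mathcal T_1|,|\mathcal T_2|)}$ for a constant $C$ and a polynomial $P$ that do not depend on $\mathcal T_1$ and $\mathcal T_2$. -/

import Mathlib

/-! Nondeterministic streaming string transducers (NSSTs) with bag semantics.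

Letters are natural numbers and alphabets are finite sets of them; the states and the registers of a
transducer are `Fin n` and `Fin r`. So every transducer is a finite object with an explicit code, and
a construction is effective when it is computable on codes. -/

/-- Strings over registers (`Sum.inl`) and letters (`Sum.inr`). -/
abbrev RegWord (r : ℕ) : Type := List (Fin r ⊕ ℕ)

/-- Assignments: partial functions from registers to strings over registers and letters. -/
abbrev Assignment (r : ℕ) : Type := Fin r → Option (RegWord r)

/-- Valuations: partial functions from registers to strings of letters. -/
abbrev RegVal (r : ℕ) : Type := Fin r → Option (List ℕ)

/-- All letters of the string `u` belong to `A`. -/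
def RegWord.Over {r : ℕ} (u : RegWord r) (A : Finset ℕ) : Prop :=
  ∀ o : ℕ, Sum.inr o ∈ u → o ∈ A

/-- All letters used by the assignment belong to `A`. -/
def Assignment.Over {r : ℕ} (σ : Assignment r) (A : Finset ℕ) : Prop :=
  ∀ (X : Fin r) (u : RegWord r), σ X = some u → u.Over A

/-- Every register occurs at most once in all the assigned strings together. -/
def Assignment.Copyless {r : ℕ} (σ : Assignment r) : Prop :=
  ∀ X : Fin r, ∑ Y : Fin r, ((σ Y).getD []).count (Sum.inl X) ≤ 1

/-- All letters used by the valuation belong to `A`. -/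
def RegVal.Over {r : ℕ} (ν : RegVal r) (A : Finset ℕ) : Prop :=
  ∀ (X : Fin r) (u : List ℕ), ν X = some u → ∀ o ∈ u, o ∈ A

/-- The extension of a valuation to strings: registers are replaced by their contents, letters are
kept; undefined as soon as some register of the string is undefined. -/
def RegVal.eval {r : ℕ} (ν : RegVal r) : RegWord r → Option (List ℕ)
  | [] => some []
  | Sum.inl X :: u => (ν X).bind fun x => (ν.eval u).map fun y => x ++ y
  | Sum.inr o :: u => (ν.eval u).map fun y => o :: y

/-- The composition `ν ∘ σ`, that is `X ↦ ν (σ X)`. -/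
def RegVal.comp {r : ℕ} (ν : RegVal r) (σ : Assignment r) : RegVal r :=
  fun X => (σ X).bind ν.eval

/-- A transition of a transducer with `n` states and `r` registers. -/
structure Transition (n r : ℕ) where
  src : Fin n
  letter : ℕ
  asg : Assignment r
  dst : Fin n

/-- Nondeterministic streaming string transducers. The bag of transitions is given as a list: each
entry is one element of the bag, and equal entries are counted with multiplicity. -/
structure NSST where
  /-- The states are the elements of `Fin numStates`. -/
  numStates : ℕ
  /-- The registers are the elements of `Fin numRegs`. -/
  numRegs : ℕ
  /-- The input alphabet. -/
  inAlph : Finset ℕ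
  /-- The output alphabet. -/
  outAlph : Finset ℕ
  /-- The bag of transitions. -/
  trans : List (Transition numStates numRegs)
  /-- The partial function giving the initial states with their initial valuations. -/
  init : Fin numStates → Option (RegVal numRegs)
  /-- The partial function giving the final states with their output strings. -/
  final : Fin numStates → Option (RegWord numRegs)
  trans_letter_mem : ∀ t ∈ trans, t.letter ∈ inAlph
  trans_asg_over : ∀ t ∈ trans, t.asg.Over outAlph
  trans_asg_copyless : ∀ t ∈ trans, t.asg.Copyless
  init_over : ∀ q ν, init q = some ν → ν.Over outAlph
  final_over : ∀ q u, final q = some u → u.Over outAlph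
  final_copyless : ∀ q u, final q = some u → ∀ X : Fin numRegs, u.count (Sum.inl X) ≤ 1

namespace NSST

/-- A configuration: a state and a valuation of the registers. -/
abbrev Config (T : NSST) : Type := Fin T.numStates × RegVal T.numRegs

/-- The bag of all sequences of steps of `T` over the given string from a given configuration. Each
step is recorded by the assignment that it applies and the configuration that it reaches; every
element of the bag of transitions contributes separately. -/
def stepsFrom (T : NSST) : T.Config → List ℕ → Multiset (List (Assignment T.numRegs × T.Config))
  | _, [] => {[]}
  | c, a :: w =>
    ((T.trans : Multiset (Transition T.numStates T.numRegs)).filter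
      fun t => t.src = c.1 ∧ t.letter = a).bind fun t =>
        (T.stepsFrom (t.dst, c.2.comp t.asg) w).map fun ρ =>
          (t.asg, (t.dst, c.2.comp t.asg)) :: ρ

/-- A run: the initial configuration and the sequence of steps. -/
abbrev Run (T : NSST) : Type := T.Config × List (Assignment T.numRegs × T.Config)

/-- The last configuration of a run. -/
def Run.last {T : NSST} (ρ : T.Run) : T.Config :=
  (ρ.2.getLast?.map Prod.snd).getD ρ.1

/-- The output of a run, undefined if the run is not accepting. -/
def Run.out {T : NSST} (ρ : T.Run) : Option (List ℕ) :=
  (T.final (Run.last ρ).1).bind (Run.last ρ).2.eval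

/-- The bag of all runs (accepting or not) over a string. -/
def allRuns (T : NSST) (w : List ℕ) : Multiset T.Run :=
  (Finset.univ : Finset (Fin T.numStates)).val.bind fun q =>
    match T.init q with
    | none => 0
    | some ν => (T.stepsFrom (q, ν) w).map fun ρ => ((q, ν), ρ)

/-- The bag of all accepting runs over a string. -/
def runs (T : NSST) (w : List ℕ) : Multiset T.Run :=
  (T.allRuns w).filter fun ρ => (Run.out ρ).isSome

/-- The bag semantics: the bag of the outputs of all accepting runs. -/
def sem (T : NSST) (w : List ℕ) : Multiset (List ℕ) :=
  (T.runs w).filterMap Run.out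

/-- The semantics of the composition: the bag union of `T₂.sem D'`, where `D'` ranges over the bag
`T₁.sem D`, each element counted with its multiplicity. -/
def compSem (T₁ T₂ : NSST) (D : List ℕ) : Multiset (List ℕ) :=
  (T₁.sem D).bind T₂.sem

/-- The number of symbols needed to write down a partial map from registers to strings. -/
def tableSize {r : ℕ} {S : Type} (σ : Fin r → Option (List S)) : ℕ :=
  ∑ X : Fin r, (σ X).elim 0 fun u => u.length + 1

/-- The size of a transducer: the number of symbols needed to write it down. It counts states,
registers, letters of both alphabets, and all transitions (with multiplicity), initial and final
entries, together with the lengths of all their strings. -/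
def size (T : NSST) : ℕ :=
  T.numStates + T.numRegs + T.inAlph.card + T.outAlph.card
    + (T.trans.map fun t => tableSize t.asg + 1).sum
    + ∑ q : Fin T.numStates, (T.init q).elim 0 (fun ν => tableSize ν + 1)
    + ∑ q : Fin T.numStates, (T.final q).elim 0 (fun u => u.length + 1)

/-- Codes of strings over registers and letters. -/
abbrev WordCode : Type := List (ℕ ⊕ ℕ)

/-- Codes of transducers: number of states, number of registers, input alphabet, output alphabet,
list of transitions, table of the initial function, table of the final function. -/
abbrev Code : Type :=
  ℕ × ℕ × List ℕ × List ℕ × List (ℕ × ℕ × List (Option WordCode) × ℕ)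
    × List (Option (List (Option (List ℕ)))) × List (Option WordCode)

/-- The code of a string: registers are replaced by their numbers. -/
def wordCode {r : ℕ} (u : RegWord r) : WordCode :=
  u.map (Sum.map Fin.val id)

/-- The explicit finite description of a transducer. -/
def code (T : NSST) : Code :=
  (T.numStates, T.numRegs, T.inAlph.sort, T.outAlph.sort,
    T.trans.map fun t =>
      (t.src.val, t.letter, List.ofFn fun X => (t.asg X).map wordCode, t.dst.val),
    List.ofFn fun q => (T.init q).map fun ν => List.ofFn ν,
    List.ofFn fun q => (T.final q).map wordCode)

end NSST

/-! The composed transducer runs `T₁` and, for every register of `T₁` whose content will end up in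
the output of `T₁`, guesses a *block*: a run of `T₂` on this content, from a guessed state. A
block is determined by its first state, its last state and its effect on the registers of `T₂`.
The words of the effect are unbounded, but the effect is copyless, so that only finitely many
arrangements of registers in them are possible. This arrangement is kept in the state, and the
letters between the registers are kept in registers of the composed transducer.

The bag of runs of `T₂` on a word over registers and letters depends on the bag of blocks on the
content of `X` additively if `X` occurs once in the word, and not at all if `X` does not occur.
Since `T₁` is copyless, these are the only cases, so that summing over guessed families of blocks,
one for each register that is still needed, counts each run of `T₂` on the output of `T₁` exactly
once. -/

attribute [fun_prop] Primrec

namespace NSST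

/-! ### Primitive recursive functions -/

section Primrec

variable {α β γ σ : Type*} [Primcodable α] [Primcodable β] [Primcodable γ] [Primcodable σ]

@[fun_prop]
theorem primrec_id : Primrec (fun x : α => x) := Primrec.id

@[fun_prop]
theorem primrec_const (y : β) : Primrec (fun _ : α => y) := Primrec.const y

@[fun_prop]
theorem primrec_comp {f : β → σ} {g : α → β} (hf : Primrec f) (hg : Primrec g) :
    Primrec fun a => f (g a) := hf.comp hg

@[fun_prop]
theorem primrec_fst {f : α → β × γ} (hf : Primrec f) : Primrec fun a => (f a).1 :=
  Primrec.fst.comp hf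

@[fun_prop]
theorem primrec_snd {f : α → β × γ} (hf : Primrec f) : Primrec fun a => (f a).2 :=
  Primrec.snd.comp hf

@[fun_prop]
theorem primrec_pair {f : α → β} {g : α → γ} (hf : Primrec f) (hg : Primrec g) :
    Primrec fun a => (f a, g a) := Primrec.pair hf hg

@[fun_prop]
theorem primrec_inl {f : α → β} (hf : Primrec f) :
    Primrec fun a => (Sum.inl (f a) : β ⊕ γ) := Primrec.sumInl.comp hf

@[fun_prop]
theorem primrec_inr {f : α → γ} (hf : Primrec f) :
    Primrec fun a => (Sum.inr (f a) : β ⊕ γ) := Primrec.sumInr.comp hf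

@[fun_prop]
theorem primrec_sum_elim {f : α → β ⊕ γ} {g : α → β → σ} {h : α → γ → σ} (hf : Primrec f)
    (hg : Primrec fun p : α × β => g p.1 p.2) (hh : Primrec fun p : α × γ => h p.1 p.2) :
    Primrec fun a => Sum.elim (g a) (h a) (f a) :=
  (Primrec.sumCasesOn hf hg hh).of_eq fun a => by cases f a <;> rfl

@[fun_prop]
theorem primrec_some {f : α → β} (hf : Primrec f) : Primrec fun a => some (f a) :=
  Primrec.option_some.comp hf

@[fun_prop]
theorem primrec_option_map {f : α → Option β} {g : α → β → σ} (hf : Primrec f)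
    (hg : Primrec fun p : α × β => g p.1 p.2) : Primrec fun a => (f a).map (g a) :=
  Primrec.option_map hf hg

@[fun_prop]
theorem primrec_option_bind {f : α → Option β} {g : α → β → Option σ} (hf : Primrec f)
    (hg : Primrec fun p : α × β => g p.1 p.2) : Primrec fun a => (f a).bind (g a) :=
  Primrec.option_bind hf hg

@[fun_prop]
theorem primrec_option_getD {f : α → Option β} {g : α → β} (hf : Primrec f)
    (hg : Primrec g) : Primrec fun a => (f a).getD (g a) := Primrec.option_getD.comp hf hg

@[fun_prop]
theorem primrec_option_elim {f : α → Option β} {d : α → σ} {g : α → β → σ}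
    (hf : Primrec f) (hd : Primrec d) (hg : Primrec fun p : α × β => g p.1 p.2) :
    Primrec fun a => (f a).elim (d a) (g a) :=
  (Primrec.option_casesOn hf hd hg).of_eq fun a => by cases f a <;> rfl

@[fun_prop]
theorem primrec_option_isSome {f : α → Option β} (hf : Primrec f) :
    Primrec fun a => (f a).isSome := Primrec.option_isSome.comp hf

@[fun_prop]
theorem primrec_option_toList {f : α → Option β} (hf : Primrec f) :
    Primrec fun a => (f a).toList := Primrec.optionToList.comp hf

@[fun_prop]
theorem primrec_list_cons {f : α → β} {g : α → List β} (hf : Primrec f) (hg : Primrec g) :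
    Primrec fun a => f a :: g a := Primrec.list_cons.comp hf hg

@[fun_prop]
theorem primrec_list_append {f g : α → List β} (hf : Primrec f) (hg : Primrec g) :
    Primrec fun a => f a ++ g a := Primrec.list_append.comp hf hg

@[fun_prop]
theorem primrec_list_map {f : α → List β} {g : α → β → σ} (hf : Primrec f)
    (hg : Primrec fun p : α × β => g p.1 p.2) : Primrec fun a => (f a).map (g a) :=
  Primrec.list_map hf hg

@[fun_prop]
theorem primrec_list_flatMap {f : α → List β} {g : α → β → List σ} (hf : Primrec f)
    (hg : Primrec fun p : α × β => g p.1 p.2) : Primrec fun a => (f a).flatMap (g a) :=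
  Primrec.list_flatMap hf hg

@[fun_prop]
theorem primrec_list_foldr {f : α → List β} {d : α → σ} {g : α → β → σ → σ} (hf : Primrec f)
    (hd : Primrec d) (hg : Primrec fun p : α × β × σ => g p.1 p.2.1 p.2.2) :
    Primrec fun a => (f a).foldr (g a) (d a) :=
  Primrec.list_foldr (h := fun a p => g a p.1 p.2) hf hd hg

@[fun_prop]
theorem primrec_list_foldl {f : α → List β} {d : α → σ} {g : α → σ → β → σ} (hf : Primrec f)
    (hd : Primrec d) (hg : Primrec fun p : α × σ × β => g p.1 p.2.1 p.2.2) :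
    Primrec fun a => (f a).foldl (g a) (d a) :=
  Primrec.list_foldl (h := fun a p => g a p.1 p.2) hf hd hg

@[fun_prop]
theorem primrec_list_range {f : α → ℕ} (hf : Primrec f) : Primrec fun a => List.range (f a) :=
  Primrec.list_range.comp hf

@[fun_prop]
theorem primrec_list_length {f : α → List β} (hf : Primrec f) : Primrec fun a => (f a).length :=
  Primrec.list_length.comp hf

@[fun_prop]
theorem primrec_list_headI [Inhabited β] {f : α → List β} (hf : Primrec f) :
    Primrec fun a => (f a).headI := Primrec.list_headI.comp hf

@[fun_prop]
theorem primrec_list_tail {f : α → List β} (hf : Primrec f) : Primrec fun a => (f a).tail :=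
  Primrec.list_tail.comp hf

@[fun_prop]
theorem primrec_list_getElem? {f : α → List β} {n : α → ℕ} (hf : Primrec f) (hn : Primrec n) :
    Primrec fun a => (f a)[n a]? := Primrec.list_getElem?.comp hf hn

@[fun_prop]
theorem primrec_list_getD {f : α → List β} {n : α → ℕ} {d : α → β} (hf : Primrec f)
    (hn : Primrec n) (hd : Primrec d) : Primrec fun a => (f a).getD (n a) (d a) := by
  simp only [List.getD_eq_getElem?_getD]
  fun_prop

@[fun_prop]
theorem primrec_list_idxOf [DecidableEq β] {f : α → β} {g : α → List β} (hf : Primrec f)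
    (hg : Primrec g) : Primrec fun a => (g a).idxOf (f a) := Primrec.list_idxOf.comp hf hg

@[fun_prop]
theorem primrec_nat_add {f g : α → ℕ} (hf : Primrec f) (hg : Primrec g) :
    Primrec fun a => f a + g a := Primrec.nat_add.comp hf hg

@[fun_prop]
theorem primrec_nat_mul {f g : α → ℕ} (hf : Primrec f) (hg : Primrec g) :
    Primrec fun a => f a * g a := Primrec.nat_mul.comp hf hg

@[fun_prop]
theorem primrec_nat_div {f g : α → ℕ} (hf : Primrec f) (hg : Primrec g) :
    Primrec fun a => f a / g a := Primrec.nat_div.comp hf hg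

@[fun_prop]
theorem primrec_nat_mod {f g : α → ℕ} (hf : Primrec f) (hg : Primrec g) :
    Primrec fun a => f a % g a := Primrec.nat_mod.comp hf hg

@[fun_prop]
theorem primrec_decide_eq {f g : α → β} [∀ a, Decidable (f a = g a)] (hf : Primrec f)
    (hg : Primrec g) : Primrec fun a => decide (f a = g a) :=
  (Primrec.eq.comp hf hg).decide

@[fun_prop]
theorem primrec_and {f g : α → Bool} (hf : Primrec f) (hg : Primrec g) :
    Primrec fun a => f a && g a := Primrec.and.comp hf hg

@[fun_prop]
theorem primrec_or {f g : α → Bool} (hf : Primrec f) (hg : Primrec g) :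
    Primrec fun a => f a || g a := Primrec.or.comp hf hg

@[fun_prop]
theorem primrec_cond {c : α → Bool} {f g : α → β} (hc : Primrec c) (hf : Primrec f)
    (hg : Primrec g) : Primrec fun a => bif c a then f a else g a := Primrec.cond hc hf hg

@[fun_prop]
theorem primrec_decide_le {f g : α → ℕ} (hf : Primrec f) (hg : Primrec g) :
    Primrec fun a => decide (f a ≤ g a) := (Primrec.nat_le.comp hf hg).decide

@[fun_prop]
theorem primrec_list_filter {f : α → List β} {g : α → β → Bool} (hf : Primrec f)
    (hg : Primrec fun p : α × β => g p.1 p.2) : Primrec fun a => (f a).filter (g a) := by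
  have h : Primrec fun a => (f a).flatMap fun b => bif g a b then [b] else [] := by fun_prop
  refine h.of_eq fun a => ?_
  induction f a with
  | nil => rfl
  | cons b l ih => cases hb : g a b <;> simp [hb, ih]

@[fun_prop]
theorem primrec_list_any {f : α → List β} {g : α → β → Bool} (hf : Primrec f)
    (hg : Primrec fun p : α × β => g p.1 p.2) : Primrec fun a => (f a).any (g a) := by
  have h : Primrec fun a => (f a).foldr (fun b acc => g a b || acc) false := by fun_prop
  exact h.of_eq fun a => by induction f a <;> simp_all

@[fun_prop]
theorem primrec_list_all {f : α → List β} {g : α → β → Bool} (hf : Primrec f)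
    (hg : Primrec fun p : α × β => g p.1 p.2) : Primrec fun a => (f a).all (g a) := by
  have h : Primrec fun a => (f a).foldr (fun b acc => g a b && acc) true := by fun_prop
  exact h.of_eq fun a => by induction f a <;> simp_all

@[fun_prop]
theorem primrec_list_replicate {n : α → ℕ} {f : α → β} (hn : Primrec n) (hf : Primrec f) :
    Primrec fun a => List.replicate (n a) (f a) := by
  have h : Primrec fun a => (List.range (n a)).map fun _ => f a := by fun_prop
  exact h.of_eq fun a => by simp

@[fun_prop]
theorem primrec_list_sections {f : α → List (List β)} (hf : Primrec f) :
    Primrec fun a => (f a).sections := by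
  have h : Primrec fun a => (f a).foldr (fun l acc => acc.flatMap fun s => l.map fun b => b :: s)
      [[]] := by fun_prop
  refine h.of_eq fun a => ?_
  induction f a with
  | nil => rfl
  | cons l L ih => simp [List.sections, ih]

@[fun_prop]
theorem primrec_list_product {f : α → List β} {g : α → List γ} (hf : Primrec f)
    (hg : Primrec g) : Primrec fun a => f a ×ˢ g a := by
  simp only [SProd.sprod, List.product]
  fun_prop

@[fun_prop]
theorem primrec_list_count [DecidableEq β] {f : α → β} {g : α → List β} (hf : Primrec f)
    (hg : Primrec g) : Primrec fun a => (g a).count (f a) := by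
  simp only [List.count_eq_countP, List.countP_eq_length_filter, beq_eq_decide]
  fun_prop

end Primrec

/-! ### Sums over lists -/

section ListSums

variable {α β M : Type*} [AddCommMonoid M]

/-- The sum of `f` over a list. Bags of outputs are sums over the lists of choices of a run. -/
def lsum (l : List α) (f : α → M) : M := (l.map f).sum

@[simp]
theorem lsum_nil (f : α → M) : lsum [] f = 0 := rfl

@[simp]
theorem lsum_cons (a : α) (l : List α) (f : α → M) : lsum (a :: l) f = f a + lsum l f := by
  simp [lsum]

theorem lsum_singleton (a : α) (f : α → M) : lsum [a] f = f a := by simp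

@[simp]
theorem lsum_append (l l' : List α) (f : α → M) : lsum (l ++ l') f = lsum l f + lsum l' f := by
  simp [lsum]

@[simp]
theorem lsum_map (g : α → β) (l : List α) (f : β → M) :
    lsum (l.map g) f = lsum l fun a => f (g a) := by
  simp [lsum, Function.comp_def]

@[simp]
theorem lsum_flatMap (g : α → List β) (l : List α) (f : β → M) :
    lsum (l.flatMap g) f = lsum l fun a => lsum (g a) f := by
  induction l <;> simp_all

theorem lsum_congr {l : List α} {f g : α → M} (h : ∀ a ∈ l, f a = g a) : lsum l f = lsum l g := by
  rw [lsum, lsum, List.map_congr_left h]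

@[simp]
theorem lsum_zero (l : List α) : lsum l (fun _ => (0 : M)) = 0 := by
  simp [lsum]

theorem lsum_add (l : List α) (f g : α → M) :
    lsum l (fun a => f a + g a) = lsum l f + lsum l g :=
  List.sum_map_add

theorem lsum_comm (l : List α) (l' : List β) (f : α → β → M) :
    lsum l (fun a => lsum l' (f a)) = lsum l' fun b => lsum l fun a => f a b := by
  induction l with
  | nil => simp
  | cons a l ih => simp only [lsum_cons, ih, lsum_add]

theorem lsum_filter (l : List α) (p : α → Bool) (f : α → M) :
    lsum (l.filter p) f = lsum l fun a => bif p a then f a else 0 := by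
  induction l with
  | nil => simp
  | cons a l ih => cases h : p a <;> simp [h, ih]

theorem lsum_cond (b : Bool) (l l' : List α) (f : α → M) :
    lsum (bif b then l else l') f = bif b then lsum l f else lsum l' f := by
  cases b <;> rfl

theorem lsum_cond_zero (b : Bool) (l : List α) (f : α → M) :
    (lsum l fun a => bif b then f a else 0) = bif b then lsum l f else 0 := by
  cases b <;> simp

theorem lsum_cond_eq [DecidableEq α] {l : List α} (hl : l.Nodup) {a : α} (ha : a ∈ l)
    (f : α → M) : (lsum l fun b => bif decide (a = b) then f b else 0) = f a := by
  induction l with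
  | nil => simp at ha
  | cons b l ih =>
    obtain ⟨hb, hl⟩ := List.nodup_cons.1 hl
    by_cases hab : a = b
    · subst hab
      have hrest : (lsum l fun b => bif decide (a = b) then f b else 0) = lsum l fun _ => 0 :=
        lsum_congr fun c hc => by simp [show a ≠ c by rintro rfl; exact hb hc]
      simp [hrest]
    · simp [hab, ih hl (by simpa [hab] using ha)]

theorem lsum_sections_cons (l : List α) (L : List (List α)) (f : List α → M) :
    lsum (l :: L).sections f = lsum L.sections fun s => lsum l fun a => f (a :: s) := by
  simp [List.sections]

theorem lsum_range_getElem? (l : List α) {n : ℕ} (hn : l.length ≤ n) (f : α → M) :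
    (lsum (List.range n) fun i => lsum (l[i]?).toList f) = lsum l f := by
  induction l generalizing n with
  | nil => simp
  | cons a l ih =>
    obtain ⟨n, rfl⟩ : ∃ k, n = k + 1 := Nat.exists_eq_succ_of_ne_zero (by simp at hn; lia)
    rw [List.range_succ_eq_map]
    simp [ih (by simpa using hn : l.length ≤ n)]

theorem coe_bind_eq_lsum (l : List α) (f : α → Multiset β) :
    (l : Multiset α).bind f = lsum l f := by
  simp [Multiset.bind, Multiset.join, lsum]

theorem lsum_bind {γ : Type*} (l : List α) (f : α → Multiset β) (g : β → Multiset γ) :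
    (lsum l f).bind g = lsum l fun a => (f a).bind g := by
  induction l <;> simp_all [Multiset.add_bind]

end ListSums

/-! ### Words and assignments -/

/-- Words over registers (`Sum.inl`), given by their numbers, and letters from `Γ` (`Sum.inr`). -/
abbrev Word (Γ : Type) : Type := List (ℕ ⊕ Γ)

/-- Tables of assignments: the entry number `Y` is the word assigned to the register `Y`. -/
abbrev Asg (Γ : Type) : Type := List (Option (Word Γ))

/-- Tables of valuations: the entry number `X` is the content of the register `X`. -/
abbrev ValTable : Type := List (Option (List ℕ))

/-- A transition with states in `S` and output letters in `Γ`, in the format used by `Code`. -/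
abbrev TransCode (S Γ : Type) : Type := S × ℕ × Asg Γ × S

section TransCode

variable {S Γ : Type}

/-- The source of a transition. -/
abbrev TransCode.src (t : TransCode S Γ) : S := t.1

/-- The letter read by a transition. -/
abbrev TransCode.letter (t : TransCode S Γ) : ℕ := t.2.1

/-- The assignment applied by a transition. -/
abbrev TransCode.asg (t : TransCode S Γ) : Asg Γ := t.2.2.1

/-- The target of a transition. -/
abbrev TransCode.dst (t : TransCode S Γ) : S := t.2.2.2

end TransCode

section Words

variable {Γ : Type}

/-- The word `σ u`: the registers of `u` are replaced by the words that `σ` assigns to them. -/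
def subst (σ : Asg Γ) (u : Word Γ) : Option (Word Γ) :=
  u.foldr (fun x acc => acc.bind fun v =>
    Sum.elim (fun Y => (σ.getD Y none).map fun y => y ++ v) (fun g => some (Sum.inr g :: v)) x)
    (some [])

/-- The composition of assignments `Y ↦ σ (τ Y)`. -/
def compAsg (σ τ : Asg Γ) : Asg Γ := τ.map fun o => o.bind fun u => subst σ u

/-- The identity assignment on `r` registers. -/
def idAsg (r : ℕ) : Asg Γ := (List.range r).map fun Y => some [Sum.inl Y]

/-- The maximal register-free factors of a word, possibly empty: one more than the registers. -/
def segments (u : Word Γ) : List (List Γ) :=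
  u.foldr (fun x acc =>
    Sum.elim (fun _ => [] :: acc) (fun g => (g :: acc.headI) :: acc.tail) x) [[]]

/-- The registers of a word, in order of occurrence. -/
def registers (u : Word Γ) : List ℕ := u.filterMap Sum.getLeft?

/-- The letters of a word, in order of occurrence. -/
def letters (u : Word Γ) : List Γ := u.filterMap Sum.getRight?

/-- The concatenation of all the words assigned to registers. -/
def flat (σ : Asg Γ) : Word Γ := σ.flatMap fun o => o.getD []

/-- The words in which only registers with number less than `r` occur, each of them at most once. -/
structure IsLinear (r : ℕ) (u : Word Γ) : Prop where
  lt_of_mem : ∀ Y ∈ registers u, Y < r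
  count_le_one : ∀ Y, (registers u).count Y ≤ 1

/-- The tables of copyless assignments on `r` registers. -/
structure IsCopyless (r : ℕ) (σ : Asg Γ) : Prop where
  length_eq : σ.length = r
  isLinear_flat : IsLinear r (flat σ)

@[simp]
theorem mem_registers {u : Word Γ} {Y : ℕ} : Y ∈ registers u ↔ Sum.inl Y ∈ u := by
  simp [registers]

@[simp]
theorem mem_letters {u : Word Γ} {g : Γ} : g ∈ letters u ↔ Sum.inr g ∈ u := by
  simp [letters]

theorem mem_flat {σ : Asg Γ} {x : ℕ ⊕ Γ} : x ∈ flat σ ↔ ∃ u, some u ∈ σ ∧ x ∈ u := by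
  simp only [flat, List.mem_flatMap]
  constructor
  · rintro ⟨_ | u, ho, hx⟩
    · simp at hx
    · exact ⟨u, ho, hx⟩
  · rintro ⟨u, hu, hx⟩
    exact ⟨some u, hu, hx⟩

theorem registers_flat (σ : Asg Γ) :
    registers (flat σ) = σ.flatMap fun o => (o.map registers).getD [] := by
  rw [flat, registers, List.filterMap_flatMap]
  exact List.flatMap_congr fun o _ => by cases o <;> rfl

@[simp]
theorem subst_nil (σ : Asg Γ) : subst σ [] = some [] := rfl

theorem subst_inl (σ : Asg Γ) (Y : ℕ) (u : Word Γ) :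
    subst σ (Sum.inl Y :: u) =
      (subst σ u).bind fun v => (σ.getD Y none).map fun y => y ++ v := rfl

theorem subst_inr (σ : Asg Γ) (g : Γ) (u : Word Γ) :
    subst σ (Sum.inr g :: u) = (subst σ u).map fun v => Sum.inr g :: v := by
  change (subst σ u).bind _ = _
  cases subst σ u <;> rfl

theorem subst_append (σ : Asg Γ) (u v : Word Γ) :
    subst σ (u ++ v) = (subst σ u).bind fun x => (subst σ v).map fun y => x ++ y := by
  induction u with
  | nil => cases h : subst σ v <;> simp [h]
  | cons x u ih =>
    cases x with
    | inl Y =>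
      rw [List.cons_append, subst_inl, subst_inl, ih]
      cases subst σ u <;> cases subst σ v <;> cases σ.getD Y none <;> simp
    | inr g =>
      rw [List.cons_append, subst_inr, subst_inr, ih]
      cases subst σ u <;> cases subst σ v <;> simp

theorem getD_compAsg (σ τ : Asg Γ) (Y : ℕ) :
    (compAsg σ τ).getD Y none = (τ.getD Y none).bind (subst σ) := by
  simp only [compAsg, List.getD_eq_getElem?_getD, List.getElem?_map]
  cases τ[Y]? <;> rfl

@[simp]
theorem length_compAsg (σ τ : Asg Γ) : (compAsg σ τ).length = τ.length := by simp [compAsg]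

@[simp]
theorem length_idAsg (r : ℕ) : (idAsg r : Asg Γ).length = r := by simp [idAsg]

theorem subst_compAsg (ρ σ : Asg Γ) (u : Word Γ) :
    subst (compAsg ρ σ) u = (subst σ u).bind (subst ρ) := by
  induction u with
  | nil => rfl
  | cons x u ih =>
    cases x with
    | inl Y =>
      rw [subst_inl, subst_inl, ih, getD_compAsg]
      rcases subst σ u with _ | v
      · rfl
      rcases σ.getD Y none with _ | y
      · cases h : subst ρ v <;> simp [h]
      simp only [Option.bind_some, Option.map_some, subst_append]
      cases subst ρ v <;> cases subst ρ y <;> rfl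
    | inr g =>
      rw [subst_inr, subst_inr, ih]
      cases subst σ u with
      | none => rfl
      | some v => simp [subst_inr]

theorem compAsg_assoc (ρ σ τ : Asg Γ) :
    compAsg (compAsg ρ σ) τ = compAsg ρ (compAsg σ τ) := by
  simp only [compAsg, List.map_map, Function.comp_def]
  refine List.map_congr_left fun o _ => ?_
  cases o with
  | none => rfl
  | some u => exact subst_compAsg ρ σ u

theorem compAsg_idAsg (σ : Asg Γ) : compAsg σ (idAsg σ.length) = σ := by
  refine List.ext_getElem (by simp) fun i _ hi => ?_
  simp only [compAsg, idAsg, List.map_map, List.getElem_map, List.getElem_range,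
    Function.comp_apply, Option.bind_some, subst_inl, subst_nil]
  cases h : σ[i] <;> simp [h, List.getElem?_eq_getElem hi]

end Words

/-! ### Codes of transducers -/

namespace Code

/-- The number of states. -/
abbrev numStates (c : Code) : ℕ := c.1

/-- The number of registers. -/
abbrev numRegs (c : Code) : ℕ := c.2.1

/-- The input alphabet. -/
abbrev inAlph (c : Code) : List ℕ := c.2.2.1

/-- The output alphabet. -/
abbrev outAlph (c : Code) : List ℕ := c.2.2.2.1

/-- The list of transitions. -/
abbrev trans (c : Code) : List (TransCode ℕ ℕ) := c.2.2.2.2.1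

/-- The table of the initial function. -/
abbrev init (c : Code) : List (Option ValTable) := c.2.2.2.2.2.1

/-- The table of the final function. -/
abbrev final (c : Code) : List (Option (Word ℕ)) := c.2.2.2.2.2.2

/-- The codes that describe transducers, up to the order in which the alphabets are listed. -/
structure WellFormed (c : Code) : Prop where
  src_lt : ∀ t ∈ c.trans, t.src < c.numStates
  dst_lt : ∀ t ∈ c.trans, t.dst < c.numStates
  letter_mem : ∀ t ∈ c.trans, t.letter ∈ c.inAlph
  asg_copyless : ∀ t ∈ c.trans, IsCopyless c.numRegs t.asg
  asg_over : ∀ t ∈ c.trans, letters (flat t.asg) ⊆ c.outAlph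
  init_length : c.init.length = c.numStates
  init_table_length : ∀ v, some v ∈ c.init → v.length = c.numRegs
  init_over : ∀ v, some v ∈ c.init → ∀ w, some w ∈ v → w ⊆ c.outAlph
  final_length : c.final.length = c.numStates
  final_linear : ∀ u, some u ∈ c.final → IsLinear c.numRegs u
  final_over : ∀ u, some u ∈ c.final → letters u ⊆ c.outAlph

end Code

instance {α β : Type*} [DecidableEq α] [DecidableEq β] : LawfulBEq (α ⊕ β) where
  rfl {x} := by rcases x with a | b; exacts [beq_self_eq_true a, beq_self_eq_true b]
  eq_of_beq {x y} h := by
    rcases x with a | b <;> rcases y with a' | b'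
    · exact congrArg Sum.inl (eq_of_beq (α := α) h)
    · cases h
    · cases h
    · exact congrArg Sum.inr (eq_of_beq (α := β) h)

section WordCode

variable {r : ℕ}

theorem registers_wordCode (u : RegWord r) :
    registers (wordCode u) = (u.filterMap Sum.getLeft?).map Fin.val := by
  rw [registers, wordCode, List.filterMap_map, List.map_filterMap]
  congr 1
  funext x
  cases x <;> rfl

theorem letters_wordCode (u : RegWord r) : letters (wordCode u) = u.filterMap Sum.getRight? := by
  rw [letters, wordCode, List.filterMap_map]
  congr 1
  funext x
  cases x <;> rfl

theorem count_registers_wordCode (u : RegWord r) (X : Fin r) :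
    (registers (wordCode u)).count X.val = u.count (Sum.inl X) := by
  rw [registers_wordCode, List.count_map_of_injective _ _ Fin.val_injective, List.count_filterMap]
  refine List.countP_congr fun x _ => ?_
  rw [beq_iff_eq, beq_iff_eq, Sum.getLeft?_eq_some_iff]

theorem lt_of_mem_registers_wordCode {u : RegWord r} {Y : ℕ} (h : Y ∈ registers (wordCode u)) :
    Y < r := by
  rw [registers_wordCode, List.mem_map] at h
  obtain ⟨X, -, rfl⟩ := h
  exact X.isLt

theorem mem_letters_wordCode {u : RegWord r} {o : ℕ} :
    o ∈ letters (wordCode u) ↔ Sum.inr o ∈ u := by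
  simp [letters_wordCode]

theorem isLinear_wordCode {u : RegWord r} :
    IsLinear r (wordCode u) ↔ ∀ X : Fin r, u.count (Sum.inl X) ≤ 1 := by
  refine ⟨fun h X => count_registers_wordCode u X ▸ h.count_le_one X,
    fun h => ⟨fun _ => lt_of_mem_registers_wordCode, fun Y => ?_⟩⟩
  by_cases hY : Y ∈ registers (wordCode u)
  · exact (count_registers_wordCode u ⟨Y, lt_of_mem_registers_wordCode hY⟩).trans_le (h _)
  · simp [List.count_eq_zero.2 hY]

theorem exists_wordCode_eq {u : Word ℕ} (h : ∀ Y ∈ registers u, Y < r) :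
    ∃ v : RegWord r, wordCode v = u := by
  have : u ∈ Set.range (List.map (Sum.map Fin.val id : Fin r ⊕ ℕ → ℕ ⊕ ℕ)) := by
    rw [Set.range_list_map]
    rintro (Y | o) hx
    · exact ⟨Sum.inl ⟨Y, h Y (mem_registers.2 hx)⟩, rfl⟩
    · exact ⟨Sum.inr o, rfl⟩
  exact this

theorem exists_map_wordCode_eq {o : Option (Word ℕ)}
    (h : ∀ u, o = some u → ∀ Y ∈ registers u, Y < r) :
    ∃ v : Option (RegWord r), v.map wordCode = o := by
  cases o with
  | none => exact ⟨none, rfl⟩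
  | some u =>
    obtain ⟨v, rfl⟩ := exists_wordCode_eq (h u rfl)
    exact ⟨some v, rfl⟩

end WordCode

section AsgCode

variable {r : ℕ}

/-- The code of an assignment. -/
def asgCode (σ : Assignment r) : Asg ℕ := List.ofFn fun X => (σ X).map wordCode

theorem mem_flat_asgCode {σ : Assignment r} {x : ℕ ⊕ ℕ} :
    x ∈ flat (asgCode σ) ↔ ∃ X u, σ X = some u ∧ x ∈ wordCode u := by
  simp only [mem_flat, asgCode, List.mem_ofFn, Option.map_eq_some_iff]
  constructor
  · rintro ⟨_, ⟨X, u, h, rfl⟩, hx⟩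
    exact ⟨X, u, h, hx⟩
  · rintro ⟨X, u, h, hx⟩
    exact ⟨_, ⟨X, u, h, rfl⟩, hx⟩

theorem letters_asgCode_subset {σ : Assignment r} {A : Finset ℕ} :
    letters (flat (asgCode σ)) ⊆ A.sort ↔ σ.Over A := by
  simp only [List.subset_def, mem_letters, mem_flat_asgCode, Finset.mem_sort]
  refine ⟨fun h X u hu o ho => h ⟨X, u, hu, ?_⟩, fun h o ⟨X, u, hu, ho⟩ => h X u hu o ?_⟩
  · rwa [← mem_letters, mem_letters_wordCode]
  · rwa [← mem_letters_wordCode, mem_letters]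

theorem count_registers_asgCode (σ : Assignment r) (X : Fin r) :
    (registers (flat (asgCode σ))).count X.val =
      ∑ Y : Fin r, ((σ Y).getD []).count (Sum.inl X) := by
  rw [registers_flat, List.count_flatMap, asgCode, List.map_ofFn, List.sum_ofFn]
  refine Finset.sum_congr rfl fun Y _ => ?_
  rw [Function.comp_apply]
  cases σ Y with
  | none => simp
  | some u => exact count_registers_wordCode u X

theorem isCopyless_asgCode {σ : Assignment r} : IsCopyless r (asgCode σ) ↔ σ.Copyless := by
  have hlt : ∀ Y ∈ registers (flat (asgCode σ)), Y < r := by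
    intro Y hY
    obtain ⟨X, u, -, hu⟩ := mem_flat_asgCode.1 (mem_registers.1 hY)
    exact lt_of_mem_registers_wordCode (mem_registers.2 hu)
  refine ⟨fun h X => count_registers_asgCode σ X ▸ h.isLinear_flat.count_le_one X,
    fun h => ⟨List.length_ofFn, hlt, fun Y => ?_⟩⟩
  by_cases hY : Y ∈ registers (flat (asgCode σ))
  · exact (count_registers_asgCode σ ⟨Y, hlt Y hY⟩).trans_le (h _)
  · simp [List.count_eq_zero.2 hY]

theorem exists_ofFn_eq {α β : Type*} {n : ℕ} {f : α → β} {l : List β} (hl : l.length = n)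
    (h : ∀ b ∈ l, ∃ a, f a = b) : ∃ g : Fin n → α, (List.ofFn fun i => f (g i)) = l := by
  subst hl
  choose g hg using fun i : Fin l.length => h l[i] (List.getElem_mem i.2)
  exact ⟨g, by simp only [hg]; exact List.ofFn_getElem⟩

theorem exists_asgCode_eq {σ : Asg ℕ} (h : IsCopyless r σ) :
    ∃ τ : Assignment r, asgCode τ = σ :=
  exists_ofFn_eq h.length_eq fun _ ho => exists_map_wordCode_eq fun _ hu Y hY =>
    h.isLinear_flat.lt_of_mem Y
      (mem_registers.2 (mem_flat.2 ⟨_, hu ▸ ho, mem_registers.1 hY⟩))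

end AsgCode

section TransitionCode

variable {n r : ℕ}

/-- The code of a transition. -/
def transitionCode (t : Transition n r) : TransCode ℕ ℕ :=
  (t.src, t.letter, asgCode t.asg, t.dst)

theorem exists_map_transitionCode_eq {tr : List (TransCode ℕ ℕ)} (hsrc : ∀ t ∈ tr, t.src < n)
    (hdst : ∀ t ∈ tr, t.dst < n) (hasg : ∀ t ∈ tr, IsCopyless r t.asg) :
    ∃ l : List (Transition n r), l.map transitionCode = tr := by
  have : tr ∈ Set.range (List.map (transitionCode : Transition n r → TransCode ℕ ℕ)) := by
    rw [Set.range_list_map]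
    rintro ⟨p, a, σ, q⟩ ht
    obtain ⟨τ, rfl⟩ := exists_asgCode_eq (hasg _ ht)
    exact ⟨⟨⟨p, hsrc _ ht⟩, a, τ, ⟨q, hdst _ ht⟩⟩, rfl⟩
  exact this

theorem exists_ofFn_ofFn_eq {l : List (Option ValTable)} (hl : l.length = n)
    (h : ∀ v, some v ∈ l → v.length = r) :
    ∃ f : Fin n → Option (RegVal r), (List.ofFn fun q => (f q).map fun ν => List.ofFn ν) = l := by
  refine exists_ofFn_eq (f := fun o : Option (RegVal r) => o.map fun ν => List.ofFn ν) hl ?_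
  rintro (_ | v) hv
  · exact ⟨none, rfl⟩
  · obtain ⟨ν, rfl⟩ := exists_ofFn_eq (f := id) (h v hv) fun b _ => ⟨b, rfl⟩
    exact ⟨some ν, rfl⟩

end TransitionCode

theorem code_trans (T : NSST) : T.code.trans = T.trans.map transitionCode := rfl

theorem mem_code_init {T : NSST} {v : ValTable} (hv : some v ∈ T.code.init) :
    ∃ q ν, T.init q = some ν ∧ List.ofFn ν = v := by
  obtain ⟨q, hq⟩ := List.mem_ofFn.1 hv
  exact ⟨q, Option.map_eq_some_iff.1 hq⟩

theorem mem_code_final {T : NSST} {u : Word ℕ} (hu : some u ∈ T.code.final) :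
    ∃ q v, T.final q = some v ∧ wordCode v = u := by
  obtain ⟨q, hq⟩ := List.mem_ofFn.1 hu
  exact ⟨q, Option.map_eq_some_iff.1 hq⟩

theorem wellFormed_code (T : NSST) : T.code.WellFormed where
  src_lt := List.forall_mem_map.2 fun t _ => t.src.isLt
  dst_lt := List.forall_mem_map.2 fun t _ => t.dst.isLt
  letter_mem := List.forall_mem_map.2 fun t ht => (Finset.mem_sort _).2 (T.trans_letter_mem t ht)
  asg_copyless := List.forall_mem_map.2 fun t ht => isCopyless_asgCode.2 (T.trans_asg_copyless t ht)
  asg_over := List.forall_mem_map.2 fun t ht => letters_asgCode_subset.2 (T.trans_asg_over t ht)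
  init_length := List.length_ofFn
  init_table_length v hv := by
    obtain ⟨q, ν, -, rfl⟩ := mem_code_init hv
    exact List.length_ofFn
  init_over v hv w hw o ho := by
    obtain ⟨q, ν, hν, rfl⟩ := mem_code_init hv
    obtain ⟨X, hX⟩ := List.mem_ofFn.1 hw
    exact (Finset.mem_sort _).2 (T.init_over q ν hν X w hX o ho)
  final_length := List.length_ofFn
  final_linear u hu := by
    obtain ⟨q, v, hv, rfl⟩ := mem_code_final hu
    exact isLinear_wordCode.2 (T.final_copyless q v hv)
  final_over u hu o ho := by
    obtain ⟨q, v, hv, rfl⟩ := mem_code_final hu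
    exact (Finset.mem_sort _).2 (T.final_over q v hv o (mem_letters_wordCode.1 ho))

theorem exists_code_eq {c : Code} (hc : c.WellFormed) {A B : Finset ℕ} (hA : c.inAlph = A.sort)
    (hB : c.outAlph = B.sort) : ∃ T : NSST, T.code = c ∧ T.inAlph = A ∧ T.outAlph = B := by
  obtain ⟨trans, htrans⟩ := exists_map_transitionCode_eq hc.src_lt hc.dst_lt hc.asg_copyless
  obtain ⟨init, hinit⟩ := exists_ofFn_ofFn_eq hc.init_length hc.init_table_length
  obtain ⟨final, hfinal⟩ := exists_ofFn_eq hc.final_length fun o ho =>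
    exists_map_wordCode_eq fun u hu => (hc.final_linear u (hu ▸ ho)).lt_of_mem
  have mem_trans : ∀ t ∈ trans, transitionCode t ∈ c.trans :=
    fun t ht => htrans ▸ List.mem_map_of_mem ht
  have mem_init : ∀ q ν, init q = some ν → some (List.ofFn ν) ∈ c.init :=
    fun q ν hν => hinit ▸ List.mem_ofFn.2 ⟨q, by rw [hν, Option.map_some]⟩
  have mem_final : ∀ q u, final q = some u → some (wordCode u) ∈ c.final :=
    fun q u hu => hfinal ▸ List.mem_ofFn.2 ⟨q, by rw [hu, Option.map_some]⟩
  have mem_B : ∀ {o}, o ∈ c.outAlph → o ∈ B := fun ho => (Finset.mem_sort _).1 (hB ▸ ho)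
  let T : NSST :=
    { numStates := c.numStates, numRegs := c.numRegs, inAlph := A, outAlph := B
      trans, init, final
      trans_letter_mem := fun t ht =>
        (Finset.mem_sort _).1 (hA ▸ hc.letter_mem _ (mem_trans t ht))
      trans_asg_over := fun t ht =>
        letters_asgCode_subset.1 (hB ▸ hc.asg_over _ (mem_trans t ht))
      trans_asg_copyless := fun t ht => isCopyless_asgCode.1 (hc.asg_copyless _ (mem_trans t ht))
      init_over := fun q ν hν X u hu o ho =>
        mem_B (hc.init_over _ (mem_init q ν hν) u (List.mem_ofFn.2 ⟨X, hu⟩) ho)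
      final_over := fun q u hu o ho =>
        mem_B (hc.final_over _ (mem_final q u hu) (mem_letters_wordCode.2 ho))
      final_copyless := fun q u hu => isLinear_wordCode.1 (hc.final_linear _ (mem_final q u hu)) }
  refine ⟨T, ?_, rfl, rfl⟩
  calc T.code = (c.numStates, c.numRegs, A.sort, B.sort, c.trans, c.init, c.final) := by
        rw [← htrans, ← hinit, ← hfinal]; rfl
    _ = c := by rw [← hA, ← hB]

/-! ### Machines and their bag semantics -/

/-- Valuations of registers that are given by their numbers. -/
abbrev Val : Type := ℕ → Option (List ℕ)

/-- The valuation given by a table. -/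
def tableVal (l : ValTable) : Val := fun X => l.getD X none

/-- The valuation of all numbers that extends a valuation of the registers `Fin r`. -/
def extendVal {r : ℕ} (ν : RegVal r) : Val := fun X => if h : X < r then ν ⟨X, h⟩ else none

/-- The extension of a valuation to words. -/
def evalWord (ν : Val) : Word ℕ → Option (List ℕ)
  | [] => some []
  | Sum.inl X :: u => (ν X).bind fun x => (evalWord ν u).map fun y => x ++ y
  | Sum.inr o :: u => (evalWord ν u).map fun y => o :: y

/-- The composition of a valuation and an assignment. -/
def compVal (ν : Val) (σ : Asg ℕ) : Val := fun X => (σ.getD X none).bind (evalWord ν)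

/-- A relaxed form of transducers, closer to what the construction of the composition produces: a
state may occur in several initial configurations and may have several output words. -/
structure Machine (S : Type) where
  /-- The initial configurations. -/
  ini : List (S × ValTable)
  /-- The letters, assignments and targets of the transitions from a state. -/
  step : S → List (ℕ × Asg ℕ × S)
  /-- The output words of a state. -/
  fin : S → List (Word ℕ)

namespace Machine

variable {S : Type} (M : Machine S)

/-- The bag of outputs of the runs from a configuration. -/
def outFrom : List ℕ → S → Val → Multiset (List ℕ)
  | [], s, ν => lsum (M.fin s) fun u => ((evalWord ν u).toList : Multiset (List ℕ))
  | a :: w, s, ν => lsum ((M.step s).filter fun t => decide (t.1 = a)) fun t =>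
      outFrom w t.2.2 (compVal ν t.2.1)

/-- The bag of outputs of all runs. -/
def sem (w : List ℕ) : Multiset (List ℕ) := lsum M.ini fun e => M.outFrom w e.1 (tableVal e.2)

end Machine

/-- The machine described by a code. -/
def Code.machine (c : Code) : Machine ℕ where
  ini := (List.range c.numStates).flatMap fun q => (c.init.getD q none).toList.map fun v => (q, v)
  step q := (c.trans.filter fun t => decide (t.src = q)).map fun t => (t.letter, t.asg, t.dst)
  fin q := (c.final.getD q none).toList

theorem getD_ofFn {α : Type*} {r : ℕ} (f : Fin r → α) (d : α) (X : ℕ) :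
    (List.ofFn f).getD X d = if h : X < r then f ⟨X, h⟩ else d := by
  simp only [List.getD_eq_getElem?_getD, List.getElem?_ofFn]
  split <;> simp

theorem evalWord_wordCode {r : ℕ} (ν : RegVal r) (u : RegWord r) :
    evalWord (extendVal ν) (wordCode u) = ν.eval u := by
  induction u with
  | nil => rfl
  | cons x u ih =>
    rw [wordCode] at ih
    cases x <;> simp [wordCode, evalWord, RegVal.eval, ih, extendVal]

theorem compVal_asgCode {r : ℕ} (ν : RegVal r) (σ : Assignment r) :
    compVal (extendVal ν) (asgCode σ) = extendVal (ν.comp σ) := by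
  funext X
  simp only [compVal, asgCode, getD_ofFn, extendVal, RegVal.comp]
  split
  · case isTrue hX =>
    cases σ ⟨X, hX⟩ with
    | none => rfl
    | some u => exact evalWord_wordCode ν u
  · rfl

theorem tableVal_ofFn {r : ℕ} (ν : RegVal r) : tableVal (List.ofFn ν) = extendVal ν := by
  funext X
  simp only [tableVal, getD_ofFn, extendVal]

section Semantics

variable (T : NSST)

theorem init_code_machine :
    T.code.machine.ini = (List.finRange T.numStates).flatMap fun q =>
      (T.init q).toList.map fun ν => (q.val, List.ofFn ν) := by
  have hrange : List.range T.code.numStates = (List.finRange T.numStates).map Fin.val := by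
    simp [code]
  rw [Code.machine, hrange, List.flatMap_map]
  refine List.flatMap_congr fun q _ => ?_
  cases h : T.init q <;> simp [code, Code.init, h]

theorem fin_code_machine (q : Fin T.numStates) :
    T.code.machine.fin q = (T.final q).toList.map wordCode := by
  cases h : T.final q <;> simp [Code.machine, code, Code.final, h]

theorem step_code_machine (q : Fin T.numStates) :
    T.code.machine.step q = (T.trans.filter fun t => decide (t.src = q)).map fun t =>
      (t.letter, asgCode t.asg, t.dst.val) := by
  simp only [Code.machine, code_trans, List.filter_map, List.map_map]
  refine congrArg _ (List.filter_congr fun t _ => ?_)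
  exact decide_eq_decide.2 Fin.ext_iff.symm

theorem last_cons (c c' : T.Config) (σ : Assignment T.numRegs)
    (ρ : List (Assignment T.numRegs × T.Config)) :
    Run.last (T := T) (c, (σ, c') :: ρ) = Run.last (T := T) (c', ρ) := by
  cases ρ with
  | nil => rfl
  | cons x ρ => simp [Run.last, List.getLast?_cons]

theorem filterMap_bind {α β γ : Type*} (s : Multiset α) (f : α → Multiset β) (g : β → Option γ) :
    (s.bind f).filterMap g = s.bind fun a => (f a).filterMap g := by
  induction s using Multiset.induction <;> simp_all [Multiset.filterMap_add]

theorem filterMap_out_stepsFrom (w : List ℕ) (c : T.Config) :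
    (T.stepsFrom c w).filterMap (fun ρ => Run.out (T := T) (c, ρ)) =
      T.code.machine.outFrom w c.1 (extendVal c.2) := by
  induction w generalizing c with
  | nil =>
    simp only [stepsFrom, Machine.outFrom, fin_code_machine, lsum_map, evalWord_wordCode, Run.out,
      Run.last]
    cases hf : T.final c.1 with
    | none => simp [hf, ← Multiset.cons_zero]
    | some u => cases he : c.2.eval u <;> simp [hf, he, ← Multiset.cons_zero]
  | cons a w ih =>
    rw [stepsFrom, filterMap_bind, Multiset.filter_coe, coe_bind_eq_lsum]
    simp only [Machine.outFrom, step_code_machine, Multiset.filterMap_map, Function.comp_def,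
      List.filter_map, lsum_map, List.filter_filter]
    have hfilter : T.trans.filter (fun t => decide (t.src = c.1 ∧ t.letter = a)) =
        T.trans.filter fun t => decide (t.letter = a) && decide (t.src = c.1) :=
      List.filter_congr fun t _ => by rw [Bool.decide_and, Bool.and_comm]
    rw [hfilter]
    refine lsum_congr fun t _ => ?_
    rw [compVal_asgCode, ← ih (t.dst, c.2.comp t.asg)]
    exact congrArg (Multiset.filterMap · _) (funext fun ρ => by simp only [Run.out, last_cons])

theorem sem_eq_sem_machine (w : List ℕ) : T.sem w = T.code.machine.sem w := by
  have hsem : T.sem w = (T.allRuns w).filterMap Run.out := by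
    rw [sem, runs, Multiset.filterMap_filter]
    refine congrArg (Multiset.filterMap · _) (funext fun ρ => ?_)
    cases h : Run.out ρ <;> simp
  have huniv : (Finset.univ : Finset (Fin T.numStates)).val =
      ((List.finRange T.numStates : List (Fin T.numStates)) : Multiset _) := rfl
  rw [hsem, allRuns, filterMap_bind, huniv, coe_bind_eq_lsum, Machine.sem, init_code_machine,
    lsum_flatMap]
  refine lsum_congr fun q _ => ?_
  cases hq : T.init q with
  | none => simp
  | some ν =>
    simp only [Multiset.filterMap_map, lsum_map, Option.toList_some, lsum_singleton, tableVal_ofFn]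
    exact filterMap_out_stepsFrom T w (q, ν)

end Semantics

/-! ### From machines to codes -/

theorem lsum_product {α β M : Type*} [AddCommMonoid M] (l : List α) (l' : List β)
    (f : α × β → M) : lsum (l ×ˢ l') f = lsum l fun a => lsum l' fun b => f (a, b) := by
  simp only [SProd.sprod, List.product, lsum_flatMap, lsum_map]

namespace Machine

theorem outFrom_map {S S' : Type} {M : Machine S} {N : Machine S'} {S₀ : List S} {e : S → S'}
    (hmem : ∀ s ∈ S₀, ∀ t ∈ M.step s, t.2.2 ∈ S₀)
    (hstep : ∀ s ∈ S₀, N.step (e s) = (M.step s).map fun t => (t.1, t.2.1, e t.2.2))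
    (hfin : ∀ s ∈ S₀, N.fin (e s) = M.fin s) (w : List ℕ) {s : S} (hs : s ∈ S₀) (ν : Val) :
    N.outFrom w (e s) ν = M.outFrom w s ν := by
  induction w generalizing s ν with
  | nil => rw [outFrom, outFrom, hfin s hs]
  | cons a w ih =>
    rw [outFrom, outFrom, hstep s hs, List.filter_map, lsum_map]
    exact lsum_congr fun t ht => ih (hmem s hs t (List.mem_of_mem_filter ht)) _

end Machine

section NumberedCode

variable {S : Type} [DecidableEq S]

/-- The code of the transducer whose states are the entries of the list `S₀`. -/
def numberedCode (S₀ : List S) (r : ℕ) (inA outA : List ℕ) (step : S → List (ℕ × Asg ℕ × S))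
    (init : S → Option ValTable) (final : S → Option (Word ℕ)) : Code :=
  (S₀.length, r, inA, outA,
    S₀.flatMap fun s => (step s).map fun t => (S₀.idxOf s, t.1, t.2.1, S₀.idxOf t.2.2),
    S₀.map init, S₀.map final)

theorem mem_trans_numberedCode {S₀ : List S} {r : ℕ} {inA outA : List ℕ}
    {step : S → List (ℕ × Asg ℕ × S)} {init : S → Option ValTable} {final : S → Option (Word ℕ)}
    {t : TransCode ℕ ℕ} (ht : t ∈ (numberedCode S₀ r inA outA step init final).trans) :
    ∃ s ∈ S₀, ∃ t' ∈ step s, t = (S₀.idxOf s, t'.1, t'.2.1, S₀.idxOf t'.2.2) := by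
  obtain ⟨s, hs, ht⟩ := List.mem_flatMap.1 ht
  obtain ⟨t', ht', rfl⟩ := List.mem_map.1 ht
  exact ⟨s, hs, t', ht', rfl⟩

theorem src_dst_lt_of_mem_trans_numberedCode {S₀ : List S} {r : ℕ} {inA outA : List ℕ}
    {step : S → List (ℕ × Asg ℕ × S)} {init : S → Option ValTable} {final : S → Option (Word ℕ)}
    (hstep : ∀ s ∈ S₀, ∀ t ∈ step s, t.2.2 ∈ S₀) {t : TransCode ℕ ℕ}
    (ht : t ∈ (numberedCode S₀ r inA outA step init final).trans) :
    t.src < S₀.length ∧ t.dst < S₀.length := by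
  obtain ⟨s, hs, t', ht', rfl⟩ := mem_trans_numberedCode ht
  exact ⟨List.idxOf_lt_length_of_mem hs, List.idxOf_lt_length_of_mem (hstep s hs t' ht')⟩

theorem getD_map_idxOf {α : Type*} {S₀ : List S} {s : S} (hs : s ∈ S₀) (f : S → α) (d : α) :
    (S₀.map f).getD (S₀.idxOf s) d = f s := by
  simp [List.getD_eq_getElem?_getD, List.getElem?_idxOf hs]

theorem map_idxOf_eq_range {S₀ : List S} (hS : S₀.Nodup) :
    S₀.map S₀.idxOf = List.range S₀.length :=
  List.ext_getElem (by simp) fun i _ _ => by simp [hS.idxOf_getElem]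

theorem flatMap_cond_eq {α : Type*} {S₀ : List S} (hS : S₀.Nodup) {s : S} (hs : s ∈ S₀)
    (f : S → List α) : (S₀.flatMap fun s' => bif decide (s' = s) then f s' else []) = f s := by
  induction S₀ with
  | nil => simp at hs
  | cons s' S₀ ih =>
    obtain ⟨hs', hS⟩ := List.nodup_cons.1 hS
    by_cases hss : s' = s
    · subst hss
      have hrest : (S₀.flatMap fun s₁ => bif decide (s₁ = s') then f s₁ else []) = [] :=
        List.flatMap_eq_nil_iff.2 fun s₁ h₁ => by simp [show s₁ ≠ s' by rintro rfl; exact hs' h₁]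
      simp [hrest]
    · simp [hss, ih hS (by simpa [Ne.symm hss] using hs)]

theorem step_numberedCode {S₀ : List S} (hS : S₀.Nodup) (step : S → List (ℕ × Asg ℕ × S)) (r : ℕ)
    (inA outA : List ℕ) (init : S → Option ValTable) (final : S → Option (Word ℕ)) {s : S}
    (hs : s ∈ S₀) :
    (numberedCode S₀ r inA outA step init final).machine.step (S₀.idxOf s) =
      (step s).map fun t => (t.1, t.2.1, S₀.idxOf t.2.2) := by
  simp only [Code.machine, numberedCode, Code.trans, List.filter_flatMap, List.map_flatMap,
    List.filter_map, List.map_map]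
  rw [← flatMap_cond_eq hS hs fun s => (step s).map fun t => (t.1, t.2.1, S₀.idxOf t.2.2)]
  refine List.flatMap_congr fun s' hs' => ?_
  by_cases hss : s' = s
  · simp [hss, Function.comp_def]
  · have hidx : S₀.idxOf s' ≠ S₀.idxOf s := fun h => hss ((List.idxOf_inj hs').1 h)
    simp [hss, Function.comp_def, hidx]

theorem sem_numberedCode {S₀ : List S} (hS : S₀.Nodup) {step : S → List (ℕ × Asg ℕ × S)}
    (hstep : ∀ s ∈ S₀, ∀ t ∈ step s, t.2.2 ∈ S₀) (r : ℕ) (inA outA : List ℕ)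
    (init : S → Option ValTable) (final : S → Option (Word ℕ)) (w : List ℕ) :
    (numberedCode S₀ r inA outA step init final).machine.sem w = lsum S₀ fun s =>
      lsum (init s).toList fun v =>
        Machine.outFrom ⟨[], step, fun s => (final s).toList⟩ w s (tableVal v) := by
  have hini : (numberedCode S₀ r inA outA step init final).machine.ini =
      S₀.flatMap fun s => (init s).toList.map fun v => (S₀.idxOf s, v) := by
    simp only [Code.machine, numberedCode, ← map_idxOf_eq_range hS, List.flatMap_map]
    exact List.flatMap_congr fun s hs => by rw [Code.init, getD_map_idxOf hs]
  simp only [Machine.sem, hini, lsum_flatMap, lsum_map]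
  refine lsum_congr fun s hs => lsum_congr fun v _ => ?_
  refine Machine.outFrom_map (M := ⟨[], step, fun s => (final s).toList⟩) (e := S₀.idxOf) hstep
    (fun s => step_numberedCode hS step r inA outA init final) (fun s hs => ?_) w hs _
  exact congrArg Option.toList (getD_map_idxOf hs final none)

end NumberedCode

namespace Machine

variable {S : Type} (M : Machine S)

/-- The closed and well-behaved machines: the entries of `S₀` are the states, the numbers less than
`r` are the registers, and the alphabets are `inA` and `outA`. -/
structure WellFormed (S₀ : List S) (r : ℕ) (inA outA : List ℕ) : Prop where
  ini_mem : ∀ e ∈ M.ini, e.1 ∈ S₀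
  ini_length : ∀ e ∈ M.ini, e.2.length = r
  ini_over : ∀ e ∈ M.ini, ∀ w, some w ∈ e.2 → w ⊆ outA
  step_mem : ∀ s ∈ S₀, ∀ t ∈ M.step s, t.2.2 ∈ S₀
  step_letter : ∀ s ∈ S₀, ∀ t ∈ M.step s, t.1 ∈ inA
  step_copyless : ∀ s ∈ S₀, ∀ t ∈ M.step s, IsCopyless r t.2.1
  step_over : ∀ s ∈ S₀, ∀ t ∈ M.step s, letters (flat t.2.1) ⊆ outA
  fin_linear : ∀ s ∈ S₀, ∀ u ∈ M.fin s, IsLinear r u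
  fin_over : ∀ s ∈ S₀, ∀ u ∈ M.fin s, letters u ⊆ outA

/-- A number that exceeds the number of output words of every state in `S₀`. -/
def finBound (S₀ : List S) : ℕ := (S₀.flatMap M.fin).length + 1

/-- The states of the transducer that simulates a machine. In `(k, l, s)`, the number `k` selects an
initial configuration, and `l` announces the output word used if the run ends in this state. -/
def copies (S₀ : List S) : List (ℕ × ℕ × S) :=
  List.range (M.ini.length + 1) ×ˢ List.range (M.finBound S₀) ×ˢ S₀

/-- The transitions between copies of states. Only the copies with `l = 0` can be left, so that
every run visits exactly one copy of each of its states except the last. -/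
def copyStep (L : ℕ) (s : ℕ × ℕ × S) : List (ℕ × Asg ℕ × ℕ × ℕ × S) :=
  bif decide (0 = s.2.1) then
    (M.step s.2.2).flatMap fun t => (List.range L).map fun l => (t.1, t.2.1, 0, l, t.2.2)
  else []

/-- The initial function on the copies of the states. -/
def copyInit [DecidableEq S] (s : ℕ × ℕ × S) : Option ValTable :=
  M.ini[s.1]?.bind fun e => bif decide (e.1 = s.2.2) then some e.2 else none

/-- The final function on the copies of the states. -/
def copyFinal (s : ℕ × ℕ × S) : Option (Word ℕ) := (M.fin s.2.2)[s.2.1]?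

/-- The code of a transducer with `r` registers that simulates a machine on the states `S₀`. -/
def toCode [DecidableEq S] (S₀ : List S) (r : ℕ) (inA outA : List ℕ) : Code :=
  numberedCode (M.copies S₀) r inA outA (M.copyStep (M.finBound S₀)) M.copyInit M.copyFinal

variable {M} {S₀ : List S}

theorem length_fin_lt_finBound {s : S} (hs : s ∈ S₀) : (M.fin s).length < M.finBound S₀ := by
  rw [finBound, Nat.lt_add_one_iff, List.length_flatMap]
  exact List.single_le_sum (by simp) _ (List.mem_map_of_mem hs)

theorem mem_copies {s : ℕ × ℕ × S} :
    s ∈ M.copies S₀ ↔ s.1 < M.ini.length + 1 ∧ s.2.1 < M.finBound S₀ ∧ s.2.2 ∈ S₀ := by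
  obtain ⟨k, l, s⟩ := s
  simp only [copies, List.mem_product, List.mem_range]

theorem nodup_copies (hS : S₀.Nodup) : (M.copies S₀).Nodup :=
  List.nodup_range.product (List.nodup_range.product hS)

theorem mem_copyStep {L : ℕ} {s : ℕ × ℕ × S} {t : ℕ × Asg ℕ × ℕ × ℕ × S}
    (ht : t ∈ M.copyStep L s) : (t.1, t.2.1, t.2.2.2.2) ∈ M.step s.2.2 ∧ t.2.2.1 = 0 ∧
      t.2.2.2.1 < L := by
  rw [copyStep] at ht
  cases h : decide (0 = s.2.1) <;> rw [h] at ht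
  · simp at ht
  · simp only [cond_true, List.mem_flatMap, List.mem_map, List.mem_range] at ht
    obtain ⟨t', ht', l, hl, rfl⟩ := ht
    exact ⟨ht', rfl, hl⟩

theorem copyStep_mem_copies (hstep : ∀ s ∈ S₀, ∀ t ∈ M.step s, t.2.2 ∈ S₀) (s : ℕ × ℕ × S)
    (hs : s ∈ M.copies S₀) (t : ℕ × Asg ℕ × ℕ × ℕ × S)
    (ht : t ∈ M.copyStep (M.finBound S₀) s) : t.2.2 ∈ M.copies S₀ := by
  obtain ⟨ht, hk, hl⟩ := mem_copyStep ht
  exact mem_copies.2 ⟨by lia, hl, hstep _ (mem_copies.1 hs).2.2 _ ht⟩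

theorem lsum_outFrom_copies (hstep : ∀ s ∈ S₀, ∀ t ∈ M.step s, t.2.2 ∈ S₀) (w : List ℕ) (k : ℕ)
    {s : S} (hs : s ∈ S₀) (ν : Val) :
    (lsum (List.range (M.finBound S₀)) fun l =>
      outFrom ⟨[], M.copyStep (M.finBound S₀), fun s => (M.copyFinal s).toList⟩ w (k, l, s) ν) =
      M.outFrom w s ν := by
  induction w generalizing k s ν with
  | nil => exact lsum_range_getElem? _ (length_fin_lt_finBound hs).le _
  | cons a w ih =>
    simp only [outFrom, copyStep, lsum_filter, lsum_cond, lsum_nil, lsum_flatMap, lsum_map]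
    rw [lsum_cond_eq List.nodup_range
      (List.mem_range.2 (Nat.zero_lt_of_lt (length_fin_lt_finBound hs)))]
    refine lsum_congr fun t ht => ?_
    rw [← ih 0 (hstep s hs t ht)]
    exact lsum_cond_zero (decide (t.1 = a)) _ _

theorem sem_toCode [DecidableEq S] (hS : S₀.Nodup) {r : ℕ} {inA outA : List ℕ}
    (hM : M.WellFormed S₀ r inA outA) (w : List ℕ) :
    (M.toCode S₀ r inA outA).machine.sem w = M.sem w := by
  rw [toCode, sem_numberedCode (nodup_copies hS) (copyStep_mem_copies hM.step_mem)]
  have hcopies : ∀ k, (lsum (List.range (M.finBound S₀)) fun l => lsum S₀ fun s =>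
      lsum (M.copyInit (k, l, s)).toList fun v => outFrom ⟨[], M.copyStep (M.finBound S₀),
        fun s => (M.copyFinal s).toList⟩ w (k, l, s) (tableVal v)) =
      lsum M.ini[k]?.toList fun e => M.outFrom w e.1 (tableVal e.2) := by
    intro k
    cases he : M.ini[k]? with
    | none => simp [copyInit, he]
    | some e =>
      rw [lsum_comm, Option.toList_some, lsum_singleton,
        ← lsum_cond_eq hS (hM.ini_mem e (List.mem_of_getElem? he)) fun s =>
          M.outFrom w s (tableVal e.2)]
      refine lsum_congr fun s hs => ?_
      rw [← lsum_outFrom_copies hM.step_mem w k hs]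
      cases h : decide (e.1 = s) <;> simp [copyInit, he, h]
  simp only [copies, lsum_product, hcopies, Machine.sem]
  exact lsum_range_getElem? _ (Nat.le_succ _) _

theorem exists_step_of_mem_trans_toCode [DecidableEq S] {r : ℕ} {inA outA : List ℕ}
    {t : TransCode ℕ ℕ} (ht : t ∈ (M.toCode S₀ r inA outA).trans) :
    ∃ s ∈ S₀, ∃ s', (t.letter, t.asg, s') ∈ M.step s := by
  obtain ⟨s, hs, t', ht', rfl⟩ := mem_trans_numberedCode ht
  exact ⟨_, (mem_copies.1 hs).2.2, _, (mem_copyStep ht').1⟩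

theorem exists_ini_of_mem_init_toCode [DecidableEq S] {r : ℕ} {inA outA : List ℕ} {v : ValTable}
    (hv : some v ∈ (M.toCode S₀ r inA outA).init) : ∃ s, (s, v) ∈ M.ini := by
  obtain ⟨s, -, hs⟩ := List.mem_map.1 hv
  obtain ⟨e, he, hev⟩ := Option.bind_eq_some_iff.1 hs
  refine ⟨e.1, ?_⟩
  cases h : decide (e.1 = s.2.2) <;> rw [h] at hev <;> cases hev
  exact List.mem_of_getElem? he

theorem exists_fin_of_mem_final_toCode [DecidableEq S] {r : ℕ} {inA outA : List ℕ} {u : Word ℕ}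
    (hu : some u ∈ (M.toCode S₀ r inA outA).final) : ∃ s ∈ S₀, u ∈ M.fin s := by
  obtain ⟨s, hs, hsu⟩ := List.mem_map.1 hu
  exact ⟨_, (mem_copies.1 hs).2.2, List.mem_of_getElem? hsu⟩

theorem wellFormed_toCode [DecidableEq S] {r : ℕ} {inA outA : List ℕ}
    (hM : M.WellFormed S₀ r inA outA) : (M.toCode S₀ r inA outA).WellFormed where
  src_lt t ht :=
    (src_dst_lt_of_mem_trans_numberedCode (copyStep_mem_copies hM.step_mem) ht).1
  dst_lt t ht :=
    (src_dst_lt_of_mem_trans_numberedCode (copyStep_mem_copies hM.step_mem) ht).2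
  letter_mem t ht := by
    obtain ⟨s, hs, s', ht'⟩ := exists_step_of_mem_trans_toCode ht
    exact hM.step_letter s hs _ ht'
  asg_copyless t ht := by
    obtain ⟨s, hs, s', ht'⟩ := exists_step_of_mem_trans_toCode ht
    exact hM.step_copyless s hs _ ht'
  asg_over t ht := by
    obtain ⟨s, hs, s', ht'⟩ := exists_step_of_mem_trans_toCode ht
    exact hM.step_over s hs _ ht'
  init_length := List.length_map _
  init_table_length v hv := by
    obtain ⟨s, hs⟩ := exists_ini_of_mem_init_toCode hv
    exact hM.ini_length _ hs
  init_over v hv := by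
    obtain ⟨s, hs⟩ := exists_ini_of_mem_init_toCode hv
    exact hM.ini_over _ hs
  final_length := List.length_map _
  final_linear u hu := by
    obtain ⟨s, hs, hsu⟩ := exists_fin_of_mem_final_toCode hu
    exact hM.fin_linear s hs u hsu
  final_over u hu := by
    obtain ⟨s, hs, hsu⟩ := exists_fin_of_mem_final_toCode hu
    exact hM.fin_over s hs u hsu

end Machine

/-! ### Functionals of bags of choices -/

section Degree

variable {B M : Type*} [AddCommMonoid M]

/-- The degree of a functional in the list of choices available for `X`: degree `0` means that it
does not depend on this list, and degree `1` that it is additive in it. Nothing is said about higher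
degrees. -/
def HasDegree (X : ℕ) : ℕ → ((ℕ → List B) → M) → Prop
  | 0, Φ => ∀ J L, Φ (Function.update J X L) = Φ J
  | 1, Φ => ∀ J, Φ J = lsum (J X) fun b => Φ (Function.update J X [b])
  | _ + 2, _ => True

theorem hasDegree_const {X : ℕ} (x : M) : HasDegree X 0 fun _ : ℕ → List B => x := fun _ _ => rfl

theorem hasDegree_lsum {α : Type*} {X n : ℕ} {Φ : α → (ℕ → List B) → M} (l : List α)
    (h : ∀ a, HasDegree X n (Φ a)) : HasDegree X n fun J => lsum l fun a => Φ a J := by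
  match n, h with
  | 0, h => exact fun J L => lsum_congr fun a _ => h a J L
  | 1, h =>
    intro J
    rw [lsum_comm]
    exact lsum_congr fun a _ => h a J
  | _ + 2, _ => trivial

theorem hasDegree_lsum_self {α : Type*} {X n : ℕ} {Φ : α → (ℕ → List B) → M} (g : B → List α)
    (h : ∀ a, HasDegree X n (Φ a)) :
    HasDegree X (n + 1) fun J => lsum (J X) fun b => lsum (g b) fun a => Φ a J := by
  match n, h with
  | 0, h =>
    intro J
    refine lsum_congr fun b _ => ?_
    simp only [Function.update_self, lsum_singleton]
    exact lsum_congr fun a _ => (h a J [b]).symm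
  | _ + 1, _ => trivial

theorem hasDegree_lsum_of_ne {α : Type*} {X Y n : ℕ} (hY : Y ≠ X) {Φ : α → (ℕ → List B) → M}
    (g : B → List α) (h : ∀ a, HasDegree X n (Φ a)) :
    HasDegree X n fun J => lsum (J Y) fun b => lsum (g b) fun a => Φ a J := by
  match n, h with
  | 0, h =>
    intro J L
    simp only [Function.update_of_ne hY]
    exact lsum_congr fun b _ => lsum_congr fun a _ => h a J L
  | 1, h =>
    intro J
    simp only [Function.update_of_ne hY]
    rw [lsum_comm]
    refine lsum_congr fun b _ => ?_
    rw [lsum_comm]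
    exact lsum_congr fun a _ => h a J
  | _ + 2, _ => trivial

/-- The options for one register: one of the given choices if the register is selected. -/
def pick (b : Bool) (l : List B) : List (Option B) := bif b then l.map fun x => some x else [none]

/-- The choices of a family, register by register. -/
def familyChoices (fam : List (Option B)) (X : ℕ) : List B := (fam.getD X none).toList

/-- The sequence with head `L` and tail `J`. -/
def consChoices (L : List B) (J : ℕ → List B) : ℕ → List B
  | 0 => L
  | X + 1 => J X

theorem consChoices_head_tail (J : ℕ → List B) : consChoices (J 0) (fun X => J (X + 1)) = J := by
  funext X
  cases X <;> rfl

theorem familyChoices_cons (x : Option B) (fam : List (Option B)) :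
    familyChoices (x :: fam) = consChoices x.toList (familyChoices fam) := by
  funext X
  cases X <;> rfl

theorem update_consChoices_zero (L L' : List B) (J : ℕ → List B) :
    Function.update (consChoices L J) 0 L' = consChoices L' J := by
  funext X
  cases X <;> simp [consChoices]

theorem update_consChoices_succ (L L' : List B) (J : ℕ → List B) (X : ℕ) :
    Function.update (consChoices L J) (X + 1) L' =
      consChoices L (Function.update J X L') := by
  funext Y
  cases Y <;> simp [consChoices, Function.update_apply]

theorem HasDegree.comp_consChoices {X n : ℕ} {Φ : (ℕ → List B) → M}
    (h : HasDegree (X + 1) n Φ) (L : List B) :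
    HasDegree X n fun J => Φ (consChoices L J) := by
  match n, h with
  | 0, h =>
    intro J L'
    simp only [← update_consChoices_succ]
    exact h (consChoices L J) L'
  | 1, h =>
    intro J
    simp only [← update_consChoices_succ]
    exact h (consChoices L J)
  | _ + 2, _ => trivial

theorem HasDegree.eq_lsum_pick {Φ : (ℕ → List B) → M} {b : Bool}
    (h : HasDegree 0 (if b then 1 else 0) Φ) (J : ℕ → List B) :
    Φ J = lsum (pick b (J 0)) fun x => Φ (consChoices x.toList fun X => J (X + 1)) := by
  have hupdate : ∀ L, Function.update J 0 L = consChoices L fun X => J (X + 1) := fun L => by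
    conv_lhs => rw [← consChoices_head_tail J]
    exact update_consChoices_zero _ L _
  cases b with
  | false =>
    simpa only [pick, cond_false, lsum_singleton, Option.toList_none, ← hupdate] using (h J []).symm
  | true => simpa only [pick, cond_true, lsum_map, Option.toList_some, ← hupdate] using h J

theorem eq_lsum_sections {Φ : (ℕ → List B) → M} {A : ℕ → Bool} {m : ℕ} {J : ℕ → List B}
    (hJ : ∀ X, m ≤ X → J X = []) (hΦ : ∀ X < m, HasDegree X (if A X then 1 else 0) Φ) :
    Φ J = lsum ((List.range m).map fun X => pick (A X) (J X)).sections fun fam =>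
      Φ (familyChoices fam) := by
  induction m generalizing Φ A J with
  | zero =>
    have hempty : J = familyChoices [] := funext fun X => hJ X X.zero_le
    simp [List.sections, hempty]
  | succ m ih =>
    rw [List.range_succ_eq_map, List.map_cons, List.map_map, lsum_sections_cons, lsum_comm,
      (hΦ 0 m.succ_pos).eq_lsum_pick J]
    refine lsum_congr fun x _ => ?_
    simp only [familyChoices_cons]
    exact ih (fun X hX => hJ _ (Nat.succ_le_succ hX)) fun X hX =>
      (hΦ _ (Nat.succ_lt_succ hX)).comp_consChoices _

end Degree

/-! ### Runs on words over registers and letters -/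

/-- A run of the second transducer on a factor of its input, condensed to its first state, its last
state and its effect on the registers. -/
structure Block (Γ : Type) where
  /-- The first state. -/
  src : ℕ
  /-- The last state. -/
  dst : ℕ
  /-- The effect on the registers. -/
  asg : Asg Γ

section TokenRuns

variable {Γ : Type} (δ : ℕ → ℕ → List (ℕ × Asg Γ)) (J : ℕ → List (Block Γ))

/-- The moves of the second transducer from the state `p` on a letter, given by `δ`, or on a
register `X` of the first transducer, whose content is skipped by one of the blocks `J X`. -/
def moves (p : ℕ) : ℕ ⊕ ℕ → List (ℕ × Asg Γ)
  | Sum.inl X => ((J X).filter fun b => decide (b.src = p)).map fun b => (b.dst, b.asg)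
  | Sum.inr o => δ p o

/-- The runs of the second transducer on a word that extend a given partial run, which is recorded
by its last state and its effect on the registers. -/
def tokenRuns : Word ℕ → ℕ × Asg Γ → List (ℕ × Asg Γ)
  | [], c => [c]
  | x :: u, c => (moves δ J c.1 x).flatMap fun d => tokenRuns u (d.1, compAsg c.2 d.2)

/-- The blocks on a word, for a transducer with `n` states and `r` registers. -/
def blocks (n r : ℕ) (u : Word ℕ) : List (Block Γ) :=
  (List.range n).flatMap fun p => (tokenRuns δ J u (p, idAsg r)).map fun d => ⟨p, d.1, d.2⟩

/-- The families of blocks on the words `σ X`, for the registers `X < m` selected by `A`. -/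
def families (n r m : ℕ) (A : List Bool) (σ : ℕ → Option (Word ℕ)) :
    List (List (Option (Block Γ))) :=
  ((List.range m).map fun X =>
    pick (A.getD X false) ((σ X).elim [] (blocks δ J n r))).sections

/-- The concatenation of the words assigned by `σ` to the registers `X < m` selected by `A`. -/
def selected (m : ℕ) (A : List Bool) (σ : ℕ → Option (Word ℕ)) : Word ℕ :=
  (List.range m).flatMap fun X => bif A.getD X false then (σ X).getD [] else []

variable {δ J}

theorem tokenRuns_append (u v : Word ℕ) (c : ℕ × Asg Γ) :
    tokenRuns δ J (u ++ v) c = (tokenRuns δ J u c).flatMap (tokenRuns δ J v) := by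
  induction u generalizing c with
  | nil => simp [tokenRuns]
  | cons x u ih => simp only [List.cons_append, tokenRuns, ih, List.flatMap_assoc]

theorem tokenRuns_induction {P : ℕ × Asg Γ → Prop} {u : Word ℕ}
    (h : ∀ x ∈ u, ∀ c, P c → ∀ d ∈ moves δ J c.1 x, P (d.1, compAsg c.2 d.2))
    {c : ℕ × Asg Γ} (hc : P c) : ∀ d ∈ tokenRuns δ J u c, P d := by
  induction u generalizing c with
  | nil => simpa [tokenRuns] using hc
  | cons x u ih =>
    intro d hd
    obtain ⟨e, he, hd⟩ := List.mem_flatMap.1 hd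
    exact ih (fun y hy => h y (List.mem_cons_of_mem _ hy)) (h x List.mem_cons_self c hc e he) d hd

section Degree

variable {M : Type*} [AddCommMonoid M] {X n : ℕ}

theorem hasDegree_tokenRuns {Φ : ℕ × Asg Γ → (ℕ → List (Block Γ)) → M}
    (h : ∀ d, HasDegree X n (Φ d)) (u : Word ℕ) (c : ℕ × Asg Γ) :
    HasDegree X (n + u.count (Sum.inl X)) fun J => lsum (tokenRuns δ J u c) fun d => Φ d J := by
  induction u generalizing c with
  | nil => simpa [tokenRuns] using h c
  | cons x u ih =>
    simp only [tokenRuns, lsum_flatMap]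
    cases x with
    | inr o =>
      rw [List.count_cons_of_ne (by simp)]
      exact hasDegree_lsum _ fun d => ih _
    | inl Y =>
      have hmoves : ∀ J : ℕ → List (Block Γ), (lsum (moves δ J c.1 (Sum.inl Y)) fun d =>
          lsum (tokenRuns δ J u (d.1, compAsg c.2 d.2)) fun d => Φ d J) =
          lsum (J Y) fun b => lsum (bif decide (b.src = c.1) then [(b.dst, b.asg)] else []) fun d =>
            lsum (tokenRuns δ J u (d.1, compAsg c.2 d.2)) fun d => Φ d J := fun J => by
        simp only [moves, lsum_map, lsum_filter, lsum_cond, lsum_singleton, lsum_nil]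
      simp only [hmoves]
      by_cases hY : Y = X
      · subst hY
        rw [List.count_cons_self]
        exact hasDegree_lsum_self _ fun d => ih _
      · rw [List.count_cons_of_ne (by simpa using hY)]
        exact hasDegree_lsum_of_ne hY _ fun d => ih _

theorem hasDegree_blocks {k r : ℕ} {Φ : Block Γ → (ℕ → List (Block Γ)) → M}
    (h : ∀ d, HasDegree X n (Φ d)) (u : Word ℕ) :
    HasDegree X (n + u.count (Sum.inl X)) fun J => lsum (blocks δ J k r u) fun d => Φ d J := by
  simp only [blocks, lsum_flatMap, lsum_map]
  exact hasDegree_lsum _ fun p => hasDegree_tokenRuns (fun d => h ⟨p, d.1, d.2⟩) u _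

theorem hasDegree_families {k r m : ℕ} {Φ : List (Option (Block Γ)) → (ℕ → List (Block Γ)) → M}
    (h : ∀ d, HasDegree X n (Φ d)) (A : List Bool) (σ : ℕ → Option (Word ℕ)) :
    HasDegree X (n + (selected m A σ).count (Sum.inl X)) fun J =>
      lsum (families δ J k r m A σ) fun fam => Φ fam J := by
  unfold families selected
  induction List.range m generalizing n Φ with
  | nil => simpa [List.sections] using h []
  | cons Y l ih =>
    simp only [List.map_cons, lsum_sections_cons, List.flatMap_cons, List.count_append, ← add_assoc]
    refine ih fun s => ?_
    cases A.getD Y false with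
    | false => simpa [pick] using h _
    | true =>
      simp only [pick, cond_true, lsum_map]
      cases σ Y with
      | none => exact hasDegree_lsum (n := n + 0) [] fun d => h (some d :: s)
      | some u => exact hasDegree_blocks (fun d => h _) u

end Degree

end TokenRuns

/-! ### Runs on the contents of registers -/

section ValBlocks

variable {Γ : Type} {δ : ℕ → ℕ → List (ℕ × Asg Γ)} {J : ℕ → List (Block Γ)}

theorem tokenRuns_compAsg (u : Word ℕ) (p : ℕ) (σ τ : Asg Γ) :
    tokenRuns δ J u (p, compAsg σ τ) =
      (tokenRuns δ J u (p, τ)).map fun d => (d.1, compAsg σ d.2) := by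
  induction u generalizing p τ with
  | nil => rfl
  | cons x u ih => simp only [tokenRuns, List.map_flatMap, compAsg_assoc, ih]

theorem tokenRuns_eq_map (u : Word ℕ) (c : ℕ × Asg Γ) :
    tokenRuns δ J u c =
      (tokenRuns δ J u (c.1, idAsg c.2.length)).map fun d => (d.1, compAsg c.2 d.2) := by
  rw [← tokenRuns_compAsg, compAsg_idAsg]

theorem moves_blocks {n r X p : ℕ} (hp : p < n) {u : Word ℕ} {J' : ℕ → List (Block Γ)}
    (hX : J' X = blocks δ J n r u) :
    moves δ J' p (Sum.inl X) = tokenRuns δ J u (p, idAsg r) := by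
  simp only [moves, hX, blocks, List.filter_flatMap, List.map_flatMap]
  rw [← flatMap_cond_eq List.nodup_range (List.mem_range.2 hp) fun p =>
    tokenRuns δ J u (p, idAsg r)]
  refine List.flatMap_congr fun p' _ => ?_
  cases h : decide (p' = p) <;> simp [List.filter_map, Function.comp_def, h]

/-- The contents of registers under a valuation, as words over registers and letters. -/
def contentWord (ν : Val) (X : ℕ) : Option (Word ℕ) := (ν X).map (List.map Sum.inr)

/-- The blocks on the contents of registers under a valuation. -/
def valBlocks (δ : ℕ → ℕ → List (ℕ × Asg Γ)) (n r : ℕ) (ν : Val) (X : ℕ) : List (Block Γ) :=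
  (contentWord ν X).elim [] (blocks δ (fun _ => []) n r)

theorem state_and_length_of_mem_tokenRuns {n r : ℕ}
    (hδ : ∀ p o, ∀ d ∈ δ p o, d.1 < n ∧ d.2.length = r)
    (hJ : ∀ X, ∀ b ∈ J X, b.dst < n ∧ b.asg.length = r) (u : Word ℕ) {c : ℕ × Asg Γ}
    (hc : c.1 < n ∧ c.2.length = r) : ∀ d ∈ tokenRuns δ J u c, d.1 < n ∧ d.2.length = r := by
  refine tokenRuns_induction (P := fun d => d.1 < n ∧ d.2.length = r) (fun x _ c _ d hd => ?_) hc
  rw [length_compAsg]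
  cases x with
  | inr o => exact hδ c.1 o d hd
  | inl X =>
    obtain ⟨b, hb, rfl⟩ := List.mem_map.1 hd
    exact hJ X b (List.mem_of_mem_filter hb)

theorem tokenRuns_valBlocks {n r : ℕ} (hδ : ∀ p o, ∀ d ∈ δ p o, d.1 < n ∧ d.2.length = r)
    (ν : Val) (u : Word ℕ) (c : ℕ × Asg Γ) (hc : c.1 < n ∧ c.2.length = r) :
    tokenRuns δ (valBlocks δ n r ν) u c = (evalWord ν u).elim []
      fun w => tokenRuns δ (fun _ => []) (w.map Sum.inr) c := by
  induction u generalizing c with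
  | nil => rfl
  | cons x u ih =>
    cases x with
    | inr o =>
      have ih' : ∀ d ∈ δ c.1 o, _ := fun d hd =>
        ih (d.1, compAsg c.2 d.2) (by simpa using hδ c.1 o d hd)
      simp only [tokenRuns, moves, evalWord, List.flatMap_congr ih']
      cases evalWord ν u <;> simp [tokenRuns, moves]
    | inl X =>
      cases hX : ν X with
      | none => simp [tokenRuns, moves, valBlocks, contentWord, evalWord, hX]
      | some x =>
        have hblocks : valBlocks δ n r ν X = blocks δ (fun _ => []) n r (x.map Sum.inr) := by
          simp only [valBlocks, contentWord, hX, Option.map_some, Option.elim_some]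
        have hruns := state_and_length_of_mem_tokenRuns (J := fun _ => []) hδ (by simp)
          (x.map Sum.inr) (c := (c.1, idAsg r)) ⟨hc.1, length_idAsg r⟩
        have ih' : ∀ d ∈ tokenRuns δ (fun _ => []) (x.map Sum.inr) (c.1, idAsg r), _ := fun d hd =>
          ih (d.1, compAsg c.2 d.2) (by simpa using hruns d hd)
        simp only [tokenRuns, moves_blocks hc.1 hblocks, List.flatMap_congr ih', evalWord, hX]
        cases evalWord ν u with
        | none => simp
        | some w =>
          simp [tokenRuns_append, tokenRuns_eq_map (x.map Sum.inr) c, hc.2, List.flatMap_map]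

theorem blocks_valBlocks {n r : ℕ} (hδ : ∀ p o, ∀ d ∈ δ p o, d.1 < n ∧ d.2.length = r) (ν : Val)
    (u : Word ℕ) :
    blocks δ (valBlocks δ n r ν) n r u = (evalWord ν u).elim []
      fun w => blocks δ (fun _ => []) n r (w.map Sum.inr) := by
  have hruns : ∀ p ∈ List.range n, _ := fun p hp => congrArg (List.map fun d => Block.mk p d.1 d.2)
    (tokenRuns_valBlocks hδ ν u (p, idAsg r) ⟨List.mem_range.1 hp, length_idAsg r⟩)
  rw [blocks, List.flatMap_congr hruns]
  cases evalWord ν u <;> simp [blocks]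

theorem families_valBlocks {n r : ℕ} (hδ : ∀ p o, ∀ d ∈ δ p o, d.1 < n ∧ d.2.length = r) (m : ℕ)
    (A : List Bool) (ν : Val) (σ : Asg ℕ) :
    families δ (valBlocks δ n r ν) n r m A (fun X => σ.getD X none) =
      families δ (fun _ => []) n r m A (contentWord (compVal ν σ)) := by
  refine congrArg List.sections (List.map_congr_left fun X _ => congrArg (pick _) ?_)
  simp only [contentWord, compVal]
  cases σ.getD X none with
  | none => rfl
  | some u =>
    simp only [Option.elim_some, Option.bind_some, blocks_valBlocks hδ]
    cases evalWord ν u <;> rfl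

end ValBlocks

/-! ### Substitution of words for letters -/

section Hom

variable {Γ Δ : Type} (g : Γ → List Δ)

/-- The replacement of letters by words in a word over registers and letters. -/
def homWord (u : Word Γ) : Word Δ :=
  u.flatMap (Sum.elim (fun Y => [Sum.inl Y]) fun a => (g a).map Sum.inr)

/-- The replacement of letters by words in an assignment. -/
def homAsg (σ : Asg Γ) : Asg Δ := σ.map (Option.map (homWord g))

/-- The replacement of letters by words in a block. -/
def homBlock (b : Block Γ) : Block Δ := ⟨b.src, b.dst, homAsg g b.asg⟩

@[simp]
theorem homWord_inl_cons (Y : ℕ) (u : Word Γ) :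
    homWord g (Sum.inl Y :: u) = Sum.inl Y :: homWord g u := rfl

@[simp]
theorem homWord_inr_cons (a : Γ) (u : Word Γ) :
    homWord g (Sum.inr a :: u) = (g a).map Sum.inr ++ homWord g u := rfl

theorem homWord_append (u v : Word Γ) : homWord g (u ++ v) = homWord g u ++ homWord g v :=
  List.flatMap_append

theorem getD_map_option_map {α β : Type*} (f : α → β) (l : List (Option α)) (i : ℕ) :
    (l.map (Option.map f)).getD i none = (l.getD i none).map f := by
  simp only [List.getD_eq_getElem?_getD, List.getElem?_map]
  cases l[i]? <;> rfl

theorem getD_homAsg (σ : Asg Γ) (Y : ℕ) :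
    (homAsg g σ).getD Y none = (σ.getD Y none).map (homWord g) := getD_map_option_map ..

theorem subst_map_inr_append (σ : Asg Δ) (l : List Δ) (v : Word Δ) :
    subst σ (l.map Sum.inr ++ v) = (subst σ v).map fun y => l.map Sum.inr ++ y := by
  induction l with
  | nil => simp
  | cons a l ih => simp [subst_inr, ih, Function.comp_def]

theorem subst_homAsg_homWord (σ : Asg Γ) (u : Word Γ) :
    subst (homAsg g σ) (homWord g u) = (subst σ u).map (homWord g) := by
  induction u with
  | nil => rfl
  | cons x u ih =>
    cases x with
    | inl Y =>
      rw [homWord_inl_cons, subst_inl, subst_inl, ih, getD_homAsg]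
      cases subst σ u <;> cases σ.getD Y none <;> simp [homWord_append]
    | inr a =>
      rw [homWord_inr_cons, subst_map_inr_append, subst_inr, ih]
      cases subst σ u <;> simp

theorem homAsg_compAsg (σ τ : Asg Γ) :
    homAsg g (compAsg σ τ) = compAsg (homAsg g σ) (homAsg g τ) := by
  simp only [homAsg, compAsg, List.map_map, Function.comp_def]
  refine List.map_congr_left fun o _ => ?_
  cases o with
  | none => rfl
  | some u => exact (subst_homAsg_homWord g σ u).symm

theorem homAsg_idAsg (r : ℕ) : homAsg g (idAsg r) = idAsg r := by
  simp [homAsg, idAsg, homWord]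

theorem registers_homWord (u : Word Γ) : registers (homWord g u) = registers u := by
  induction u with
  | nil => rfl
  | cons x u ih =>
    cases x with
    | inl Y => exact congrArg (Y :: ·) ih
    | inr a =>
      have hletters : registers ((g a).map (Sum.inr : Δ → ℕ ⊕ Δ)) = [] := by simp [registers]
      rw [homWord_inr_cons, registers, List.filterMap_append]
      exact (congrArg (· ++ _) hletters).trans ih

variable {g} {δ : ℕ → ℕ → List (ℕ × Asg Γ)} {δ' : ℕ → ℕ → List (ℕ × Asg Δ)}
  {J : ℕ → List (Block Γ)} {J' : ℕ → List (Block Δ)}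

theorem moves_hom (hδ : ∀ p o, δ' p o = (δ p o).map (Prod.map id (homAsg g)))
    (hJ : ∀ X, J' X = (J X).map (homBlock g)) (p : ℕ) (x : ℕ ⊕ ℕ) :
    moves δ' J' p x = (moves δ J p x).map (Prod.map id (homAsg g)) := by
  cases x with
  | inl X =>
    simp only [moves, hJ, List.filter_map, List.map_map]
    rfl
  | inr o => exact hδ p o

theorem tokenRuns_hom (hδ : ∀ p o, δ' p o = (δ p o).map (Prod.map id (homAsg g)))
    (hJ : ∀ X, J' X = (J X).map (homBlock g)) (u : Word ℕ) (c : ℕ × Asg Γ) :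
    tokenRuns δ' J' u (Prod.map id (homAsg g) c) =
      (tokenRuns δ J u c).map (Prod.map id (homAsg g)) := by
  induction u generalizing c with
  | nil => rfl
  | cons x u ih =>
    simp only [tokenRuns, moves_hom hδ hJ, List.flatMap_map, List.map_flatMap, ← ih]
    simp only [Prod.map, homAsg_compAsg, id]

theorem blocks_hom (hδ : ∀ p o, δ' p o = (δ p o).map (Prod.map id (homAsg g)))
    (hJ : ∀ X, J' X = (J X).map (homBlock g)) (n r : ℕ) (u : Word ℕ) :
    blocks δ' J' n r u = (blocks δ J n r u).map (homBlock g) := by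
  simp only [blocks, List.map_flatMap, List.map_map]
  refine List.flatMap_congr fun p _ => ?_
  have hruns := tokenRuns_hom hδ hJ u (p, idAsg r)
  rw [Prod.map, homAsg_idAsg] at hruns
  exact (congrArg _ hruns).trans (List.map_map ..)

theorem sections_map_map {α β : Type*} (f : α → β) (L : List (List α)) :
    (L.map (List.map f)).sections = L.sections.map (List.map f) := by
  induction L with
  | nil => rfl
  | cons l L ih =>
    simp [List.sections, ih, List.flatMap_map, List.map_flatMap, Function.comp_def]

theorem families_hom (hδ : ∀ p o, δ' p o = (δ p o).map (Prod.map id (homAsg g)))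
    (hJ : ∀ X, J' X = (J X).map (homBlock g)) (n r m : ℕ) (A : List Bool)
    (σ : ℕ → Option (Word ℕ)) :
    families δ' J' n r m A σ =
      (families δ J n r m A σ).map (List.map (Option.map (homBlock g))) := by
  rw [families, families, ← sections_map_map, List.map_map]
  refine congrArg List.sections (List.map_congr_left fun X _ => ?_)
  rw [Function.comp_apply]
  cases A.getD X false with
  | false => rfl
  | true => cases σ X <;> simp [pick, blocks_hom hδ hJ]

end Hom

/-! ### Counting letters and registers -/

section Counting

variable {Γ : Type}

@[simp]
theorem registers_append (u v : Word Γ) : registers (u ++ v) = registers u ++ registers v :=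
  List.filterMap_append

@[simp]
theorem letters_append (u v : Word Γ) : letters (u ++ v) = letters u ++ letters v :=
  List.filterMap_append

theorem registers_inl_cons (Y : ℕ) (u : Word Γ) :
    registers (Sum.inl Y :: u) = Y :: registers u := rfl

theorem registers_inr_cons (a : Γ) (u : Word Γ) : registers (Sum.inr a :: u) = registers u := rfl

theorem letters_inl_cons (Y : ℕ) (u : Word Γ) : letters (Sum.inl Y :: u) = letters u := rfl

theorem letters_inr_cons (a : Γ) (u : Word Γ) : letters (Sum.inr a :: u) = a :: letters u := rfl

theorem countP_registers (u : Word Γ) (q : ℕ → Bool) :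
    (registers u).countP q = u.countP (Sum.elim q fun _ => false) := by
  rw [registers, List.countP_filterMap]
  congr! with x
  cases x <;> rfl

theorem count_registers [DecidableEq Γ] (u : Word Γ) (Y : ℕ) :
    (registers u).count Y = u.count (Sum.inl Y) := by
  rw [List.count, List.count, countP_registers]
  exact List.countP_congr fun x _ => by cases x <;> simp

theorem countP_letters (u : Word Γ) (q : Γ → Bool) :
    (letters u).countP q = u.countP (Sum.elim (fun _ => false) q) := by
  rw [letters, List.countP_filterMap]
  congr! with x
  cases x <;> rfl

theorem countP_subst {σ : Asg Γ} {u v : Word Γ} (h : subst σ u = some v) (q : ℕ ⊕ Γ → Bool) :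
    v.countP q = ((registers u).map fun Y => ((σ.getD Y none).getD []).countP q).sum +
      (letters u).countP fun a => q (Sum.inr a) := by
  induction u generalizing v with
  | nil =>
    obtain rfl : [] = v := by simpa using h
    rfl
  | cons x u ih =>
    cases x with
    | inl Y =>
      rw [subst_inl, Option.bind_eq_some_iff] at h
      obtain ⟨w, hw, h⟩ := h
      obtain ⟨y, hy, rfl⟩ := Option.map_eq_some_iff.1 h
      rw [List.countP_append, ih hw, registers_inl_cons, letters_inl_cons, List.map_cons,
        List.sum_cons, hy, Option.getD_some, add_assoc]
    | inr a =>
      rw [subst_inr, Option.map_eq_some_iff] at h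
      obtain ⟨w, hw, rfl⟩ := h
      rw [List.countP_cons, ih hw, registers_inr_cons, letters_inr_cons, List.countP_cons,
        add_assoc]

theorem countP_flat_compAsg_le_sum (σ τ : Asg Γ) (q : ℕ ⊕ Γ → Bool) :
    (flat (compAsg σ τ)).countP q ≤
      ((registers (flat τ)).map fun Y => ((σ.getD Y none).getD []).countP q).sum +
        (letters (flat τ)).countP fun a => q (Sum.inr a) := by
  induction τ with
  | nil => simp [compAsg, flat]
  | cons o τ ih =>
    have hcomp : flat (compAsg σ (o :: τ)) =
      (o.bind (subst σ)).getD [] ++ flat (compAsg σ τ) := rfl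
    have hcons : flat (o :: τ) = o.getD [] ++ flat τ := rfl
    have hword : ((o.bind (subst σ)).getD []).countP q ≤
        ((registers (o.getD [])).map fun Y => ((σ.getD Y none).getD []).countP q).sum +
          (letters (o.getD [])).countP fun a => q (Sum.inr a) := by
      cases o with
      | none => simp
      | some u =>
        cases h : subst σ u with
        | none => simp [h]
        | some v => simpa [h] using (countP_subst h q).le
    rw [hcomp, hcons, registers_append, letters_append, List.countP_append, List.countP_append,
      List.map_append, List.sum_append]
    lia

theorem flat_eq_flatMap_range (σ : Asg Γ) :
    flat σ = (List.range σ.length).flatMap fun Y => (σ.getD Y none).getD [] := by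
  have hσ : σ = (List.range σ.length).map fun Y => σ.getD Y none :=
    List.ext_getElem (by simp) fun i h _ => by simp [h]
  conv_lhs => rw [hσ, flat, List.flatMap_map]

theorem sum_range_countP_getD (σ : Asg Γ) (q : ℕ ⊕ Γ → Bool) :
    ∑ Y ∈ Finset.range σ.length, ((σ.getD Y none).getD []).countP q = (flat σ).countP q := by
  induction σ with
  | nil => rfl
  | cons o σ ih =>
    have hcons : flat (o :: σ) = o.getD [] ++ flat σ := rfl
    rw [List.length_cons, Finset.sum_range_succ', hcons, List.countP_append, ← ih, add_comm]
    simp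

theorem sum_countP_getD_le {l : List ℕ} (hl : l.Nodup) (σ : Asg Γ) (q : ℕ ⊕ Γ → Bool) :
    (l.map fun Y => ((σ.getD Y none).getD []).countP q).sum ≤ (flat σ).countP q := by
  rw [← sum_range_countP_getD, ← List.sum_toFinset _ hl]
  refine Finset.sum_le_sum_of_ne_zero fun Y _ hY => Finset.mem_range.2 ?_
  contrapose! hY
  simp [List.getElem?_eq_none hY]

theorem countP_flat_compAsg_le (σ : Asg Γ) {τ : Asg Γ}
    (hτ : ∀ Y, (registers (flat τ)).count Y ≤ 1) (q : ℕ ⊕ Γ → Bool) :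
    (flat (compAsg σ τ)).countP q ≤
      (flat σ).countP q + (letters (flat τ)).countP fun a => q (Sum.inr a) :=
  (countP_flat_compAsg_le_sum σ τ q).trans <|
    Nat.add_le_add_right (sum_countP_getD_le (List.nodup_iff_count_le_one.2 hτ) σ q) _

theorem countP_registers_compAsg_le (σ : Asg Γ) {τ : Asg Γ}
    (hτ : ∀ Y, (registers (flat τ)).count Y ≤ 1) (q : ℕ → Bool) :
    (registers (flat (compAsg σ τ))).countP q ≤ (registers (flat σ)).countP q := by
  simpa [countP_registers] using countP_flat_compAsg_le σ hτ (Sum.elim q fun _ => false)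

theorem countP_letters_compAsg_le (σ : Asg Γ) {τ : Asg Γ}
    (hτ : ∀ Y, (registers (flat τ)).count Y ≤ 1) (q : Γ → Bool) :
    (letters (flat (compAsg σ τ))).countP q ≤
      (letters (flat σ)).countP q + (letters (flat τ)).countP q := by
  rw [countP_letters (flat (compAsg σ τ)), countP_letters (flat σ)]
  exact countP_flat_compAsg_le σ hτ _

theorem IsCopyless.comp {r : ℕ} {σ τ : Asg Γ} (hσ : IsCopyless r σ) (hτ : IsCopyless r τ) :
    IsCopyless r (compAsg σ τ) where
  length_eq := (length_compAsg σ τ).trans hτ.length_eq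
  isLinear_flat := by
    have hcountP := countP_registers_compAsg_le σ hτ.isLinear_flat.count_le_one
    refine ⟨fun Y hY => ?_, fun Y => (hcountP (· == Y)).trans (hσ.isLinear_flat.count_le_one Y)⟩
    have hσY : 0 < (registers (flat σ)).countP (· == Y) :=
      (List.countP_pos_iff.2 ⟨Y, hY, by simp⟩).trans_le (hcountP _)
    obtain ⟨Z, hZ, hZY⟩ := List.countP_pos_iff.1 hσY
    exact hσ.isLinear_flat.lt_of_mem Y (beq_iff_eq.1 hZY ▸ hZ)

theorem registers_flat_idAsg (r : ℕ) : registers (flat (idAsg r : Asg Γ)) = List.range r := by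
  rw [flat, idAsg, List.flatMap_map]
  exact (List.filterMap_flatMap ..).trans (List.flatMap_singleton' _)

theorem letters_flat_idAsg (r : ℕ) : letters (flat (idAsg r : Asg Γ)) = [] := by
  rw [flat, idAsg, List.flatMap_map]
  exact (List.filterMap_flatMap ..).trans (by simp)

theorem isCopyless_idAsg (r : ℕ) : IsCopyless r (idAsg r : Asg Γ) where
  length_eq := length_idAsg r
  isLinear_flat :=
    ⟨fun Y hY => List.mem_range.1 (registers_flat_idAsg (Γ := Γ) r ▸ hY), fun Y => by
      rw [registers_flat_idAsg]
      exact List.nodup_iff_count_le_one.1 List.nodup_range Y⟩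

end Counting

/-! ### Well-formed blocks -/

section BlockWellFormed

variable {Γ : Type} {δ : ℕ → ℕ → List (ℕ × Asg Γ)} {J : ℕ → List (Block Γ)} {n r : ℕ}

/-- Blocks between states less than `n` that act on `r` registers without copying. -/
structure Block.WellFormed (n r : ℕ) (b : Block Γ) : Prop where
  src_lt : b.src < n
  dst_lt : b.dst < n
  isCopyless : IsCopyless r b.asg

theorem mem_blocks {u : Word ℕ} {b : Block Γ} :
    b ∈ blocks δ J n r u ↔ b.src < n ∧ (b.dst, b.asg) ∈ tokenRuns δ J u (b.src, idAsg r) := by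
  simp only [blocks, List.mem_flatMap, List.mem_map, List.mem_range]
  constructor
  · rintro ⟨p, hp, d, hd, rfl⟩
    exact ⟨hp, hd⟩
  · exact fun h => ⟨b.src, h.1, _, h.2, rfl⟩

theorem mem_pick {α : Type*} {b : Bool} {l : List α} {a : α} :
    some a ∈ pick b l ↔ b = true ∧ a ∈ l := by
  cases b <;> simp [pick]

theorem isSome_of_mem_pick {α : Type*} {b : Bool} {l : List α} {o : Option α} (h : o ∈ pick b l) :
    o.isSome = b := by
  cases b with
  | false => simp_all [pick]
  | true =>
    obtain ⟨a, _, rfl⟩ := List.mem_map.1 h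
    rfl

theorem length_of_mem_families {m : ℕ} {A : List Bool} {σ : ℕ → Option (Word ℕ)}
    {fam : List (Option (Block Γ))} (h : fam ∈ families δ J n r m A σ) : fam.length = m := by
  simpa using (List.mem_sections.1 h).length_eq

theorem getD_mem_pick_of_mem_families {m : ℕ} {A : List Bool} {σ : ℕ → Option (Word ℕ)}
    {fam : List (Option (Block Γ))} (h : fam ∈ families δ J n r m A σ) {X : ℕ} (hX : X < m) :
    fam.getD X none ∈ pick (A.getD X false) ((σ X).elim [] (blocks δ J n r)) := by
  have hfam : X < fam.length := (length_of_mem_families h).symm ▸ hX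
  rw [List.getD_eq_getElem _ _ hfam]
  simpa using (List.mem_sections.1 h).get hfam (by simpa using hX)

theorem exists_of_getD_mem_families {m : ℕ} {A : List Bool} {σ : ℕ → Option (Word ℕ)}
    {fam : List (Option (Block Γ))} (h : fam ∈ families δ J n r m A σ) {X : ℕ} {b : Block Γ}
    (hb : fam.getD X none = some b) :
    A.getD X false = true ∧ ∃ u, σ X = some u ∧ b ∈ blocks δ J n r u := by
  have hX : X < m := by
    by_contra hX
    rw [List.getD_eq_default _ _ (length_of_mem_families h ▸ not_lt.1 hX)] at hb
    simp at hb
  obtain ⟨hA, hb⟩ := mem_pick.1 (hb ▸ getD_mem_pick_of_mem_families h hX)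
  cases hσ : σ X with
  | none => simp [hσ] at hb
  | some u => exact ⟨hA, u, rfl, by simpa [hσ] using hb⟩

theorem wellFormed_of_mem_moves (hδ : ∀ p o, ∀ d ∈ δ p o, d.1 < n ∧ IsCopyless r d.2)
    (hJ : ∀ X, ∀ b ∈ J X, b.WellFormed n r) {x : ℕ ⊕ ℕ} {p : ℕ} {d : ℕ × Asg Γ}
    (hd : d ∈ moves δ J p x) : d.1 < n ∧ IsCopyless r d.2 := by
  cases x with
  | inl X =>
    obtain ⟨b, hb, rfl⟩ := List.mem_map.1 hd
    have hb := hJ X b (List.mem_of_mem_filter hb)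
    exact ⟨hb.dst_lt, hb.isCopyless⟩
  | inr o => exact hδ p o d hd

theorem wellFormed_of_mem_tokenRuns (hδ : ∀ p o, ∀ d ∈ δ p o, d.1 < n ∧ IsCopyless r d.2)
    (hJ : ∀ X, ∀ b ∈ J X, b.WellFormed n r) (u : Word ℕ) {c : ℕ × Asg Γ}
    (hc : c.1 < n ∧ IsCopyless r c.2) : ∀ d ∈ tokenRuns δ J u c, d.1 < n ∧ IsCopyless r d.2 :=
  tokenRuns_induction (P := fun d => d.1 < n ∧ IsCopyless r d.2) (fun _ _ _ hc _ hd =>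
    (wellFormed_of_mem_moves hδ hJ hd).imp_right hc.2.comp) hc

theorem wellFormed_of_mem_blocks (hδ : ∀ p o, ∀ d ∈ δ p o, d.1 < n ∧ IsCopyless r d.2)
    (hJ : ∀ X, ∀ b ∈ J X, b.WellFormed n r) {u : Word ℕ} {b : Block Γ}
    (hb : b ∈ blocks δ J n r u) : b.WellFormed n r :=
  have ⟨hsrc, hrun⟩ := mem_blocks.1 hb
  have ⟨hdst, hasg⟩ := wellFormed_of_mem_tokenRuns hδ hJ u ⟨hsrc, isCopyless_idAsg r⟩ _ hrun
  ⟨hsrc, hdst, hasg⟩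

theorem wellFormed_of_mem_families (hδ : ∀ p o, ∀ d ∈ δ p o, d.1 < n ∧ IsCopyless r d.2)
    (hJ : ∀ X, ∀ b ∈ J X, b.WellFormed n r) {m : ℕ} {A : List Bool} {σ : ℕ → Option (Word ℕ)}
    {fam : List (Option (Block Γ))} (h : fam ∈ families δ J n r m A σ) {X : ℕ} {b : Block Γ}
    (hb : fam.getD X none = some b) : b.WellFormed n r :=
  have ⟨_, _, _, hb⟩ := exists_of_getD_mem_families h hb
  wellFormed_of_mem_blocks hδ hJ hb

end BlockWellFormed

/-! ### Register-free factors of words -/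

section Interleave

variable {Γ Δ : Type}

/-- The word `s 0, y₀, s 1, y₁, …` in which register-free words alternate with registers. -/
def interleave (s : ℕ → List Γ) (ys : List ℕ) : Word Γ :=
  (s 0).map Sum.inr ++ (List.range ys.length).flatMap fun i =>
    Sum.inl (ys.getD i 0) :: (s (i + 1)).map Sum.inr

theorem interleave_nil (s : ℕ → List Γ) : interleave s [] = (s 0).map Sum.inr := by
  simp [interleave]

theorem interleave_cons (s : ℕ → List Γ) (y : ℕ) (ys : List ℕ) :
    interleave s (y :: ys) =
      (s 0).map Sum.inr ++ Sum.inl y :: interleave (fun i => s (i + 1)) ys := by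
  simp [interleave, List.range_succ_eq_map, List.flatMap_map]

theorem interleave_congr {s s' : ℕ → List Γ} {ys : List ℕ} (h : ∀ i ≤ ys.length, s i = s' i) :
    interleave s ys = interleave s' ys := by
  induction ys generalizing s s' with
  | nil => rw [interleave_nil, interleave_nil, h 0 le_rfl]
  | cons y ys ih =>
    rw [interleave_cons, interleave_cons, h 0 (Nat.zero_le _),
      ih fun i hi => h (i + 1) (Nat.succ_le_succ hi)]

theorem registers_map_inr (l : List Γ) : registers (l.map (Sum.inr : Γ → ℕ ⊕ Γ)) = [] := by
  simp [registers]

theorem letters_map_inr (l : List Γ) : letters (l.map (Sum.inr : Γ → ℕ ⊕ Γ)) = l := by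
  simp [letters, List.filterMap_map, Function.comp_def]

theorem registers_interleave (s : ℕ → List Γ) (ys : List ℕ) :
    registers (interleave s ys) = ys := by
  induction ys generalizing s with
  | nil => rw [interleave_nil, registers_map_inr]
  | cons y ys ih =>
    rw [interleave_cons, registers_append, registers_map_inr, registers_inl_cons, ih,
      List.nil_append]

theorem letters_interleave (s : ℕ → List Γ) (ys : List ℕ) :
    letters (interleave s ys) = (List.range (ys.length + 1)).flatMap s := by
  induction ys generalizing s with
  | nil => simp [interleave_nil, letters_map_inr]
  | cons y ys ih =>
    rw [interleave_cons, letters_append, letters_map_inr, letters_inl_cons, ih,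
      List.length_cons, List.range_succ_eq_map (n := ys.length + 1), List.flatMap_cons,
      List.flatMap_map]

theorem homWord_map_inr (g : Γ → List Δ) (l : List Γ) :
    homWord g (l.map Sum.inr) = (l.flatMap g).map Sum.inr := by
  rw [homWord, List.flatMap_map, List.map_flatMap]
  rfl

theorem homWord_interleave (g : Γ → List Δ) (s : ℕ → List Γ) (ys : List ℕ) :
    homWord g (interleave s ys) = interleave (fun i => (s i).flatMap g) ys := by
  induction ys generalizing s with
  | nil => rw [interleave_nil, interleave_nil, homWord_map_inr]
  | cons y ys ih =>
    rw [interleave_cons, interleave_cons, homWord_append, homWord_map_inr, homWord_inl_cons, ih]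

theorem segments_inl_cons (Y : ℕ) (u : Word Γ) :
    segments (Sum.inl Y :: u) = [] :: segments u := rfl

theorem segments_inr_cons (a : Γ) (u : Word Γ) :
    segments (Sum.inr a :: u) = (a :: (segments u).headI) :: (segments u).tail := rfl

theorem length_segments (u : Word Γ) : (segments u).length = (registers u).length + 1 := by
  induction u with
  | nil => rfl
  | cons x u ih =>
    cases x with
    | inl Y => rw [segments_inl_cons, registers_inl_cons, List.length_cons, ih, List.length_cons]
    | inr a =>
      rw [segments_inr_cons, registers_inr_cons, List.length_cons, List.length_tail, ih,
        Nat.add_sub_cancel]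

theorem interleave_segments (u : Word Γ) :
    interleave (fun i => (segments u).getD i []) (registers u) = u := by
  induction u with
  | nil => rfl
  | cons x u ih =>
    cases x with
    | inl Y =>
      rw [segments_inl_cons, registers_inl_cons, interleave_cons]
      exact congrArg (Sum.inl Y :: ·) ih
    | inr a =>
      rw [segments_inr_cons, registers_inr_cons]
      cases h : segments u with
      | nil => simpa [h] using length_segments u
      | cons s t =>
        rw [h] at ih
        exact congrArg (Sum.inr a :: ·) ih

theorem segments_map_inr_append {u : Word Γ} {s : List Γ} {t : List (List Γ)}
    (h : segments u = s :: t) (l : List Γ) : segments (l.map Sum.inr ++ u) = (l ++ s) :: t := by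
  induction l with
  | nil => exact h
  | cons a l ih => rw [List.map_cons, List.cons_append, segments_inr_cons, ih]; rfl

theorem segments_interleave (s : ℕ → List Γ) (ys : List ℕ) :
    segments (interleave s ys) = (List.range (ys.length + 1)).map s := by
  induction ys generalizing s with
  | nil =>
    rw [interleave_nil, ← List.append_nil (List.map _ _), segments_map_inr_append rfl,
      List.append_nil]
    rfl
  | cons y ys ih =>
    rw [interleave_cons, segments_map_inr_append (segments_inl_cons _ _), ih, List.append_nil,
      List.length_cons, List.range_succ_eq_map (n := ys.length + 1), List.map_cons, List.map_map]
    rfl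

theorem segments_homWord (g : Γ → List Δ) (u : Word Γ) :
    segments (homWord g u) = (segments u).map fun l => l.flatMap g := by
  have hrange : (List.range (segments u).length).map (fun i => (segments u).getD i []) =
      segments u := List.ext_getElem (by simp) fun i _ hi => by simp [hi]
  conv_lhs => rw [← interleave_segments u, homWord_interleave, segments_interleave,
    ← length_segments]
  conv_rhs => rw [← hrange, List.map_map]
  rfl

theorem flatMap_range_getD {α β : Type*} (l : List α) {d : α} {f : α → List β} (hd : f d = [])
    {k : ℕ} (hk : l.length ≤ k) :
    ((List.range k).flatMap fun i => f (l.getD i d)) = l.flatMap f := by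
  induction l generalizing k with
  | nil => simp [hd]
  | cons a l ih =>
    obtain ⟨k, rfl⟩ := Nat.exists_eq_add_one.2 (Nat.zero_lt_of_lt hk)
    rw [List.range_succ_eq_map, List.flatMap_cons, List.flatMap_map, List.flatMap_cons,
      ← ih (Nat.le_of_succ_le_succ hk)]
    rfl

theorem flatMap_segments (u : Word Γ) {k : ℕ} (hk : (registers u).length < k) :
    ((List.range k).flatMap fun i => (segments u).getD i []) = letters u := by
  conv_rhs => rw [← interleave_segments u, letters_interleave, ← length_segments]
  exact (flatMap_range_getD (f := id) _ rfl ((length_segments u).trans_le hk)).trans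
    (flatMap_range_getD (f := id) _ rfl le_rfl).symm

/-- The register-free factor number `i` of the word assigned to `Y`, empty if there is none. -/
def segment (σ : Asg Γ) (Y i : ℕ) : List Γ :=
  (σ.getD Y none).elim [] fun u => (segments u).getD i []

theorem segment_homAsg (g : Γ → List Δ) (σ : Asg Γ) (Y i : ℕ) :
    segment (homAsg g σ) Y i = (segment σ Y i).flatMap g := by
  rw [segment, segment, getD_homAsg]
  cases σ.getD Y none with
  | none => rfl
  | some u =>
    simp only [Option.map_some, Option.elim_some, segments_homWord, List.getD_eq_getElem?_getD,
      List.getElem?_map]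
    cases (segments u)[i]? <;> rfl

theorem letters_flat (σ : Asg Γ) : letters (flat σ) = σ.flatMap fun o => o.elim [] letters := by
  rw [flat, letters, List.filterMap_flatMap]
  exact List.flatMap_congr fun o _ => by cases o <;> rfl

theorem IsCopyless.length_registers_le {r : ℕ} {σ : Asg Γ} (hσ : IsCopyless r σ) {u : Word Γ}
    (hu : some u ∈ σ) : (registers u).length ≤ r := by
  have hsub : (registers u).Sublist (registers (flat σ)) :=
    .filterMap _ (List.sublist_flatten_of_mem (List.mem_map.2 ⟨some u, hu, rfl⟩))
  have hnodup := (List.nodup_iff_count_le_one.2 hσ.isLinear_flat.count_le_one).sublist hsub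
  simpa using hnodup.length_le_of_subset (l₂ := List.range r) fun Y hY =>
    List.mem_range.2 (hσ.isLinear_flat.lt_of_mem Y (hsub.subset hY))

theorem IsCopyless.flatMap_segment {r : ℕ} {σ : Asg Γ} (hσ : IsCopyless r σ) :
    ((List.range r).flatMap fun Y => (List.range (r + 1)).flatMap (segment σ Y)) =
      letters (flat σ) := by
  rw [letters_flat, ← flatMap_range_getD σ (d := none) rfl hσ.length_eq.le]
  refine List.flatMap_congr fun Y hY => ?_
  have hY : Y < σ.length := hσ.length_eq.symm ▸ List.mem_range.1 hY
  cases hu : σ.getD Y none with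
  | none => simp [segment, -List.getD_eq_getElem?_getD, hu]
  | some u =>
    have hmem : some u ∈ σ := by
      rw [← hu, List.getD_eq_getElem _ _ hY]
      exact List.getElem_mem hY
    rw [Option.elim_some, ← flatMap_segments u (Nat.lt_succ_of_le (hσ.length_registers_le hmem))]
    unfold segment
    simp only [hu, Option.elim_some]

end Interleave

/-! ### Summaries of blocks -/

section Summaries

variable {Γ Δ : Type}

/-- The registers in the words of an assignment, without the letters. -/
def shapeOf (σ : Asg Γ) : List (Option (List ℕ)) := σ.map (Option.map registers)

/-- What a state of the composition remembers of a block: its letters are forgotten. -/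
structure Summary where
  /-- The first state. -/
  src : ℕ
  /-- The last state. -/
  dst : ℕ
  /-- The registers in the words of the effect on the registers. -/
  shape : List (Option (List ℕ))
  deriving DecidableEq

/-- The summary of a block. -/
def Block.summary (b : Block Γ) : Summary := ⟨b.src, b.dst, shapeOf b.asg⟩

/-- The summaries of a family of blocks. -/
def summaries (fam : List (Option (Block Γ))) : List (Option Summary) :=
  fam.map (Option.map Block.summary)

/-- The number of the register of the composition that holds the register-free factor number `i` of
the word assigned to `Y` by the block on the content of `X`. -/
def regIndex (r X Y i : ℕ) : ℕ := (X * r + Y) * (r + 1) + i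

/-- The content of the register number `z` of the composition, given the family of blocks on the
contents of the registers of the first transducer. -/
def content (r : ℕ) (fam : List (Option (Block Γ))) (z : ℕ) : List Γ :=
  (fam.getD (z / (r + 1) / r) none).elim [] fun b =>
    segment b.asg (z / (r + 1) % r) (z % (r + 1))

/-- The contents of all the registers of the composition, given the family of blocks. -/
def contents (m r : ℕ) (fam : List (Option (Block Γ))) : List (Option (List Γ)) :=
  (List.range (m * r * (r + 1))).map fun z => some (content r fam z)

/-- The assignment of the given shape in which each register-free factor is the name of the register
of the composition that holds it, for a block on the content of `X`. -/
def unfoldShape (r X : ℕ) (h : List (Option (List ℕ))) : Asg (ℕ ⊕ ℕ) :=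
  (List.range h.length).map fun Y =>
    (h.getD Y none).map (interleave fun i => [Sum.inl (regIndex r X Y i)])

/-- The block on the content of `X` with the given summary, its letters being expressed by the
registers of the composition. -/
def symbolicBlock (r X : ℕ) (b : Summary) : Block (ℕ ⊕ ℕ) := ⟨b.src, b.dst, unfoldShape r X b.shape⟩

/-- The blocks described by a list of summaries. -/
def symbolicBlocks (r : ℕ) (s : List (Option Summary)) (X : ℕ) : List (Block (ℕ ⊕ ℕ)) :=
  (familyChoices s X).map (symbolicBlock r X)

theorem regIndex_div {r X Y i : ℕ} (hY : Y < r) (hi : i ≤ r) :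
    regIndex r X Y i / (r + 1) / r = X := by
  rw [regIndex, mul_comm, Nat.mul_add_div r.succ_pos, Nat.div_eq_of_lt (Nat.lt_succ_of_le hi),
    add_zero, mul_comm X, Nat.mul_add_div (Nat.zero_lt_of_lt hY), Nat.div_eq_of_lt hY, add_zero]

theorem regIndex_div_mod {r X Y i : ℕ} (hY : Y < r) (hi : i ≤ r) :
    regIndex r X Y i / (r + 1) % r = Y := by
  rw [regIndex, mul_comm, Nat.mul_add_div r.succ_pos, Nat.div_eq_of_lt (Nat.lt_succ_of_le hi),
    add_zero, mul_comm X, Nat.mul_add_mod, Nat.mod_eq_of_lt hY]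

theorem regIndex_mod {r X Y i : ℕ} (hi : i ≤ r) : regIndex r X Y i % (r + 1) = i := by
  rw [regIndex, mul_comm, Nat.mul_add_mod, Nat.mod_eq_of_lt (Nat.lt_succ_of_le hi)]

theorem content_regIndex {r X Y i : ℕ} (hY : Y < r) (hi : i ≤ r)
    (fam : List (Option (Block Γ))) :
    content r fam (regIndex r X Y i) =
      (fam.getD X none).elim [] fun b => segment b.asg Y i := by
  rw [content, regIndex_div hY hi, regIndex_div_mod hY hi, regIndex_mod hi]

theorem shapeOf_unfoldShape (r X : ℕ) (h : List (Option (List ℕ))) :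
    shapeOf (unfoldShape r X h) = h := by
  refine List.ext_getElem (by simp [shapeOf, unfoldShape]) fun Y _ hY => ?_
  simp only [shapeOf, unfoldShape, List.getElem_map, List.getElem_range,
    List.getD_eq_getElem _ _ hY, Option.map_map]
  cases h[Y] with
  | none => rfl
  | some ys => exact congrArg some (registers_interleave _ ys)

theorem content_hom (g : Γ → List Δ) (r : ℕ) (fam : List (Option (Block Γ))) (z : ℕ) :
    content r (fam.map (Option.map (homBlock g))) z = (content r fam z).flatMap g := by
  rw [content, content, getD_map_option_map]
  cases fam.getD (z / (r + 1) / r) none with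
  | none => rfl
  | some b => exact segment_homAsg g b.asg _ _

theorem summaries_hom (g : Γ → List Δ) (fam : List (Option (Block Γ))) :
    summaries (fam.map (Option.map (homBlock g))) = summaries fam := by
  have hsummary : Block.summary ∘ homBlock g = Block.summary := funext fun b =>
    congrArg (Summary.mk b.src b.dst) <| by
      simp only [shapeOf, homBlock, homAsg, List.map_map, Option.map_comp_map]
      exact congrArg (List.map · b.asg) (congrArg Option.map (funext (registers_homWord g)))
  rw [summaries, List.map_map, Option.map_comp_map, hsummary, summaries]

end Summaries

/-! ### Reading summaries in the contents of the registers -/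

section Reading

/-- The words denoted by registers of the composition and by letters. -/
def wordOf (r : ℕ) (fam : List (Option (Block ℕ))) : ℕ ⊕ ℕ → List ℕ :=
  Sum.elim (content r fam) fun o => [o]

theorem homAsg_unfoldShape {r X : ℕ} {fam : List (Option (Block ℕ))} {b : Block ℕ}
    (hX : fam.getD X none = some b) (hb : IsCopyless r b.asg) :
    homAsg (wordOf r fam) (unfoldShape r X (shapeOf b.asg)) = b.asg := by
  refine List.ext_getElem (by simp [homAsg, unfoldShape, shapeOf]) fun Y _ hY => ?_
  have hYr : Y < r := hb.length_eq ▸ hY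
  simp only [homAsg, unfoldShape, List.getElem_map, List.getElem_range, shapeOf,
    getD_map_option_map, List.getD_eq_getElem _ _ hY]
  cases hu : b.asg[Y] with
  | none => rfl
  | some u =>
    have hlength := hb.length_registers_le (hu ▸ List.getElem_mem hY)
    simp only [Option.map_some, Option.some.injEq, homWord_interleave]
    refine (interleave_congr fun i hi => ?_).trans (interleave_segments u)
    simp [wordOf, content_regIndex hYr (hi.trans hlength), -List.getD_eq_getElem?_getD, hX, segment,
      List.getD_eq_getElem _ _ hY, hu]

theorem symbolicBlocks_hom {r : ℕ} {fam : List (Option (Block ℕ))}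
    (hfam : ∀ X b, fam.getD X none = some b → IsCopyless r b.asg) (X : ℕ) :
    familyChoices fam X =
      (symbolicBlocks r (summaries fam) X).map (homBlock (wordOf r fam)) := by
  rw [symbolicBlocks, familyChoices, familyChoices, summaries, getD_map_option_map]
  cases hX : fam.getD X none with
  | none => rfl
  | some b =>
    simp [homBlock, symbolicBlock, Block.summary, homAsg_unfoldShape hX (hfam X b hX)]

/-- A word over the letters as a word over registers of the composition and letters. -/
def liftWord (u : Word ℕ) : Word (ℕ ⊕ ℕ) := u.map (Sum.map id Sum.inr)

/-- An assignment over the letters as an assignment over registers of the composition and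
letters. -/
def liftAsg (σ : Asg ℕ) : Asg (ℕ ⊕ ℕ) := σ.map (Option.map liftWord)

theorem homWord_liftWord (r : ℕ) (fam : List (Option (Block ℕ))) (u : Word ℕ) :
    homWord (wordOf r fam) (liftWord u) = u := by
  induction u with
  | nil => rfl
  | cons x u ih => cases x <;> exact congrArg (_ :: ·) ih

theorem homAsg_liftAsg (r : ℕ) (fam : List (Option (Block ℕ))) (σ : Asg ℕ) :
    homAsg (wordOf r fam) (liftAsg σ) = σ := by
  simp only [homAsg, liftAsg, List.map_map, Option.map_comp_map]
  have hid : homWord (wordOf r fam) ∘ liftWord = id := funext (homWord_liftWord r fam)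
  rw [hid, Option.map_id, List.map_id]

theorem getD_contents {Γ : Type} (m r : ℕ) (fam : List (Option (Block Γ))) (z : ℕ) :
    (contents m r fam).getD z none =
      if z < m * r * (r + 1) then some (content r fam z) else none := by
  simp only [contents, List.getD_eq_getElem?_getD, List.getElem?_map]
  split <;> simp [*]

theorem evalWord_contents {m r : ℕ} (fam : List (Option (Block ℕ))) {w : Word ℕ}
    (hw : ∀ z, Sum.inl z ∈ w → z < m * r * (r + 1)) :
    evalWord (tableVal (contents m r fam)) w = some (w.flatMap (wordOf r fam)) := by
  induction w with
  | nil => rfl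
  | cons x w ih =>
    have ih := ih fun z hz => hw z (List.mem_cons_of_mem _ hz)
    cases x with
    | inl z =>
      rw [evalWord, ih, tableVal, getD_contents, if_pos (hw z List.mem_cons_self)]
      rfl
    | inr o =>
      rw [evalWord, ih]
      rfl

theorem compVal_contents {m r : ℕ} (fam : List (Option (Block ℕ)))
    (fam' : List (Option (Block (ℕ ⊕ ℕ))))
    (h : ∀ z < m * r * (r + 1), ∀ z', Sum.inl z' ∈ content r fam' z → z' < m * r * (r + 1)) :
    compVal (tableVal (contents m r fam)) (contents m r fam') =
      tableVal (contents m r (fam'.map (Option.map (homBlock (wordOf r fam))))) := by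
  funext z
  rw [tableVal, getD_contents, content_hom]
  rw [compVal, getD_contents]
  split
  case isTrue hz => exact evalWord_contents fam (h z hz)
  case isFalse => rfl

end Reading

/-! ### Counting letters in the contents of the registers -/

section CountContents

variable {Γ : Type} {δ : ℕ → ℕ → List (ℕ × Asg Γ)} {J : ℕ → List (Block Γ)} {n r m : ℕ}

theorem flatMap_range_mul {α : Type*} (a b : ℕ) (f : ℕ → List α) :
    (List.range (a * b)).flatMap f =
      (List.range a).flatMap fun i => (List.range b).flatMap fun j => f (i * b + j) := by
  induction a with
  | zero => simp
  | succ a ih =>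
    rw [Nat.succ_mul, List.range_add, List.flatMap_append, ih, List.range_succ,
      List.flatMap_append, List.flatMap_singleton, List.flatMap_map]

theorem flatMap_content {fam : List (Option (Block Γ))}
    (hfam : ∀ X b, fam.getD X none = some b → IsCopyless r b.asg) :
    (List.range (m * r * (r + 1))).flatMap (content r fam) =
      (List.range m).flatMap fun X =>
        (fam.getD X none).elim [] fun b => letters (flat b.asg) := by
  rw [flatMap_range_mul, flatMap_range_mul]
  refine List.flatMap_congr fun X _ => ?_
  have hcontent : ∀ Y ∈ List.range r, ∀ i ∈ List.range (r + 1),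
      content r fam ((X * r + Y) * (r + 1) + i) =
        (fam.getD X none).elim [] fun b => segment b.asg Y i := fun Y hY i hi =>
    content_regIndex (List.mem_range.1 hY) (Nat.le_of_lt_succ (List.mem_range.1 hi)) fam
  rw [List.flatMap_congr fun Y hY => List.flatMap_congr (hcontent Y hY)]
  cases hX : fam.getD X none with
  | none => simp
  | some b => exact (hfam X b hX).flatMap_segment

variable (hδ : ∀ p o, ∀ d ∈ δ p o, d.1 < n ∧ IsCopyless r d.2)
  (hJ : ∀ X, ∀ b ∈ J X, b.WellFormed n r) {q : Γ → Bool} {B : ℕ ⊕ ℕ → ℕ}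
  (hB : ∀ p x, ∀ d ∈ moves δ J p x, (letters (flat d.2)).countP q ≤ B x)

include hδ hJ hB

theorem countP_letters_le_of_mem_tokenRuns {u : Word ℕ} {c d : ℕ × Asg Γ}
    (hd : d ∈ tokenRuns δ J u c) :
    (letters (flat d.2)).countP q ≤ (letters (flat c.2)).countP q + (u.map B).sum := by
  induction u generalizing c with
  | nil =>
    obtain rfl : d = c := by simpa [tokenRuns] using hd
    simp
  | cons x u ih =>
    obtain ⟨e, he, hd⟩ := List.mem_flatMap.1 hd
    have hcopyless := (wellFormed_of_mem_moves hδ hJ he).2.isLinear_flat.count_le_one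
    have hcomp := countP_letters_compAsg_le c.2 hcopyless q
    have hmove := hB _ _ e he
    have hrest := ih hd
    rw [List.map_cons, List.sum_cons]
    lia

theorem countP_letters_le_of_mem_blocks {u : Word ℕ} {b : Block Γ} (hb : b ∈ blocks δ J n r u) :
    (letters (flat b.asg)).countP q ≤ (u.map B).sum := by
  simpa [letters_flat_idAsg] using
    countP_letters_le_of_mem_tokenRuns hδ hJ hB (mem_blocks.1 hb).2

theorem countP_content_le_of_mem_families {A : List Bool} {σ : ℕ → Option (Word ℕ)}
    {fam : List (Option (Block Γ))} (h : fam ∈ families δ J n r m A σ) :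
    ((List.range (m * r * (r + 1))).flatMap (content r fam)).countP q ≤
      ((selected m A σ).map B).sum := by
  rw [flatMap_content fun X b hb => (wellFormed_of_mem_families hδ hJ h hb).isCopyless,
    selected, List.countP_flatMap, List.map_flatMap, List.flatMap, List.sum_flatten, List.map_map]
  refine List.sum_le_sum fun X _ => ?_
  rw [Function.comp_apply]
  cases hX : fam.getD X none with
  | none => exact Nat.zero_le _
  | some b =>
    obtain ⟨hA, u, hu, hb⟩ := exists_of_getD_mem_families h hX
    simpa [-List.getD_eq_getElem?_getD, hA, hu] using countP_letters_le_of_mem_blocks hδ hJ hB hb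

omit hB in
theorem forall_mem_content_of_mem_families {P : Γ → Prop}
    (hP : ∀ p x, ∀ d ∈ moves δ J p x, ∀ a ∈ letters (flat d.2), P a) {A : List Bool}
    {σ : ℕ → Option (Word ℕ)} {fam : List (Option (Block Γ))} (h : fam ∈ families δ J n r m A σ)
    {z : ℕ} (hz : z < m * r * (r + 1)) : ∀ a ∈ content r fam z, P a := by
  classical
  have hcount := countP_content_le_of_mem_families (q := fun a => decide ¬P a) (B := fun _ => 0)
    hδ hJ (fun p x d hd => (List.countP_eq_zero.2 fun a ha => by simpa using hP p x d hd a ha).le) h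
  have hzero : ((selected m A σ).map fun _ => 0).sum = 0 := by simp
  intro a ha
  by_contra hPa
  refine absurd (hcount.trans_eq hzero) (not_le.2 (List.countP_pos_iff.2 ⟨a, ?_, by simpa⟩))
  exact List.mem_flatMap.2 ⟨z, List.mem_range.2 hz, ha⟩

end CountContents

/-! ### Well-formed summaries -/

section Shapes

/-- The shapes of copyless assignments on `r` registers. -/
structure IsShape (r : ℕ) (h : List (Option (List ℕ))) : Prop where
  length_eq : h.length = r
  lt_of_mem : ∀ Y ∈ h.flatMap fun o => o.getD [], Y < r
  count_le_one : ∀ Y, (h.flatMap fun o => o.getD []).count Y ≤ 1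

/-- The summaries of well-formed blocks. -/
structure Summary.WellFormed (n r : ℕ) (b : Summary) : Prop where
  src_lt : b.src < n
  dst_lt : b.dst < n
  isShape : IsShape r b.shape

variable {Γ : Type} {n r X : ℕ}

theorem isShape_shapeOf {σ : Asg Γ} : IsShape r (shapeOf σ) ↔ IsCopyless r σ := by
  have hregisters : ((shapeOf σ).flatMap fun o => o.getD []) = registers (flat σ) := by
    rw [registers_flat, shapeOf, List.flatMap_map]
  constructor <;> intro h
  · exact ⟨by simpa [shapeOf] using h.length_eq, hregisters ▸ h.lt_of_mem,
      hregisters ▸ h.count_le_one⟩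
  · exact ⟨by simpa [shapeOf] using h.length_eq, hregisters ▸ h.isLinear_flat.lt_of_mem,
      hregisters ▸ h.isLinear_flat.count_le_one⟩

theorem Block.WellFormed.summary {b : Block Γ} (h : b.WellFormed n r) : b.summary.WellFormed n r :=
  ⟨h.src_lt, h.dst_lt, isShape_shapeOf.2 h.isCopyless⟩

theorem IsShape.isCopyless_unfoldShape {h : List (Option (List ℕ))} (hh : IsShape r h) :
    IsCopyless r (unfoldShape r X h) := by
  rwa [← isShape_shapeOf, shapeOf_unfoldShape]

theorem Summary.WellFormed.symbolicBlock {b : Summary} (h : b.WellFormed n r) :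
    (symbolicBlock r X b).WellFormed n r :=
  ⟨h.src_lt, h.dst_lt, h.isShape.isCopyless_unfoldShape⟩

theorem segment_unfoldShape_sublist (r X : ℕ) (h : List (Option (List ℕ))) (Y i : ℕ) :
    (segment (unfoldShape r X h) Y i).Sublist [Sum.inl (regIndex r X Y i)] := by
  by_cases hY : Y < h.length
  swap
  · simp [segment, unfoldShape, hY]
  have hlength : Y < (unfoldShape r X h).length := by simpa [unfoldShape] using hY
  rw [segment, List.getD_eq_getElem _ _ hlength]
  simp only [unfoldShape, List.getElem_map, List.getElem_range]
  cases h.getD Y none with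
  | none => simp
  | some ys =>
    simp only [Option.map_some, Option.elim_some, segments_interleave]
    by_cases hi : i < ys.length + 1 <;> simp [hi]

theorem letters_flat_unfoldShape_sublist {h : List (Option (List ℕ))}
    (hh : IsShape r h) :
    (letters (flat (unfoldShape r X h))).Sublist
      ((List.range (r * (r + 1))).map fun k => Sum.inl (X * (r * (r + 1)) + k)) := by
  rw [← hh.isCopyless_unfoldShape.flatMap_segment, List.map_eq_flatMap, flatMap_range_mul]
  refine List.Sublist.flatMap_right _ fun Y _ => List.Sublist.flatMap_right _ fun i _ => ?_
  convert segment_unfoldShape_sublist r X h Y i using 3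
  rw [regIndex]
  ring

theorem exists_of_mem_symbolicBlocks {s : List (Option Summary)} {b : Block (ℕ ⊕ ℕ)}
    (hb : b ∈ symbolicBlocks r s X) :
    ∃ e, some e ∈ s ∧ X < s.length ∧ b = symbolicBlock r X e := by
  obtain ⟨e, he, rfl⟩ := List.mem_map.1 hb
  have he : s.getD X none = some e := by simpa [familyChoices] using he
  have hX : X < s.length := by
    by_contra hX
    simp [List.getElem?_eq_none (not_lt.1 hX)] at he
  rw [List.getD_eq_getElem _ _ hX] at he
  exact ⟨e, he ▸ List.getElem_mem hX, hX, rfl⟩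

theorem wellFormed_of_mem_symbolicBlocks {s : List (Option Summary)}
    (hs : ∀ e, some e ∈ s → e.WellFormed n r) {b : Block (ℕ ⊕ ℕ)}
    (hb : b ∈ symbolicBlocks r s X) : b.WellFormed n r := by
  obtain ⟨e, he, -, rfl⟩ := exists_of_mem_symbolicBlocks hb
  exact (hs e he).symbolicBlock

end Shapes

/-! ### Expansion over families of blocks -/

section Expansion

variable {Γ M : Type} [AddCommMonoid M] {δ : ℕ → ℕ → List (ℕ × Asg Γ)} {n r m : ℕ}

/-- All vectors of `m` truth values. -/
def boolVectors (m : ℕ) : List (List Bool) := (List.replicate m [false, true]).sections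

/-- Which of the first `m` registers occur in a word. -/
def occurring (m : ℕ) (v : Word ℕ) : List Bool :=
  (List.range m).map fun X => v.any fun x => decide (x = Sum.inl X)

theorem mem_sections_replicate {α : Type*} {l s : List α} :
    s ∈ (List.replicate m l).sections ↔ s.length = m ∧ ∀ a ∈ s, a ∈ l := by
  rw [List.mem_sections]
  induction m generalizing s with
  | zero => simp +contextual
  | succ m ih => cases s <;> simp [List.replicate_succ, ih, and_left_comm]

theorem mem_boolVectors {A : List Bool} : A ∈ boolVectors m ↔ A.length = m :=
  mem_sections_replicate.trans (and_iff_left fun b _ => by cases b <;> simp)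

theorem nodup_sections {α : Type*} {L : List (List α)} (h : ∀ l ∈ L, l.Nodup) :
    L.sections.Nodup := by
  induction L with
  | nil => simp [List.sections]
  | cons l L ih =>
    rw [List.sections, List.nodup_flatMap]
    refine ⟨fun s _ => (h l List.mem_cons_self).map fun a b hab => by simpa using hab, ?_⟩
    refine (ih fun l hl => h l (List.mem_cons_of_mem _ hl)).imp fun {s s'} hss => ?_
    rw [Function.onFun, List.disjoint_left]
    rintro _ hs hs'
    obtain ⟨a, -, rfl⟩ := List.mem_map.1 hs
    obtain ⟨a', -, h'⟩ := List.mem_map.1 hs'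
    exact hss (List.cons.inj h').2.symm

theorem nodup_boolVectors (m : ℕ) : (boolVectors m).Nodup :=
  nodup_sections fun l hl => by rw [List.eq_of_mem_replicate hl]; decide

@[simp]
theorem length_occurring (m : ℕ) (v : Word ℕ) : (occurring m v).length = m := by
  rw [occurring, List.length_map, List.length_range]

theorem getD_occurring (v : Word ℕ) {X : ℕ} (hX : X < m) :
    (occurring m v).getD X false = decide (0 < v.count (Sum.inl X)) := by
  rw [occurring, List.getD_eq_getElem _ _ (by simpa using hX), List.getElem_map, List.getElem_range,
    Bool.eq_iff_iff]
  simp [List.any_eq_true, List.count_pos_iff]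

theorem map_isSome_summaries {J : ℕ → List (Block Γ)} {A : List Bool} {σ : ℕ → Option (Word ℕ)}
    {fam : List (Option (Block Γ))} (hA : A.length = m) (h : fam ∈ families δ J n r m A σ) :
    (summaries fam).map Option.isSome = A := by
  have hlength := length_of_mem_families h
  refine List.ext_getElem (by simp [summaries, hlength, hA]) fun X _ hX => ?_
  have hisSome := isSome_of_mem_pick (getD_mem_pick_of_mem_families h (hA ▸ hX))
  rw [List.getD_eq_getElem _ _ hX, List.getD_eq_getElem _ _ (by lia)] at hisSome
  simpa [summaries] using hisSome

variable {Φ : (ℕ → List (Block Γ)) → M} {v : Word ℕ} {ν : Val}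

theorem lsum_families_occurring (hν : ∀ X, m ≤ X → ν X = none)
    (hv : ∀ X, v.count (Sum.inl X) ≤ 1) (hΦ : ∀ X, HasDegree X (v.count (Sum.inl X)) Φ) :
    (lsum (families δ (fun _ => []) n r m (occurring m v) (contentWord ν)) fun fam =>
      Φ (familyChoices fam)) = Φ (valBlocks δ n r ν) := by
  refine (eq_lsum_sections (A := fun X => (occurring m v).getD X false) (fun X hX => ?_)
    fun X hX => ?_).symm
  · simp [contentWord, hν X hX]
  · have hcount : (if decide (0 < v.count (Sum.inl X)) then 1 else 0) = v.count (Sum.inl X) := by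
      have := hv X
      simp only [decide_eq_true_eq]
      split <;> lia
    rw [getD_occurring v hX, hcount]
    exact hΦ X

/-- The choices of the registers on which the second transducer runs sum up to the only right
choice, for which the expansion over families applies. -/
theorem lsum_boolVectors_families (hν : ∀ X, m ≤ X → ν X = none)
    (hv : ∀ X, v.count (Sum.inl X) ≤ 1) (hΦ : ∀ X, HasDegree X (v.count (Sum.inl X)) Φ) :
    (lsum (boolVectors m) fun A =>
      lsum (families δ (fun _ => []) n r m A (contentWord ν)) fun fam =>
        bif decide (A = occurring m v) then Φ (familyChoices fam) else 0) =
      Φ (valBlocks δ n r ν) := by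
  rw [← lsum_families_occurring hν hv hΦ, ← lsum_cond_eq (nodup_boolVectors m)
    (mem_boolVectors.2 (length_occurring m v)) fun A =>
      lsum (families δ (fun _ => []) n r m A (contentWord ν)) fun fam => Φ (familyChoices fam)]
  refine lsum_congr fun A _ => ?_
  rw [lsum_cond_zero (decide (A = occurring m v))]
  exact congrArg (fun b => bif b then _ else _) (decide_eq_decide.2 eq_comm)

end Expansion

/-! ### Outputs of runs on words over registers and letters -/

section RunOutputs

variable {Γ Δ : Type}

/-- The outputs of the runs on `u` from the configurations in `ini`, where `fin` gives the output
words of the states. -/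
def runOutputs (δ : ℕ → ℕ → List (ℕ × Asg Γ)) (J : ℕ → List (Block Γ)) (ini : List (ℕ × Asg Γ))
    (fin : ℕ → List (Word Γ)) (u : Word ℕ) : List (List Γ) :=
  ini.flatMap fun c => (tokenRuns δ J u c).flatMap fun d => (fin d.1).flatMap fun v =>
    (subst d.2 v).toList.map letters

variable {δ : ℕ → ℕ → List (ℕ × Asg Γ)} {J : ℕ → List (Block Γ)} {ini : List (ℕ × Asg Γ)}
  {fin : ℕ → List (Word Γ)}

theorem letters_homWord (g : Γ → List Δ) (u : Word Γ) :
    letters (homWord g u) = (letters u).flatMap g := by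
  induction u with
  | nil => rfl
  | cons x u ih =>
    cases x with
    | inl Y => rw [homWord_inl_cons, letters_inl_cons, letters_inl_cons, ih]
    | inr a =>
      rw [homWord_inr_cons, letters_append, letters_map_inr, letters_inr_cons, ih,
        List.flatMap_cons]

theorem runOutputs_hom {g : Γ → List Δ} {δ' : ℕ → ℕ → List (ℕ × Asg Δ)} {J' : ℕ → List (Block Δ)}
    {ini' : List (ℕ × Asg Δ)} {fin' : ℕ → List (Word Δ)}
    (hδ : ∀ p o, δ' p o = (δ p o).map (Prod.map id (homAsg g)))
    (hJ : ∀ X, J' X = (J X).map (homBlock g)) (hini : ini' = ini.map (Prod.map id (homAsg g)))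
    (hfin : ∀ p, fin' p = (fin p).map (homWord g)) (u : Word ℕ) :
    runOutputs δ' J' ini' fin' u = (runOutputs δ J ini fin u).map (List.flatMap g) := by
  simp only [runOutputs, hini, List.flatMap_map, tokenRuns_hom hδ hJ, List.map_flatMap,
    Prod.map_fst, Prod.map_snd, id_eq, hfin, subst_homAsg_homWord]
  refine List.flatMap_congr fun _ _ => List.flatMap_congr fun d _ =>
    List.flatMap_congr fun v _ => ?_
  cases subst d.2 v with
  | none => rfl
  | some y => exact congrArg (fun l => [l]) (letters_homWord g y)

theorem runOutputs_valBlocks {n r : ℕ} (hδ : ∀ p o, ∀ d ∈ δ p o, d.1 < n ∧ d.2.length = r)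
    (hini : ∀ c ∈ ini, c.1 < n ∧ c.2.length = r) (ν : Val) (u : Word ℕ) :
    runOutputs δ (valBlocks δ n r ν) ini fin u =
      (evalWord ν u).elim [] fun w => runOutputs δ (fun _ => []) ini fin (w.map Sum.inr) := by
  rw [runOutputs, List.flatMap_congr fun c hc => by
    rw [tokenRuns_valBlocks hδ ν u c (hini c hc)]]
  cases evalWord ν u with
  | none => simp
  | some w => rfl

theorem hasDegree_runOutputs {M : Type*} [AddCommMonoid M] (X : ℕ) (f : List Γ → M)
    (u : Word ℕ) :
    HasDegree X (u.count (Sum.inl X)) fun J => lsum (runOutputs δ J ini fin u) f := by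
  simp only [runOutputs, lsum_flatMap]
  refine hasDegree_lsum _ fun c => ?_
  rw [← zero_add (u.count _)]
  exact hasDegree_tokenRuns (fun _ => hasDegree_const _) u c

theorem countP_le_of_mem_runOutputs {n r Cᵢ Cₒ : ℕ} {q : Γ → Bool} {B : ℕ ⊕ ℕ → ℕ}
    (hδ : ∀ p o, ∀ d ∈ δ p o, d.1 < n ∧ IsCopyless r d.2) (hJ : ∀ X, ∀ b ∈ J X, b.WellFormed n r)
    (hfin : ∀ p, ∀ v ∈ fin p, ∀ Y, (registers v).count Y ≤ 1)
    (hB : ∀ p x, ∀ d ∈ moves δ J p x, (letters (flat d.2)).countP q ≤ B x)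
    (hCᵢ : ∀ c ∈ ini, (letters (flat c.2)).countP q ≤ Cᵢ)
    (hCₒ : ∀ p, ∀ v ∈ fin p, (letters v).countP q ≤ Cₒ) {u : Word ℕ} {y : List Γ}
    (hy : y ∈ runOutputs δ J ini fin u) : y.countP q ≤ Cᵢ + (u.map B).sum + Cₒ := by
  simp only [runOutputs, List.mem_flatMap, List.mem_map, Option.mem_toList] at hy
  obtain ⟨c, hc, d, hd, v, hv, y, hsubst, rfl⟩ := hy
  have hrun := countP_letters_le_of_mem_tokenRuns hδ hJ hB hd
  have hlast := countP_letters_compAsg_le d.2 (τ := [some v]) (by simpa [flat] using hfin _ v hv) q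
  simp only [compAsg, flat, List.map_cons, List.map_nil, Option.bind_some, hsubst,
    List.flatMap_singleton, Option.getD_some] at hlast
  have hini := hCᵢ c hc
  have hout := hCₒ _ v hv
  rw [flat] at hrun
  lia

theorem forall_mem_of_mem_runOutputs {n r : ℕ} {P : Γ → Prop}
    (hδ : ∀ p o, ∀ d ∈ δ p o, d.1 < n ∧ IsCopyless r d.2) (hJ : ∀ X, ∀ b ∈ J X, b.WellFormed n r)
    (hfin : ∀ p, ∀ v ∈ fin p, ∀ Y, (registers v).count Y ≤ 1)
    (hP : ∀ p x, ∀ d ∈ moves δ J p x, ∀ a ∈ letters (flat d.2), P a)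
    (hPᵢ : ∀ c ∈ ini, ∀ a ∈ letters (flat c.2), P a)
    (hPₒ : ∀ p, ∀ v ∈ fin p, ∀ a ∈ letters v, P a) {u : Word ℕ} {y : List Γ}
    (hy : y ∈ runOutputs δ J ini fin u) : ∀ a ∈ y, P a := by
  classical
  have hzero : ∀ l : List Γ, (l.countP fun a => decide ¬P a) ≤ 0 ↔ ∀ a ∈ l, P a := fun l => by
    simp [List.countP_eq_zero]
  have hcount := countP_le_of_mem_runOutputs (q := fun a => decide ¬P a) (B := fun _ => 0) hδ hJ
    hfin (fun p x d hd => (hzero _).2 (hP p x d hd)) (fun c hc => (hzero _).2 (hPᵢ c hc))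
    (fun p v hv => (hzero _).2 (hPₒ p v hv)) hy
  refine (hzero y).1 (hcount.trans_eq ?_)
  simp

end RunOutputs

/-! ### Runs of a transducer on words of letters -/

section CodeRuns

/-- The assignment with the values of a valuation. -/
def constAsg (v : ValTable) : Asg ℕ := v.map (Option.map (List.map Sum.inr))

theorem mem_of_getD_eq_some {α : Type*} {l : List (Option α)} {i : ℕ} {a : α}
    (h : l.getD i none = some a) : some a ∈ l := by
  by_cases hi : i < l.length
  · rw [List.getD_eq_getElem _ _ hi] at h
    exact h ▸ List.getElem_mem hi
  · simp [hi] at h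

namespace Code

variable (c : Code)

/-- The moves of a transducer on a letter. -/
def moves (p o : ℕ) : List (ℕ × Asg ℕ) :=
  ((c.machine.step p).filter fun t => decide (t.1 = o)).map fun t => (t.2.2, t.2.1)

/-- The initial configurations of a transducer, with valuations as assignments. -/
def starts : List (ℕ × Asg ℕ) := c.machine.ini.map fun e => (e.1, constAsg e.2)

variable {c}

theorem mem_step {p : ℕ} {t : ℕ × Asg ℕ × ℕ} (ht : t ∈ c.machine.step p) :
    (p, t) ∈ c.trans := by
  obtain ⟨t', ht', rfl⟩ := List.mem_map.1 ht
  obtain ⟨ht', hp⟩ := List.mem_filter.1 ht'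
  exact of_decide_eq_true hp ▸ ht'

theorem mem_moves {p o : ℕ} {d : ℕ × Asg ℕ} (hd : d ∈ c.moves p o) :
    (p, o, d.2, d.1) ∈ c.trans := by
  obtain ⟨t, ht, rfl⟩ := List.mem_map.1 hd
  obtain ⟨ht, ho⟩ := List.mem_filter.1 ht
  exact of_decide_eq_true ho ▸ mem_step ht

theorem mem_ini {e : ℕ × ValTable} (he : e ∈ c.machine.ini) :
    e.1 < c.numStates ∧ some e.2 ∈ c.init := by
  obtain ⟨q, hq, he⟩ := List.mem_flatMap.1 he
  obtain ⟨v, hv, rfl⟩ := List.mem_map.1 he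
  exact ⟨List.mem_range.1 hq, mem_of_getD_eq_some (Option.mem_toList.1 hv)⟩

theorem mem_fin {p : ℕ} {u : Word ℕ} (hu : u ∈ c.machine.fin p) : some u ∈ c.final :=
  mem_of_getD_eq_some (Option.mem_toList.1 hu)

theorem WellFormed.moves (hc : c.WellFormed) :
    ∀ p o, ∀ d ∈ c.moves p o, d.1 < c.numStates ∧ IsCopyless c.numRegs d.2 := fun _ _ _ hd =>
  ⟨hc.dst_lt _ (mem_moves hd), hc.asg_copyless _ (mem_moves hd)⟩

theorem WellFormed.lt_and_length_of_mem_moves (hc : c.WellFormed) :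
    ∀ p o, ∀ d ∈ c.moves p o, d.1 < c.numStates ∧ d.2.length = c.numRegs := fun p o d hd =>
  (hc.moves p o d hd).imp_right IsCopyless.length_eq

theorem WellFormed.lt_and_length_of_mem_starts (hc : c.WellFormed) :
    ∀ d ∈ c.starts, d.1 < c.numStates ∧ d.2.length = c.numRegs :=
  List.forall_mem_map.2 fun _ he =>
    ⟨(mem_ini he).1, (List.length_map _).trans (hc.init_table_length _ (mem_ini he).2)⟩

end Code

theorem map_letters_subst (σ : Asg ℕ) (u : Word ℕ) :
    (subst σ u).map letters = evalWord (fun X => (σ.getD X none).map letters) u := by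
  induction u with
  | nil => rfl
  | cons x u ih =>
    cases x with
    | inl Y =>
      rw [subst_inl, evalWord, ← ih]
      cases subst σ u <;> cases σ.getD Y none <;> simp
    | inr o =>
      rw [subst_inr, evalWord, ← ih]
      cases subst σ u <;> simp [letters_inr_cons]

theorem lsum_tokenRuns_moves (c : Code) (w : List ℕ) (p : ℕ) (σ : Asg ℕ) :
    (lsum (tokenRuns c.moves (fun _ => []) (w.map Sum.inr) (p, σ)) fun d =>
      lsum (c.machine.fin d.1) fun v =>
        (((subst d.2 v).map letters).toList : Multiset (List ℕ))) =
      c.machine.outFrom w p fun X => (σ.getD X none).map letters := by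
  induction w generalizing p σ with
  | nil => simp only [List.map_nil, tokenRuns, lsum_singleton, map_letters_subst]; rfl
  | cons a w ih =>
    rw [List.map_cons, tokenRuns, lsum_flatMap, moves, Code.moves, lsum_map, Machine.outFrom]
    refine lsum_congr fun t _ => (ih _ _).trans (congrArg _ (funext fun X => ?_))
    rw [getD_compAsg, compVal]
    cases t.2.1.getD X none with
    | none => rfl
    | some u => exact map_letters_subst σ u

theorem lsum_runOutputs_moves (c : Code) (w : List ℕ) :
    (lsum (runOutputs c.moves (fun _ => []) c.starts c.machine.fin (w.map Sum.inr)) fun y =>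
      ({y} : Multiset (List ℕ))) = c.machine.sem w := by
  have hsingleton : ∀ o : Option (Word ℕ), (lsum (o.toList.map letters) fun y =>
      ({y} : Multiset (List ℕ))) = ((o.map letters).toList : Multiset (List ℕ)) := fun o => by
    cases o <;> rfl
  simp only [runOutputs, lsum_flatMap, hsingleton, lsum_tokenRuns_moves, Code.starts, lsum_map]
  refine lsum_congr fun e _ => congrArg _ (funext fun X => ?_)
  rw [constAsg, getD_map_option_map, Option.map_map, tableVal]
  exact (congrArg (Option.map · _) (funext letters_map_inr)).trans Option.map_id_apply

end CodeRuns

/-! ### The composition -/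

/-- A state of the composition of two transducers: a state of the first one and, for each register
of the first one on whose content the second one will run, the summary of a block on it. -/
abbrev State : Type := ℕ × List (Option Summary)

/-- The state of the first transducer. -/
abbrev State.base (s : State) : ℕ := s.1

/-- The summaries of the blocks. -/
abbrev State.summaries (s : State) : List (Option Summary) := s.2

/-- The moves of a transducer, over registers of the composition and letters. -/
def Code.liftedMoves (c : Code) (p o : ℕ) : List (ℕ × Asg (ℕ ⊕ ℕ)) :=
  (c.moves p o).map (Prod.map id liftAsg)

/-- The initial configurations of a transducer, over registers of the composition and letters. -/
def Code.liftedStarts (c : Code) : List (ℕ × Asg (ℕ ⊕ ℕ)) :=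
  c.starts.map (Prod.map id liftAsg)

/-- The output words of a transducer, over registers of the composition and letters. -/
def Code.liftedFin (c : Code) (p : ℕ) : List (Word (ℕ ⊕ ℕ)) := (c.machine.fin p).map liftWord

/-- The outputs of a transducer on a word, given summaries of blocks on the contents of registers;
their letters are registers of the composition and letters. -/
def Code.symbolicOutputs (c : Code) (s : List (Option Summary)) (u : Word ℕ) : List (Word ℕ) :=
  runOutputs c.liftedMoves (symbolicBlocks c.numRegs s) c.liftedStarts c.liftedFin u

section Compose

variable (c₁ c₂ : Code)

/-- The initial configurations of the composition. -/
def composeIni : List (State × ValTable) :=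
  c₁.machine.ini.flatMap fun e => (boolVectors c₁.numRegs).flatMap fun A =>
    (families c₂.moves (fun _ => []) c₂.numStates c₂.numRegs c₁.numRegs A
      (contentWord (tableVal e.2))).map fun fam =>
        ((e.1, summaries fam), contents c₁.numRegs c₂.numRegs fam)

/-- The transitions of the composition. The new blocks on registers in `A` use up the old blocks on
all the registers that occur in the words assigned to them, and there must be no other old block. -/
def composeStep (s : State) : List (ℕ × Asg ℕ × State) :=
  (c₁.machine.step s.base).flatMap fun t => (boolVectors c₁.numRegs).flatMap fun A =>
    bif decide (s.summaries.map Option.isSome =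
      occurring c₁.numRegs (selected c₁.numRegs A fun X => t.2.1.getD X none)) then
        (families c₂.liftedMoves (symbolicBlocks c₂.numRegs s.summaries) c₂.numStates c₂.numRegs
          c₁.numRegs A fun X => t.2.1.getD X none).map fun fam =>
            (t.1, contents c₁.numRegs c₂.numRegs fam, (t.2.2, summaries fam))
    else []

/-- The output words of the composition. -/
def composeFin (s : State) : List (Word ℕ) :=
  (c₁.machine.fin s.base).flatMap fun u =>
    bif decide (s.summaries.map Option.isSome = occurring c₁.numRegs u) then
      c₂.symbolicOutputs s.summaries u
    else []

/-- The composition of two transducers. -/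
def compose : Machine State := ⟨composeIni c₁ c₂, composeStep c₁ c₂, composeFin c₁ c₂⟩

end Compose

/-! ### Letters in lifted words -/

section Lift

theorem registers_liftWord (u : Word ℕ) : registers (liftWord u) = registers u := by
  simp only [registers, liftWord, List.filterMap_map]
  exact List.filterMap_congr fun x _ => by cases x <;> rfl

theorem letters_liftWord (u : Word ℕ) : letters (liftWord u) = (letters u).map Sum.inr := by
  simp only [letters, liftWord, List.filterMap_map, List.map_filterMap]
  exact List.filterMap_congr fun x _ => by cases x <;> rfl

theorem flat_liftAsg (σ : Asg ℕ) : flat (liftAsg σ) = liftWord (flat σ) := by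
  rw [flat, flat, liftAsg, List.flatMap_map, liftWord, List.map_flatMap]
  exact List.flatMap_congr fun o _ => by cases o <;> rfl

theorem IsCopyless.liftAsg {r : ℕ} {σ : Asg ℕ} (hσ : IsCopyless r σ) :
    IsCopyless r (liftAsg σ) where
  length_eq := (List.length_map _).trans hσ.length_eq
  isLinear_flat :=
    ⟨by simpa only [flat_liftAsg, registers_liftWord] using hσ.isLinear_flat.lt_of_mem,
      by simpa only [flat_liftAsg, registers_liftWord] using hσ.isLinear_flat.count_le_one⟩

variable {c : Code} (hc : c.WellFormed)

include hc

theorem Code.WellFormed.liftedMoves :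
    ∀ p o, ∀ d ∈ c.liftedMoves p o, d.1 < c.numStates ∧ IsCopyless c.numRegs d.2 := fun p o =>
  List.forall_mem_map.2 fun d hd => (hc.moves p o d hd).imp_right IsCopyless.liftAsg

theorem Code.WellFormed.liftedMoves_over :
    ∀ p o, ∀ d ∈ c.liftedMoves p o, letters (flat d.2) ⊆ c.outAlph.map Sum.inr := fun p o =>
  List.forall_mem_map.2 fun d hd => by
    rw [Prod.map_snd, flat_liftAsg, letters_liftWord]
    exact List.map_subset _ (hc.asg_over _ (mem_moves hd))

theorem Code.WellFormed.liftedStarts_over :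
    ∀ d ∈ c.liftedStarts, letters (flat d.2) ⊆ c.outAlph.map Sum.inr := by
  refine List.forall_mem_map.2 <| List.forall_mem_map.2 fun e he => ?_
  rw [Prod.map_snd, flat_liftAsg, letters_liftWord]
  refine List.map_subset _ fun a ha => ?_
  obtain ⟨u, hu, ha⟩ := mem_flat.1 (mem_letters.1 ha)
  obtain ⟨o, ho, hu⟩ := List.mem_map.1 hu
  obtain ⟨w, rfl, rfl⟩ := Option.map_eq_some_iff.1 hu
  exact hc.init_over _ (Code.mem_ini he).2 w ho (by simpa using ha)

theorem Code.WellFormed.liftedFin_over :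
    ∀ p, ∀ v ∈ c.liftedFin p, letters v ⊆ c.outAlph.map Sum.inr := fun _ =>
  List.forall_mem_map.2 fun v hv =>
    letters_liftWord v ▸ List.map_subset _ (hc.final_over v (Code.mem_fin hv))

theorem Code.WellFormed.count_registers_liftedFin_le :
    ∀ p, ∀ v ∈ c.liftedFin p, ∀ Y, (registers v).count Y ≤ 1 := fun _ =>
  List.forall_mem_map.2 fun v hv =>
    registers_liftWord v ▸ (hc.final_linear v (Code.mem_fin hv)).count_le_one

end Lift

/-! ### Registers and letters of the composition -/

section Symbols

/-- Well-formed summaries of blocks on some of `m` registers. -/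
structure WellFormedSummaries (n r m : ℕ) (s : List (Option Summary)) : Prop where
  length_eq : s.length = m
  wellFormed : ∀ e, some e ∈ s → e.WellFormed n r

theorem wellFormedSummaries_of_mem_families {Γ : Type} {δ : ℕ → ℕ → List (ℕ × Asg Γ)}
    {J : ℕ → List (Block Γ)} {n r m : ℕ} (hδ : ∀ p o, ∀ d ∈ δ p o, d.1 < n ∧ IsCopyless r d.2)
    (hJ : ∀ X, ∀ b ∈ J X, b.WellFormed n r) {A : List Bool} {σ : ℕ → Option (Word ℕ)}
    {fam : List (Option (Block Γ))} (h : fam ∈ families δ J n r m A σ) :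
    WellFormedSummaries n r m (summaries fam) where
  length_eq := (List.length_map _).trans (length_of_mem_families h)
  wellFormed e he := by
    obtain ⟨o, ho, he⟩ := List.mem_map.1 he
    obtain ⟨b, rfl, rfl⟩ := Option.map_eq_some_iff.1 he
    obtain ⟨X, hX, hb⟩ := List.mem_iff_getElem.1 ho
    refine (wellFormed_of_mem_families hδ hJ h (X := X) ?_).summary
    rw [List.getD_eq_getElem _ _ hX, hb]

/-- The registers and letters that occur in the effects of runs on words over `m` registers. -/
def Code.IsSymbol (c : Code) (m : ℕ) : ℕ ⊕ ℕ → Prop :=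
  Sum.elim (fun z => z < m * c.numRegs * (c.numRegs + 1)) fun o => o ∈ c.outAlph

variable {c : Code} {m : ℕ} {s : List (Option Summary)}

theorem Code.isSymbol_of_mem_map_inr {a : ℕ ⊕ ℕ} (ha : a ∈ c.outAlph.map Sum.inr) :
    c.IsSymbol m a := by
  obtain ⟨o, ho, rfl⟩ := List.mem_map.1 ha
  exact ho

theorem isSymbol_of_mem_symbolicBlocks (hs : WellFormedSummaries c.numStates c.numRegs m s) {X : ℕ}
    {b : Block (ℕ ⊕ ℕ)} (hb : b ∈ symbolicBlocks c.numRegs s X) :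
    ∀ a ∈ letters (flat b.asg), c.IsSymbol m a := by
  obtain ⟨e, he, hX, rfl⟩ := exists_of_mem_symbolicBlocks hb
  intro a ha
  obtain ⟨k, hk, rfl⟩ := List.mem_map.1
    ((letters_flat_unfoldShape_sublist (hs.wellFormed e he).isShape).subset ha)
  have hk := List.mem_range.1 hk
  have hX : X + 1 ≤ m := hs.length_eq ▸ hX
  calc X * (c.numRegs * (c.numRegs + 1)) + k
      < X * (c.numRegs * (c.numRegs + 1)) + c.numRegs * (c.numRegs + 1) := by omega
    _ = (X + 1) * (c.numRegs * (c.numRegs + 1)) := (Nat.succ_mul _ _).symm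
    _ ≤ m * (c.numRegs * (c.numRegs + 1)) := Nat.mul_le_mul_right _ hX
    _ = m * c.numRegs * (c.numRegs + 1) := (mul_assoc _ _ _).symm

variable (hc : c.WellFormed) (hs : WellFormedSummaries c.numStates c.numRegs m s)

include hc hs

theorem isSymbol_of_mem_moves (p : ℕ) (x : ℕ ⊕ ℕ) :
    ∀ d ∈ moves c.liftedMoves (symbolicBlocks c.numRegs s) p x,
      ∀ a ∈ letters (flat d.2), c.IsSymbol m a := by
  cases x with
  | inl X =>
    exact List.forall_mem_map.2 fun b hb =>
      isSymbol_of_mem_symbolicBlocks hs (List.mem_of_mem_filter hb)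
  | inr o =>
    exact fun d hd a ha => Code.isSymbol_of_mem_map_inr (hc.liftedMoves_over p o d hd ha)

theorem isSymbol_of_mem_content {A : List Bool} {σ : ℕ → Option (Word ℕ)}
    {fam : List (Option (Block (ℕ ⊕ ℕ)))}
    (h : fam ∈ families c.liftedMoves (symbolicBlocks c.numRegs s) c.numStates c.numRegs m A σ)
    {z : ℕ} (hz : z < m * c.numRegs * (c.numRegs + 1)) :
    ∀ a ∈ content c.numRegs fam z, c.IsSymbol m a :=
  forall_mem_content_of_mem_families hc.liftedMoves
    (fun _ _ => wellFormed_of_mem_symbolicBlocks hs.wellFormed) (isSymbol_of_mem_moves hc hs) h hz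

theorem isSymbol_of_mem_symbolicOutputs {u : Word ℕ} {y : Word ℕ}
    (hy : y ∈ c.symbolicOutputs s u) : ∀ a ∈ y, c.IsSymbol m a :=
  forall_mem_of_mem_runOutputs hc.liftedMoves
    (fun _ _ => wellFormed_of_mem_symbolicBlocks hs.wellFormed) hc.count_registers_liftedFin_le
    (isSymbol_of_mem_moves hc hs)
    (fun d hd _ ha => Code.isSymbol_of_mem_map_inr (hc.liftedStarts_over d hd ha))
    (fun p v hv _ ha => Code.isSymbol_of_mem_map_inr (hc.liftedFin_over p v hv ha)) hy

end Symbols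

/-! ### The semantics of the composition -/

section ComposeSemantics

variable {c₁ c₂ : Code} {A : List Bool} {σ : ℕ → Option (Word ℕ)} {fam : List (Option (Block ℕ))}

theorem count_selected_le {m : ℕ} {σ : Asg ℕ} (hσ : IsCopyless m σ) (A : List Bool) (X : ℕ) :
    (selected m A fun Y => σ.getD Y none).count (Sum.inl X) ≤ 1 := by
  have hsel : (selected m A fun Y => σ.getD Y none).Sublist (flat σ) := by
    rw [flat_eq_flatMap_range, hσ.length_eq]
    refine List.Sublist.flatMap_right _ fun Y => ?_
    cases A.getD Y false <;> simp
  refine (hsel.count_le _).trans ?_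
  rw [← count_registers]
  exact hσ.isLinear_flat.count_le_one X

theorem map_liftAsg_hom (r : ℕ) (fam : List (Option (Block ℕ))) (l : List (ℕ × Asg ℕ)) :
    l = (l.map (Prod.map id liftAsg)).map (Prod.map id (homAsg (wordOf r fam))) := by
  rw [List.map_map]
  refine (List.map_id l).symm.trans (List.map_congr_left fun d _ => ?_)
  exact Prod.ext rfl (homAsg_liftAsg r fam d.2).symm

variable (hc₂ : c₂.WellFormed) (hA : A.length = c₁.numRegs)
  (hfam : fam ∈ families c₂.moves (fun _ => []) c₂.numStates c₂.numRegs c₁.numRegs A σ)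

include hc₂ hfam

theorem isCopyless_of_mem_families {X : ℕ} {b : Block ℕ} (hb : fam.getD X none = some b) :
    IsCopyless c₂.numRegs b.asg :=
  (wellFormed_of_mem_families hc₂.moves (by simp) hfam hb).isCopyless

theorem runOutputs_familyChoices (u : Word ℕ) :
    runOutputs c₂.moves (familyChoices fam) c₂.starts c₂.machine.fin u =
      (c₂.symbolicOutputs (summaries fam) u).map (List.flatMap (wordOf c₂.numRegs fam)) := by
  refine runOutputs_hom (fun p o => map_liftAsg_hom _ _ _)
    (symbolicBlocks_hom fun X b => isCopyless_of_mem_families hc₂ hfam) (map_liftAsg_hom _ _ _)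
    (fun p => ?_) u
  rw [Code.liftedFin, List.map_map]
  exact (List.map_id _).symm.trans (List.map_congr_left fun v _ => (homWord_liftWord _ _ v).symm)

include hA

theorem outFrom_compose_nil (q : ℕ) :
    (compose c₁ c₂).outFrom [] (q, summaries fam)
        (tableVal (contents c₁.numRegs c₂.numRegs fam)) =
      lsum (c₁.machine.fin q) fun u => bif decide (A = occurring c₁.numRegs u) then
        lsum (runOutputs c₂.moves (familyChoices fam) c₂.starts c₂.machine.fin u) fun y =>
          ({y} : Multiset (List ℕ))
      else 0 := by
  have hs := wellFormedSummaries_of_mem_families hc₂.moves (by simp) hfam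
  simp only [Machine.outFrom, compose, composeFin, State.base, State.summaries,
    map_isSome_summaries hA hfam, lsum_flatMap, lsum_cond, lsum_nil,
    runOutputs_familyChoices hc₂ hfam, lsum_map]
  refine lsum_congr fun u _ => congrArg (cond _ · _) (lsum_congr fun y hy => ?_)
  rw [evalWord_contents fam fun z hz => isSymbol_of_mem_symbolicOutputs hc₂ hs hy _ hz]
  rfl

theorem outFrom_compose_cons (a : ℕ) (w : List ℕ) (q : ℕ) :
    (compose c₁ c₂).outFrom (a :: w) (q, summaries fam)
        (tableVal (contents c₁.numRegs c₂.numRegs fam)) =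
      lsum ((c₁.machine.step q).filter fun t => decide (t.1 = a)) fun t =>
        lsum (boolVectors c₁.numRegs) fun A' =>
          bif decide (A = occurring c₁.numRegs
              (selected c₁.numRegs A' fun X => t.2.1.getD X none)) then
            lsum (families c₂.moves (familyChoices fam) c₂.numStates c₂.numRegs c₁.numRegs A'
              fun X => t.2.1.getD X none) fun fam' =>
                (compose c₁ c₂).outFrom w (t.2.2, summaries fam')
                  (tableVal (contents c₁.numRegs c₂.numRegs fam'))
          else 0 := by
  have hs := wellFormedSummaries_of_mem_families hc₂.moves (by simp) hfam
  have hfamilies := families_hom (fun p o => map_liftAsg_hom c₂.numRegs fam (c₂.moves p o))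
    (symbolicBlocks_hom fun X b => isCopyless_of_mem_families hc₂ hfam)
  rw [Machine.outFrom]
  simp only [compose, composeStep, State.base, State.summaries, map_isSome_summaries hA hfam,
    lsum_filter, lsum_flatMap, lsum_cond, lsum_map, lsum_nil, hfamilies, summaries_hom]
  refine lsum_congr fun t _ => ?_
  by_cases ha : t.1 = a
  · simp only [ha, decide_true, cond_true]
    refine lsum_congr fun A' _ => congrArg (cond _ · _) (lsum_congr fun fam' hfam' => ?_)
    rw [compVal_contents fam fam' fun z hz z' hz' => isSymbol_of_mem_content hc₂ hs hfam' hz _ hz']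
  · simp [ha]

end ComposeSemantics

section ComposeSemantics

variable {c₁ c₂ : Code} (hc₁ : c₁.WellFormed) (hc₂ : c₂.WellFormed)

include hc₁ hc₂

theorem lsum_outFrom_compose_nil (q : ℕ) {ν : Val} (hν : ∀ X, c₁.numRegs ≤ X → ν X = none) :
    (lsum (boolVectors c₁.numRegs) fun A =>
      lsum (families c₂.moves (fun _ => []) c₂.numStates c₂.numRegs c₁.numRegs A (contentWord ν))
        fun fam => (compose c₁ c₂).outFrom [] (q, summaries fam)
          (tableVal (contents c₁.numRegs c₂.numRegs fam))) =
      (c₁.machine.outFrom [] q ν).bind c₂.machine.sem := by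
  rw [lsum_congr fun A hA => lsum_congr fun fam hfam =>
      outFrom_compose_nil hc₂ (mem_boolVectors.1 hA) hfam q,
    lsum_congr fun A _ => lsum_comm _ _ _, lsum_comm, Machine.outFrom, lsum_bind]
  refine lsum_congr fun u hu => ?_
  have hcount : ∀ X, u.count (Sum.inl X) ≤ 1 := fun X =>
    count_registers u X ▸ (hc₁.final_linear u (Code.mem_fin hu)).count_le_one X
  rw [lsum_boolVectors_families (Φ := fun J =>
      lsum (runOutputs c₂.moves J c₂.starts c₂.machine.fin u) fun y => ({y} : Multiset (List ℕ)))
      hν hcount fun X => hasDegree_runOutputs X _ u,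
    runOutputs_valBlocks hc₂.lt_and_length_of_mem_moves hc₂.lt_and_length_of_mem_starts]
  cases evalWord ν u with
  | none => rfl
  | some w => simp [lsum_runOutputs_moves]

/-- Each run of the second transducer on an output of the first one traverses the contents of the
registers that reach this output, so it is counted for exactly one set `A` of registers and exactly
one family of blocks on their contents. -/
theorem lsum_outFrom_compose (w : List ℕ) (q : ℕ) {ν : Val}
    (hν : ∀ X, c₁.numRegs ≤ X → ν X = none) :
    (lsum (boolVectors c₁.numRegs) fun A =>
      lsum (families c₂.moves (fun _ => []) c₂.numStates c₂.numRegs c₁.numRegs A (contentWord ν))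
        fun fam => (compose c₁ c₂).outFrom w (q, summaries fam)
          (tableVal (contents c₁.numRegs c₂.numRegs fam))) =
      (c₁.machine.outFrom w q ν).bind c₂.machine.sem := by
  induction w generalizing q ν with
  | nil => exact lsum_outFrom_compose_nil hc₁ hc₂ q hν
  | cons a w ih =>
    rw [lsum_congr fun A hA => lsum_congr fun fam hfam =>
        outFrom_compose_cons hc₂ (mem_boolVectors.1 hA) hfam a w q,
      lsum_congr fun A _ => lsum_comm _ _ _, lsum_comm, Machine.outFrom, lsum_bind]
    refine lsum_congr fun t ht => ?_
    have hσ := hc₁.asg_copyless _ (Code.mem_step (List.mem_of_mem_filter ht))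
    have hν' : ∀ X, c₁.numRegs ≤ X → compVal ν t.2.1 X = none := fun X hX => by
      simp [compVal, List.getElem?_eq_none (hσ.length_eq.trans_le hX)]
    rw [lsum_congr fun A _ => lsum_comm _ _ _, lsum_comm, ← ih _ hν']
    refine lsum_congr fun A' _ => ?_
    rw [lsum_boolVectors_families (Φ := fun J => lsum (families c₂.moves J c₂.numStates c₂.numRegs
        c₁.numRegs A' fun X => t.2.1.getD X none) fun fam =>
          (compose c₁ c₂).outFrom w (t.2.2, summaries fam)
            (tableVal (contents c₁.numRegs c₂.numRegs fam))) hν (count_selected_le hσ A')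
        fun X => ?_,
      families_valBlocks hc₂.lt_and_length_of_mem_moves]
    simpa only [zero_add] using hasDegree_families (fun _ => hasDegree_const _) A' _

theorem sem_compose (w : List ℕ) :
    (compose c₁ c₂).sem w = (c₁.machine.sem w).bind c₂.machine.sem := by
  simp only [Machine.sem, compose, composeIni, lsum_flatMap, lsum_map, lsum_bind]
  refine lsum_congr fun e he => lsum_outFrom_compose hc₁ hc₂ w e.1 fun X hX => ?_
  rw [← hc₁.init_table_length _ (Code.mem_ini he).2] at hX
  simp [tableVal, List.getElem?_eq_none hX]

end ComposeSemantics

/-! ### States of the composition -/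

section States

variable {α : Type*} {l : List α} {m r n : ℕ}

/-- The lists of `m` values, each undefined or in the list `l`. -/
def optionVectors (m : ℕ) (l : List α) : List (List (Option α)) :=
  (List.replicate m (none :: l.map some)).sections

theorem mem_optionVectors {s : List (Option α)} :
    s ∈ optionVectors m l ↔ s.length = m ∧ ∀ a, some a ∈ s → a ∈ l := by
  simp [optionVectors, mem_sections_replicate, Option.forall]

theorem nodup_optionVectors (hl : l.Nodup) : (optionVectors m l).Nodup :=
  nodup_sections fun l' hl' => by
    rw [List.eq_of_mem_replicate hl', List.nodup_cons]
    exact ⟨by simp, hl.map (Option.some_injective α)⟩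

/-- The words of length at most `r` over the first `r` registers. -/
def registerWords (r : ℕ) : List (List ℕ) :=
  (List.range (r + 1)).flatMap fun j => (List.replicate j (List.range r)).sections

theorem mem_registerWords {u : List ℕ} :
    u ∈ registerWords r ↔ u.length ≤ r ∧ ∀ Y ∈ u, Y < r := by
  simp [registerWords, mem_sections_replicate]

theorem nodup_registerWords (r : ℕ) : (registerWords r).Nodup := by
  refine List.nodup_flatMap.2 ⟨fun j _ => nodup_sections fun l hl => ?_, ?_⟩
  · rw [List.eq_of_mem_replicate hl]
    exact List.nodup_range
  · refine List.nodup_range.imp fun {i j} hij => List.disjoint_left.2 fun u hi hj => hij ?_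
    rw [← (mem_sections_replicate.1 hi).1, (mem_sections_replicate.1 hj).1]

/-- The shapes of the copyless assignments to `r` registers. -/
def shapes (r : ℕ) : List (List (Option (List ℕ))) :=
  (optionVectors r (registerWords r)).filter fun h => (List.range r).all fun Y =>
    decide ((h.flatMap fun o => o.getD []).count Y ≤ 1)

theorem IsShape.length_le {h : List (Option (List ℕ))} (hh : IsShape r h) {u : List ℕ}
    (hu : some u ∈ h) : u.length ≤ r := by
  have hsub : u.Sublist (h.flatMap fun o => o.getD []) :=
    List.sublist_flatten_of_mem (List.mem_map_of_mem (f := fun o => o.getD []) hu)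
  have hnodup : u.Nodup := hsub.nodup (List.nodup_iff_count_le_one.2 hh.count_le_one)
  simpa using (hnodup.subperm fun Y hY =>
    List.mem_range.2 (hh.lt_of_mem Y (hsub.subset hY))).length_le

theorem mem_shapes {h : List (Option (List ℕ))} : h ∈ shapes r ↔ IsShape r h := by
  simp only [shapes, List.mem_filter, mem_optionVectors, mem_registerWords, List.all_eq_true,
    List.mem_range, decide_eq_true_eq]
  refine ⟨fun ⟨⟨hlen, hwords⟩, hcount⟩ => ?_, fun hh => ⟨⟨hh.length_eq, fun u hu =>
    ⟨hh.length_le hu, fun Y hY => hh.lt_of_mem Y ?_⟩⟩, fun Y _ => hh.count_le_one Y⟩⟩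
  · have hlt : ∀ Y ∈ h.flatMap fun o => o.getD [], Y < r := by
      intro Y hY
      obtain ⟨_ | u, hu, hY⟩ := List.mem_flatMap.1 hY
      · exact absurd hY List.not_mem_nil
      · exact (hwords u hu).2 Y hY
    refine ⟨hlen, hlt, fun Y => ?_⟩
    by_cases hY : Y ∈ h.flatMap fun o => o.getD []
    · exact hcount Y (hlt Y hY)
    · exact (List.count_eq_zero.2 hY).trans_le zero_le_one
  · exact List.mem_flatMap.2 ⟨some u, hu, hY⟩

theorem nodup_shapes (r : ℕ) : (shapes r).Nodup :=
  (nodup_optionVectors (nodup_registerWords r)).filter _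

/-- The well-formed summaries for `n` states and `r` registers. -/
def allSummaries (n r : ℕ) : List Summary :=
  (List.range n ×ˢ List.range n ×ˢ shapes r).map fun b => ⟨b.1, b.2.1, b.2.2⟩

theorem mem_allSummaries {b : Summary} : b ∈ allSummaries n r ↔ b.WellFormed n r := by
  obtain ⟨p, p', h⟩ := b
  simp only [allSummaries, List.mem_map, Prod.exists, List.mem_product, List.mem_range,
    mem_shapes, Summary.mk.injEq]
  exact ⟨by rintro ⟨_, _, _, ⟨hp, hp', hh⟩, rfl, rfl, rfl⟩; exact ⟨hp, hp', hh⟩,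
    fun ⟨hp, hp', hh⟩ => ⟨_, _, _, ⟨hp, hp', hh⟩, rfl, rfl, rfl⟩⟩

theorem nodup_allSummaries (n r : ℕ) : (allSummaries n r).Nodup :=
  (List.nodup_range.product (List.nodup_range.product (nodup_shapes r))).map
    fun ⟨_, _, _⟩ ⟨_, _, _⟩ h => by simpa using h

/-- The states of the composition. -/
def states (c₁ c₂ : Code) : List State :=
  List.range c₁.numStates ×ˢ
    optionVectors c₁.numRegs (allSummaries c₂.numStates c₂.numRegs)

variable {c₁ c₂ : Code}

theorem mem_states {s : State} : s ∈ states c₁ c₂ ↔ s.base < c₁.numStates ∧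
    WellFormedSummaries c₂.numStates c₂.numRegs c₁.numRegs s.summaries := by
  obtain ⟨q, s⟩ := s
  simp only [states, List.mem_product, List.mem_range, mem_optionVectors, mem_allSummaries]
  exact and_congr_right fun _ => ⟨fun h => ⟨h.1, h.2⟩, fun h => ⟨h.1, h.2⟩⟩

theorem nodup_states (c₁ c₂ : Code) : (states c₁ c₂).Nodup :=
  List.nodup_range.product (nodup_optionVectors (nodup_allSummaries _ _))

end States

/-! ### The code of the composition -/

section CountRegisters

variable {c : Code} {m : ℕ} {s : List (Option Summary)}

theorem sum_map_ite_eq_count {α : Type*} [BEq α] (l : List α) (a : α) :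
    (l.map fun x => if x == a then 1 else 0).sum = l.count a := by
  induction l with
  | nil => rfl
  | cons x l ih => rw [List.map_cons, List.sum_cons, ih, List.count_cons, add_comm]

variable (hc : c.WellFormed) (hs : WellFormedSummaries c.numStates c.numRegs m s)
include hc hs

theorem count_letters_le_of_mem_moves (z p : ℕ) (x : ℕ ⊕ ℕ) :
    ∀ d ∈ moves c.liftedMoves (symbolicBlocks c.numRegs s) p x,
      (letters (flat d.2)).count (Sum.inl z) ≤
        if x == Sum.inl (z / (c.numRegs * (c.numRegs + 1))) then 1 else 0 := by
  intro d hd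
  rcases x with X | o
  · obtain ⟨b, hb, rfl⟩ := List.mem_map.1 hd
    obtain ⟨e, he, -, rfl⟩ := exists_of_mem_symbolicBlocks (List.mem_filter.1 hb).1
    have hsub := letters_flat_unfoldShape_sublist (X := X) (hs.wellFormed e he).isShape
    refine (hsub.count_le _).trans ?_
    split_ifs with hX
    · exact List.nodup_iff_count_le_one.1 (List.nodup_range.map fun k k' hk => by simpa using hk) _
    · refine (List.count_eq_zero.2 fun hz => hX (beq_iff_eq.2 ?_)).le
      obtain ⟨k, hk, hz⟩ := List.mem_map.1 hz
      have hk := List.mem_range.1 hk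
      rw [← Sum.inl.inj hz, Nat.mul_comm X, Nat.mul_add_div (Nat.zero_lt_of_lt hk),
        Nat.div_eq_of_lt hk, add_zero]
  · refine (List.count_eq_zero.2 fun hz => ?_).trans_le (Nat.zero_le _)
    simpa using hc.liftedMoves_over p o d hd hz

theorem isCopyless_contents {A : List Bool} {σ : Asg ℕ} (hσ : IsCopyless m σ)
    {fam : List (Option (Block (ℕ ⊕ ℕ)))}
    (h : fam ∈ families c.liftedMoves (symbolicBlocks c.numRegs s) c.numStates c.numRegs m A
      fun X => σ.getD X none) :
    IsCopyless (m * c.numRegs * (c.numRegs + 1)) (contents m c.numRegs fam : Asg ℕ) := by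
  have hflat : flat (contents m c.numRegs fam : Asg ℕ) =
      (List.range (m * c.numRegs * (c.numRegs + 1))).flatMap (content c.numRegs fam) := by
    simp [flat, contents, List.flatMap_map]
  refine ⟨by simp [contents], fun z hz => ?_, fun z => ?_⟩
  · rw [mem_registers, hflat] at hz
    obtain ⟨z', hz', hz⟩ := List.mem_flatMap.1 hz
    exact isSymbol_of_mem_content hc hs h (List.mem_range.1 hz') _ hz
  · rw [count_registers, hflat]
    refine (countP_content_le_of_mem_families hc.liftedMoves (fun X b hb =>
      wellFormed_of_mem_symbolicBlocks hs.wellFormed hb)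
      (count_letters_le_of_mem_moves hc hs z) h).trans ?_
    rw [sum_map_ite_eq_count]
    exact count_selected_le hσ A _

theorem count_le_one_of_mem_symbolicOutputs {u : Word ℕ} (hu : ∀ X, (registers u).count X ≤ 1)
    {y : Word ℕ} (hy : y ∈ c.symbolicOutputs s u) (z : ℕ) : (registers y).count z ≤ 1 := by
  have hinr : ∀ {l : List (ℕ ⊕ ℕ)}, l ⊆ c.outAlph.map Sum.inr → l.count (Sum.inl z) ≤ 0 :=
    fun hl => (List.count_eq_zero.2 fun hz => by simpa using hl hz).le
  rw [count_registers]
  refine (countP_le_of_mem_runOutputs (Cᵢ := 0) (Cₒ := 0) hc.liftedMoves (fun X b hb =>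
    wellFormed_of_mem_symbolicBlocks hs.wellFormed hb) hc.count_registers_liftedFin_le
    (count_letters_le_of_mem_moves hc hs z) (fun d hd => hinr (hc.liftedStarts_over d hd))
    (fun p v hv => hinr (hc.liftedFin_over p v hv)) hy).trans ?_
  rw [sum_map_ite_eq_count, zero_add, add_zero, ← count_registers]
  exact hu _

end CountRegisters

section ComposeCode

variable {c₁ c₂ : Code}

theorem mem_composeIni {e : State × ValTable} (he : e ∈ composeIni c₁ c₂) :
    ∃ e' ∈ c₁.machine.ini, ∃ A, ∃ fam ∈ families c₂.moves (fun _ => []) c₂.numStates c₂.numRegs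
      c₁.numRegs A (contentWord (tableVal e'.2)),
        e = ((e'.1, summaries fam), contents c₁.numRegs c₂.numRegs fam) := by
  simp only [composeIni, List.mem_flatMap, List.mem_map] at he
  obtain ⟨e', he', A, -, fam, hfam, rfl⟩ := he
  exact ⟨e', he', A, fam, hfam, rfl⟩

theorem mem_composeStep {s : State} {t : ℕ × Asg ℕ × State} (ht : t ∈ composeStep c₁ c₂ s) :
    ∃ t' ∈ c₁.machine.step s.base, ∃ A, ∃ fam ∈ families c₂.liftedMoves
      (symbolicBlocks c₂.numRegs s.summaries) c₂.numStates c₂.numRegs c₁.numRegs A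
        (fun X => t'.2.1.getD X none),
        t = (t'.1, contents c₁.numRegs c₂.numRegs fam, t'.2.2, summaries fam) := by
  simp only [composeStep, List.mem_flatMap] at ht
  obtain ⟨t', ht', A, -, ht⟩ := ht
  cases hA : decide (s.summaries.map Option.isSome =
    occurring c₁.numRegs (selected c₁.numRegs A fun X => t'.2.1.getD X none)) <;> rw [hA] at ht
  · exact absurd ht List.not_mem_nil
  · obtain ⟨fam, hfam, rfl⟩ := List.mem_map.1 ht
    exact ⟨t', ht', A, fam, hfam, rfl⟩

theorem mem_composeFin {s : State} {y : Word ℕ} (hy : y ∈ composeFin c₁ c₂ s) :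
    ∃ u ∈ c₁.machine.fin s.base, y ∈ c₂.symbolicOutputs s.summaries u := by
  obtain ⟨u, hu, hy⟩ := List.mem_flatMap.1 hy
  cases hs : decide (s.summaries.map Option.isSome = occurring c₁.numRegs u) <;> rw [hs] at hy
  · exact absurd hy List.not_mem_nil
  · exact ⟨u, hu, hy⟩

theorem wellFormed_compose (hc₁ : c₁.WellFormed) (hc₂ : c₂.WellFormed) :
    (compose c₁ c₂).WellFormed (states c₁ c₂) (c₁.numRegs * c₂.numRegs * (c₂.numRegs + 1))
      c₁.inAlph c₂.outAlph where
  ini_mem e he := by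
    obtain ⟨e', he', A, fam, hfam, rfl⟩ := mem_composeIni he
    exact mem_states.2 ⟨(Code.mem_ini he').1,
      wellFormedSummaries_of_mem_families hc₂.moves (by simp) hfam⟩
  ini_length e he := by
    obtain ⟨e', _, A, fam, _, rfl⟩ := mem_composeIni he
    simp [contents]
  ini_over e he w hw := by
    obtain ⟨e', _, A, fam, hfam, rfl⟩ := mem_composeIni he
    obtain ⟨z, hz, hw⟩ := List.mem_map.1 hw
    obtain rfl := Option.some.inj hw
    refine forall_mem_content_of_mem_families hc₂.moves (by simp) (fun p x d hd o ho => ?_) hfam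
      (List.mem_range.1 hz)
    rcases x with X | a
    · simp [moves] at hd
    · exact hc₂.asg_over _ (Code.mem_moves hd) ho
  step_mem s hs t ht := by
    obtain ⟨t', ht', A, fam, hfam, rfl⟩ := mem_composeStep ht
    exact mem_states.2 ⟨hc₁.dst_lt _ (Code.mem_step ht'), wellFormedSummaries_of_mem_families
      hc₂.liftedMoves (fun X b => wellFormed_of_mem_symbolicBlocks (mem_states.1 hs).2.wellFormed)
      hfam⟩
  step_letter s _ t ht := by
    obtain ⟨t', ht', A, fam, _, rfl⟩ := mem_composeStep ht
    exact hc₁.letter_mem _ (Code.mem_step ht')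
  step_copyless s hs t ht := by
    obtain ⟨t', ht', A, fam, hfam, rfl⟩ := mem_composeStep ht
    exact isCopyless_contents hc₂ (mem_states.1 hs).2 (hc₁.asg_copyless _ (Code.mem_step ht')) hfam
  step_over s hs t ht o ho := by
    obtain ⟨t', _, A, fam, hfam, rfl⟩ := mem_composeStep ht
    obtain ⟨u, hu, ho⟩ := mem_flat.1 (mem_letters.1 ho)
    obtain ⟨z, hz, hu⟩ := List.mem_map.1 hu
    obtain rfl := Option.some.inj hu
    exact isSymbol_of_mem_content hc₂ (mem_states.1 hs).2 hfam (List.mem_range.1 hz) _ ho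
  fin_linear s hs y hy := by
    obtain ⟨u, hu, hy⟩ := mem_composeFin hy
    exact ⟨fun z hz => isSymbol_of_mem_symbolicOutputs hc₂ (mem_states.1 hs).2 hy _
      (mem_registers.1 hz), count_le_one_of_mem_symbolicOutputs hc₂ (mem_states.1 hs).2
        (hc₁.final_linear u (Code.mem_fin hu)).count_le_one hy⟩
  fin_over s hs y hy o ho := by
    obtain ⟨u, _, hy⟩ := mem_composeFin hy
    exact isSymbol_of_mem_symbolicOutputs hc₂ (mem_states.1 hs).2 hy _ (mem_letters.1 ho)

/-- The code of a transducer for the composition of two coded transducers. -/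
def composeCode (c₁ c₂ : Code) : Code :=
  (compose c₁ c₂).toCode (states c₁ c₂) (c₁.numRegs * c₂.numRegs * (c₂.numRegs + 1)) c₁.inAlph
    c₂.outAlph

theorem wellFormed_composeCode (hc₁ : c₁.WellFormed) (hc₂ : c₂.WellFormed) :
    (composeCode c₁ c₂).WellFormed :=
  Machine.wellFormed_toCode (wellFormed_compose hc₁ hc₂)

theorem sem_composeCode (hc₁ : c₁.WellFormed) (hc₂ : c₂.WellFormed) (w : List ℕ) :
    (composeCode c₁ c₂).machine.sem w = (c₁.machine.sem w).bind c₂.machine.sem :=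
  (Machine.sem_toCode (nodup_states c₁ c₂) (wellFormed_compose hc₁ hc₂) w).trans
    (sem_compose hc₁ hc₂ w)

end ComposeCode

/-! ### Sizes -/

section TableCodeSize

variable {α : Type*}

/-- The size of a partial map from registers to strings, given by the list of its values. -/
def tableCodeSize (l : List (Option (List α))) : ℕ :=
  (l.map fun o => o.elim 0 fun u => u.length + 1).sum

/-- The size of a transducer in terms of its code. -/
def codeSize (c : Code) : ℕ :=
  c.numStates + c.numRegs + c.inAlph.length + c.outAlph.length
    + (c.trans.map fun t => tableCodeSize t.asg + 1).sum
    + (c.init.map fun o => o.elim 0 fun v => tableCodeSize v + 1).sum + tableCodeSize c.final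

theorem tableCodeSize_ofFn {β : Type} {r : ℕ} (σ : Fin r → Option (List β)) {g : List β → List α}
    (hg : ∀ u, (g u).length = u.length) :
    tableCodeSize (List.ofFn fun X => (σ X).map g) = tableSize σ := by
  rw [tableCodeSize, List.map_ofFn, List.sum_ofFn, tableSize]
  exact Finset.sum_congr rfl fun X _ => by cases h : σ X <;> simp [h, hg]

theorem codeSize_code (T : NSST) : codeSize T.code = T.size := by
  have hasg (t : Transition T.numStates T.numRegs) :
      tableCodeSize (transitionCode t).asg = tableSize t.asg :=
    tableCodeSize_ofFn t.asg fun _ => List.length_map _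
  have hinit : (T.code.init.map fun o => o.elim 0 fun v => tableCodeSize v + 1).sum =
      ∑ q, (T.init q).elim 0 fun ν => tableSize ν + 1 := by
    rw [code, Code.init, List.map_ofFn, List.sum_ofFn]
    refine Finset.sum_congr rfl fun q _ => ?_
    cases h : T.init q with
    | none => simp [h]
    | some ν => simpa [h] using tableCodeSize_ofFn ν (g := id) fun _ => rfl
  have hfinal : tableCodeSize T.code.final = ∑ q, (T.final q).elim 0 fun u => u.length + 1 :=
    tableCodeSize_ofFn T.final fun _ => List.length_map _
  rw [codeSize, hinit, hfinal, code_trans, List.map_map]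
  simp only [Function.comp_def, hasg, size]
  simp [code, Code.numStates, Code.numRegs, Code.inAlph, Code.outAlph]

theorem length_le_tableCodeSize {l : List (Option (List α))} {u : List α} (hu : some u ∈ l) :
    u.length ≤ tableCodeSize l := by
  have := List.single_le_sum (fun _ _ => Nat.zero_le _) _ (List.mem_map_of_mem
    (f := fun o : Option (List α) => o.elim 0 fun u => u.length + 1) hu)
  exact (Nat.le_succ _).trans this

theorem length_flat_le {Γ : Type} (σ : Asg Γ) : (flat σ).length ≤ tableCodeSize σ := by
  rw [flat, List.length_flatMap, tableCodeSize]
  exact List.sum_le_sum fun o _ => by cases o <;> simp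

theorem tableCodeSize_constAsg (v : ValTable) : tableCodeSize (constAsg v) = tableCodeSize v := by
  rw [tableCodeSize, constAsg, List.map_map]
  exact congrArg List.sum (List.map_congr_left fun o _ => by cases o <;> simp)

theorem length_selected_le (m : ℕ) (A : List Bool) (σ : Asg ℕ) :
    (selected m A fun X => σ.getD X none).length ≤ tableCodeSize σ := by
  have hsum := sum_countP_getD_le (List.nodup_range (n := m)) σ fun _ => true
  simp only [List.countP_true] at hsum
  refine le_trans ?_ (hsum.trans (length_flat_le σ))
  rw [selected, List.length_flatMap]
  exact List.sum_le_sum fun X _ => by cases A.getD X false <;> simp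

theorem length_letters_le {Γ : Type} (u : Word Γ) : (letters u).length ≤ u.length :=
  List.length_filterMap_le _ _

theorem tableCodeSize_contents_le {Γ : Type} {δ : ℕ → ℕ → List (ℕ × Asg Γ)}
    {J : ℕ → List (Block Γ)} {n r m D : ℕ} (hδ : ∀ p o, ∀ d ∈ δ p o, d.1 < n ∧ IsCopyless r d.2)
    (hJ : ∀ X, ∀ b ∈ J X, b.WellFormed n r)
    (hD : ∀ p x, ∀ d ∈ moves δ J p x, (letters (flat d.2)).length ≤ D) {A : List Bool}
    {σ : Asg ℕ} {fam : List (Option (Block Γ))}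
    
    (h : fam ∈ families δ J n r m A fun X => σ.getD X none) :
    tableCodeSize (contents m r fam) ≤ m * r * (r + 1) + tableCodeSize σ * D := by
  have hcount := countP_content_le_of_mem_families hδ hJ (q := fun _ => true) (B := fun _ => D)
    (by simpa using hD) h
  simp only [List.countP_true, List.length_flatMap, List.map_const', List.sum_replicate,
    smul_eq_mul] at hcount
  have hsize : tableCodeSize (contents m r fam) = m * r * (r + 1) +
      ((List.range (m * r * (r + 1))).map fun z => (content r fam z).length).sum := by
    simp [tableCodeSize, contents, Function.comp_def, List.sum_map_add, Nat.add_comm]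
  rw [hsize]
  gcongr
  exact hcount.trans (Nat.mul_le_mul_right D (length_selected_le m A σ))

end TableCodeSize

section Bounded

/-- A bound on the constituents of a code that is linear in the size of the transducer. -/
structure Bounded (m : ℕ) (c : Code) : Prop where
  numStates_le : c.numStates ≤ m
  numRegs_le : c.numRegs ≤ m
  length_inAlph_le : c.inAlph.length ≤ m
  length_outAlph_le : c.outAlph.length ≤ m
  length_trans_le : c.trans.length ≤ m
  asg_le : ∀ t ∈ c.trans, tableCodeSize t.asg ≤ m
  init_le : ∀ v, some v ∈ c.init → tableCodeSize v ≤ m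
  final_le : ∀ u, some u ∈ c.final → u.length ≤ m

theorem bounded_of_codeSize_le {c : Code} {m : ℕ} (hm : codeSize c ≤ m) : Bounded m c := by
  have htrans : c.trans.length ≤ (c.trans.map fun t => tableCodeSize t.asg + 1).sum := by
    simp [List.sum_map_add]
  have hasg (t) (ht : t ∈ c.trans) :=
    List.single_le_sum (fun _ _ => Nat.zero_le _) _
      (List.mem_map_of_mem (f := fun t : TransCode ℕ ℕ => tableCodeSize t.asg + 1) ht)
  have hinit (v) (hv : some v ∈ c.init) :=
    List.single_le_sum (fun _ _ => Nat.zero_le _) _ (List.mem_map_of_mem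
      (f := fun o : Option ValTable => o.elim 0 fun v => tableCodeSize v + 1) hv)
  simp only [Option.elim_some] at hinit
  unfold codeSize at hm
  constructor
  case asg_le => intro t ht; have := hasg t ht; lia
  case init_le => intro v hv; have := hinit v hv; lia
  case final_le => intro u hu; have := length_le_tableCodeSize hu; lia
  all_goals lia

end Bounded

section Lengths

variable {α β : Type*} {k b : ℕ}

theorem sum_map_le {l : List α} {f : α → ℕ} (hl : l.length ≤ k) (hf : ∀ a ∈ l, f a ≤ b) :
    (l.map f).sum ≤ k * b := by
  have := List.sum_le_card_nsmul (l.map f) b (List.forall_mem_map.2 hf)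
  rw [List.length_map, smul_eq_mul] at this
  exact this.trans (Nat.mul_le_mul_right b hl)

theorem length_flatMap_le {l : List α} {f : α → List β} (hl : l.length ≤ k)
    (hf : ∀ a ∈ l, (f a).length ≤ b) : (l.flatMap f).length ≤ k * b := by
  rw [List.length_flatMap]
  exact sum_map_le hl hf

theorem length_product_le {l : List α} {l' : List β} (hl : l.length ≤ k) (hl' : l'.length ≤ b) :
    (l ×ˢ l').length ≤ k * b := by
  rw [List.length_product]
  exact Nat.mul_le_mul hl hl'

theorem length_sections_le {L : List (List α)} (hL : ∀ l ∈ L, l.length ≤ b) :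
    L.sections.length ≤ b ^ L.length := by
  induction L with
  | nil => simp
  | cons l L ih =>
    rw [List.length_cons, pow_succ, List.sections]
    exact length_flatMap_le (ih fun l' h => hL l' (List.mem_cons_of_mem _ h)) fun s _ => by
      simpa using hL l List.mem_cons_self

theorem length_boolVectors (m : ℕ) : (boolVectors m).length ≤ 2 ^ m := by
  simpa [boolVectors] using
    length_sections_le (L := List.replicate m [false, true]) (b := 2) (by simp)

theorem length_optionVectors_le (m : ℕ) {l : List α} (hl : l.length ≤ k) :
    (optionVectors m l).length ≤ (k + 1) ^ m := by
  simpa [optionVectors] using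
    length_sections_le (L := List.replicate m (none :: l.map some)) (b := k + 1) fun l' h => by
      simpa [List.eq_of_mem_replicate h] using hl

end Lengths

section LengthRuns

variable {Γ : Type} {δ : ℕ → ℕ → List (ℕ × Asg Γ)} {J : ℕ → List (Block Γ)} {k : ℕ}

theorem length_tokenRuns_le (h : ∀ p x, (moves δ J p x).length ≤ k) (u : Word ℕ) (c : ℕ × Asg Γ) :
    (tokenRuns δ J u c).length ≤ k ^ u.length := by
  induction u generalizing c with
  | nil => simp [tokenRuns]
  | cons x u ih =>
    rw [tokenRuns, List.length_cons, pow_succ']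
    exact length_flatMap_le (h c.1 x) fun d _ => ih _

theorem length_families_le {n r m : ℕ} (hk : 0 < k) (h : ∀ p x, (moves δ J p x).length ≤ k)
    (A : List Bool) (σ : Asg ℕ) :
    (families δ J n r m A fun X => σ.getD X none).length ≤
      (n * k ^ tableCodeSize σ + 1) ^ m := by
  have hblocks (u) (hu : u.length ≤ tableCodeSize σ) :
      (blocks δ J n r u).length ≤ n * k ^ tableCodeSize σ :=
    length_flatMap_le List.length_range.le fun p _ => by
      rw [List.length_map]
      exact (length_tokenRuns_le h u _).trans (Nat.pow_le_pow_right hk hu)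
  refine (length_sections_le (b := n * k ^ tableCodeSize σ + 1) ?_).trans_eq (by simp)
  refine List.forall_mem_map.2 fun X _ => ?_
  rcases A.getD X false
  · simp [pick]
  · rcases hX : σ.getD X none with _ | u
    · simp [-List.getD_eq_getElem?_getD, pick, hX]
    · have := hblocks u (length_le_tableCodeSize (mem_of_getD_eq_some hX))
      simpa [-List.getD_eq_getElem?_getD, pick, hX] using this.trans (Nat.le_succ _)

theorem length_runOutputs_le {ini : List (ℕ × Asg Γ)} {fin : ℕ → List (Word Γ)}
    (h : ∀ p x, (moves δ J p x).length ≤ k) (hfin : ∀ p, (fin p).length ≤ 1) (u : Word ℕ) :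
    (runOutputs δ J ini fin u).length ≤ ini.length * k ^ u.length := by
  have hone (d : ℕ × Asg Γ) :
      ((fin d.1).flatMap fun v => (subst d.2 v).toList.map letters).length ≤ 1 * 1 :=
    length_flatMap_le (hfin d.1) fun v _ => by cases subst d.2 v <;> simp
  exact length_flatMap_le le_rfl fun c _ =>
    (length_flatMap_le (length_tokenRuns_le h u c) fun d _ => hone d).trans_eq (by ring)

end LengthRuns

section LengthStates

theorem length_registerWords_le (r : ℕ) : (registerWords r).length ≤ (r + 1) * (r + 1) ^ r := by
  refine length_flatMap_le (by simp) fun j hj => ?_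
  have hj : j ≤ r := Nat.lt_succ_iff.1 (List.mem_range.1 hj)
  refine (length_sections_le (b := r + 1) (by simp)).trans ?_
  rw [List.length_replicate]
  exact Nat.pow_le_pow_right r.succ_pos hj

/-- A bound on the number of summaries of blocks with at most `m` states and `m` registers. -/
def summaryBound (m : ℕ) : ℕ := m * (m * ((m + 1) * (m + 1) ^ m + 1) ^ m)

/-- A bound on the number of states of the composition. -/
def stateBound (m : ℕ) : ℕ := m * (summaryBound m + 1) ^ m

theorem length_allSummaries_le {n r m : ℕ} (hn : n ≤ m) (hr : r ≤ m) :
    (allSummaries n r).length ≤ summaryBound m := by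
  have hshapes : (shapes r).length ≤ ((m + 1) * (m + 1) ^ m + 1) ^ m :=
    calc (shapes r).length ≤ (optionVectors r (registerWords r)).length := List.length_filter_le _ _
      _ ≤ ((r + 1) * (r + 1) ^ r + 1) ^ r := length_optionVectors_le r (length_registerWords_le r)
      _ ≤ ((m + 1) * (m + 1) ^ m + 1) ^ m := by gcongr <;> lia
  have hrange : (List.range n).length ≤ m := by simpa
  rw [allSummaries, List.length_map]
  exact length_product_le hrange (length_product_le hrange hshapes)

theorem length_states_le {m : ℕ} {c₁ c₂ : Code} (h₁ : Bounded m c₁) (h₂ : Bounded m c₂) :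
    (states c₁ c₂).length ≤ stateBound m := by
  refine length_product_le (by simpa using h₁.numStates_le) ?_
  refine (length_optionVectors_le _ (length_allSummaries_le h₂.numStates_le h₂.numRegs_le)).trans ?_
  exact Nat.pow_le_pow_right (Nat.succ_pos _) h₁.numRegs_le

end LengthStates

namespace Machine

variable {S : Type} {M : Machine S} {S₀ : List S} {b f k E : ℕ}

theorem finBound_le (hS : S₀.length ≤ k) (hfin : ∀ s ∈ S₀, (M.fin s).length ≤ f) :
    M.finBound S₀ ≤ k * f + 1 :=
  Nat.succ_le_succ (length_flatMap_le hS hfin)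

/-- A bound on the number of states of the code of a machine with at most `k` states, `b` initial
configurations, and `f` output words at each state. -/
def copyBound (b f k : ℕ) : ℕ := (b + 1) * ((k * f + 1) * k)

theorem length_copies_le (hS : S₀.length ≤ k) (hini : M.ini.length ≤ b)
    (hfin : ∀ s ∈ S₀, (M.fin s).length ≤ f) : (M.copies S₀).length ≤ copyBound b f k := by
  have hfirst : (List.range (M.ini.length + 1)).length ≤ b + 1 := by simpa
  have hsecond : (List.range (M.finBound S₀)).length ≤ k * f + 1 := by
    simpa using finBound_le hS hfin
  exact length_product_le hfirst (length_product_le hsecond hS)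

theorem length_copyStep_le {L : ℕ} {s : ℕ × ℕ × S} (hstep : (M.step s.2.2).length ≤ b) :
    (M.copyStep L s).length ≤ b * L := by
  rw [copyStep]
  cases decide (0 = s.2.1) with
  | false => exact Nat.zero_le _
  | true => exact length_flatMap_le hstep fun t _ => by simp

/-- A bound on the size of the tables in the code of a machine with at most `k` states, at most `b`
transitions from each state, at most `b` initial configurations, at most `f` output words at each
state, and entries of size at most `E`. -/
def tableBound (b f k E : ℕ) : ℕ :=
  copyBound b f k * (b * (k * f + 1)) * (E + 1) + copyBound b f k * (E + 1) +
    copyBound b f k * (E + 1)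

theorem codeSize_toCode_le [DecidableEq S] {r : ℕ} {inA outA : List ℕ} (hS : S₀.length ≤ k)
    (hini : M.ini.length ≤ b) (hstep : ∀ s ∈ S₀, (M.step s).length ≤ b)
    (hfin : ∀ s ∈ S₀, (M.fin s).length ≤ f) (hiniE : ∀ e ∈ M.ini, tableCodeSize e.2 ≤ E)
    (hstepE : ∀ s ∈ S₀, ∀ t ∈ M.step s, tableCodeSize t.2.1 ≤ E)
    (hfinE : ∀ s ∈ S₀, ∀ u ∈ M.fin s, u.length ≤ E) :
    codeSize (M.toCode S₀ r inA outA) ≤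
      copyBound b f k + r + inA.length + outA.length + tableBound b f k E := by
  have hcopies := length_copies_le hS hini hfin
  have htrans : ((M.toCode S₀ r inA outA).trans.map fun t => tableCodeSize t.asg + 1).sum ≤
      copyBound b f k * (b * (k * f + 1)) * (E + 1) := by
    refine sum_map_le (length_flatMap_le hcopies fun s hs => ?_) fun t ht => ?_
    · rw [List.length_map]
      exact (length_copyStep_le (hstep _ (mem_copies.1 hs).2.2)).trans
        (Nat.mul_le_mul_left b (finBound_le hS hfin))
    · obtain ⟨s, hs, s', ht⟩ := exists_step_of_mem_trans_toCode ht
      exact Nat.succ_le_succ (hstepE s hs _ ht)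
  have hinit : ((M.toCode S₀ r inA outA).init.map fun o =>
      o.elim 0 fun v => tableCodeSize v + 1).sum ≤ copyBound b f k * (E + 1) := by
    refine sum_map_le ((List.length_map _).trans_le hcopies) fun o ho => ?_
    rcases o with _ | v
    · exact Nat.zero_le _
    · obtain ⟨s, hs⟩ := exists_ini_of_mem_init_toCode ho
      exact Nat.succ_le_succ (hiniE _ hs)
  have hfinal : tableCodeSize (M.toCode S₀ r inA outA).final ≤ copyBound b f k * (E + 1) := by
    refine sum_map_le ((List.length_map _).trans_le hcopies) fun o ho => ?_
    rcases o with _ | u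
    · exact Nat.zero_le _
    · obtain ⟨s, hs, hu⟩ := exists_fin_of_mem_final_toCode ho
      exact Nat.succ_le_succ (hfinE s hs u hu)
  have hrest : (M.toCode S₀ r inA outA).numStates + (M.toCode S₀ r inA outA).numRegs +
      (M.toCode S₀ r inA outA).inAlph.length + (M.toCode S₀ r inA outA).outAlph.length ≤
        copyBound b f k + r + inA.length + outA.length :=
    Nat.add_le_add_right (Nat.add_le_add_right (Nat.add_le_add_right hcopies r) _) _
  rw [codeSize, tableBound]
  linarith

end Machine

section CodeBounds

variable {c : Code} {m : ℕ} (hc : Bounded m c)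
include hc

theorem Bounded.length_ini_le : c.machine.ini.length ≤ m :=
  (length_flatMap_le (b := 1) (by simpa using hc.numStates_le) fun q _ => by
    cases c.init.getD q none <;> simp).trans_eq (Nat.mul_one m)

theorem Bounded.length_step_le (p : ℕ) : (c.machine.step p).length ≤ m := by
  rw [Code.machine, List.length_map]
  exact (List.length_filter_le _ _).trans hc.length_trans_le

omit hc in
theorem length_fin_le (c : Code) (p : ℕ) : (c.machine.fin p).length ≤ 1 := by
  rw [Code.machine]
  cases c.final.getD p none <;> simp

theorem Bounded.length_moves_le (p : ℕ) (x : ℕ ⊕ ℕ) :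
    (moves c.moves (fun _ => []) p x).length ≤ m := by
  rcases x with _ | o
  · exact Nat.zero_le _
  · rw [moves, Code.moves, List.length_map]
    exact (List.length_filter_le _ _).trans (hc.length_step_le p)

theorem Bounded.length_moves_symbolicBlocks_le (hm : 1 ≤ m) (s : List (Option Summary)) (p : ℕ)
    (x : ℕ ⊕ ℕ) :
    (moves c.liftedMoves (symbolicBlocks c.numRegs s) p x).length ≤ m := by
  rcases x with X | o
  · rw [moves, List.length_map]
    refine (List.length_filter_le _ _).trans (le_trans ?_ hm)
    rw [symbolicBlocks, familyChoices, List.length_map]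
    cases s.getD X none <;> simp
  · rw [moves, Code.liftedMoves, List.length_map]
    exact hc.length_moves_le p (Sum.inr o)

theorem Bounded.length_letters_le_of_mem_moves {p o : ℕ} {d : ℕ × Asg ℕ} (hd : d ∈ c.moves p o) :
    (letters (flat d.2)).length ≤ m :=
  (length_letters_le _).trans ((length_flat_le _).trans (hc.asg_le _ (Code.mem_moves hd)))

theorem Bounded.length_letters_le_of_mem_moves_symbolicBlocks {k : ℕ} {s : List (Option Summary)}
    (hs : WellFormedSummaries c.numStates c.numRegs k s) (p : ℕ) (x : ℕ ⊕ ℕ) :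
    ∀ d ∈ moves c.liftedMoves (symbolicBlocks c.numRegs s) p x,
      (letters (flat d.2)).length ≤ m * (m + 1) := by
  rcases x with X | o <;> refine List.forall_mem_map.2 fun d hd => ?_
  · obtain ⟨e, he, _, rfl⟩ := exists_of_mem_symbolicBlocks (List.mem_of_mem_filter hd)
    refine (letters_flat_unfoldShape_sublist (hs.2 e he).isShape).length_le.trans ?_
    rw [List.length_map, List.length_range]
    have := hc.numRegs_le
    gcongr
  · rw [Prod.map_snd, flat_liftAsg, letters_liftWord, List.length_map]
    exact (hc.length_letters_le_of_mem_moves hd).trans (Nat.le_mul_of_pos_right m m.succ_pos)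

end CodeBounds

section ComposeBounds

variable {c₁ c₂ : Code} {m : ℕ}

/-- A bound on the number of families in the construction of the composition. -/
def familyBound (m : ℕ) : ℕ := (m * m ^ m + 1) ^ m

/-- A bound on the number of initial configurations of the composition, and on the number of
transitions from each of its states. -/
def branchBound (m : ℕ) : ℕ := m * (2 ^ m * familyBound m)

/-- A bound on the number of output words at each state of the composition. -/
def outputBound (m : ℕ) : ℕ := m * m ^ m

/-- A bound on the size of the valuations, assignments and output words of the composition. -/
def entryBound (m : ℕ) : ℕ := m * m * (m + 1) + m * (m * (m + 1)) + 2 * m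

theorem Bounded.length_families_le {Γ : Type} (h₁ : Bounded m c₁) (h₂ : Bounded m c₂)
    (hm : 1 ≤ m) {δ : ℕ → ℕ → List (ℕ × Asg Γ)} {J : ℕ → List (Block Γ)}
    (h : ∀ p x, (moves δ J p x).length ≤ m) {A : List Bool} {σ : Asg ℕ}
    (hσ : tableCodeSize σ ≤ m) :
    (families δ J c₂.numStates c₂.numRegs c₁.numRegs A fun X => σ.getD X none).length ≤
      familyBound m := by
  refine (NSST.length_families_le hm h A σ).trans ?_
  have := h₂.numStates_le
  calc (c₂.numStates * m ^ tableCodeSize σ + 1) ^ c₁.numRegs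
      ≤ (m * m ^ m + 1) ^ c₁.numRegs := by gcongr
    _ ≤ (m * m ^ m + 1) ^ m := Nat.pow_le_pow_right (Nat.succ_pos _) h₁.numRegs_le

theorem contentWord_tableVal (v : ValTable) :
    contentWord (tableVal v) = fun X => (constAsg v).getD X none :=
  funext fun X => (getD_map_option_map (List.map Sum.inr) v X).symm

variable (h₁ : Bounded m c₁) (h₂ : Bounded m c₂)
include h₁ h₂

theorem length_composeIni_le (hm : 1 ≤ m) : (composeIni c₁ c₂).length ≤ branchBound m := by
  refine length_flatMap_le h₁.length_ini_le fun e he => ?_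
  refine length_flatMap_le ((length_boolVectors _).trans
    (Nat.pow_le_pow_right two_pos h₁.numRegs_le)) fun A _ => ?_
  rw [List.length_map, contentWord_tableVal]
  refine h₁.length_families_le h₂ hm h₂.length_moves_le ?_
  exact (tableCodeSize_constAsg e.2).trans_le (h₁.init_le _ (Code.mem_ini he).2)

theorem length_composeStep_le (hm : 1 ≤ m) (s : State) :
    (composeStep c₁ c₂ s).length ≤ branchBound m := by
  refine length_flatMap_le (h₁.length_step_le _) fun t ht => ?_
  refine length_flatMap_le ((length_boolVectors _).trans
    (Nat.pow_le_pow_right two_pos h₁.numRegs_le)) fun A _ => ?_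
  cases decide (s.summaries.map Option.isSome =
    occurring c₁.numRegs (selected c₁.numRegs A fun X => t.2.1.getD X none)) with
  | false => exact Nat.zero_le _
  | true =>
    rw [cond_true, List.length_map]
    exact h₁.length_families_le h₂ hm (h₂.length_moves_symbolicBlocks_le hm s.summaries)
      (h₁.asg_le _ (Code.mem_step ht))

theorem length_composeFin_le (hm : 1 ≤ m) (s : State) :
    (composeFin c₁ c₂ s).length ≤ outputBound m := by
  refine (length_flatMap_le (length_fin_le c₁ s.base) fun u hu => ?_).trans_eq (Nat.one_mul _)
  cases decide (s.summaries.map Option.isSome = occurring c₁.numRegs u) with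
  | false => exact Nat.zero_le _
  | true =>
    have hfin (p) : (c₂.liftedFin p).length ≤ 1 := (List.length_map _).trans_le (length_fin_le c₂ p)
    have hini : c₂.liftedStarts.length ≤ m := by
      simpa [Code.liftedStarts, Code.starts] using h₂.length_ini_le
    have hu := h₁.final_le u (Code.mem_fin hu)
    refine (length_runOutputs_le (h₂.length_moves_symbolicBlocks_le hm s.summaries) hfin u).trans ?_
    exact Nat.mul_le_mul hini (Nat.pow_le_pow_right hm hu)

theorem tableCodeSize_le_of_mem_composeIni (hc₂ : c₂.WellFormed) {e : State × ValTable}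
    (he : e ∈ composeIni c₁ c₂) : tableCodeSize e.2 ≤ entryBound m := by
  obtain ⟨e', he', A, fam, hfam, rfl⟩ := mem_composeIni he
  rw [contentWord_tableVal] at hfam
  have hmoves (p) (x : ℕ ⊕ ℕ) : ∀ d ∈ moves c₂.moves (fun _ => []) p x,
      (letters (flat d.2)).length ≤ m * (m + 1) := fun d hd => by
    rcases x with _ | o
    · simp [moves] at hd
    · exact (h₂.length_letters_le_of_mem_moves hd).trans (Nat.le_mul_of_pos_right m m.succ_pos)
  have hsize := tableCodeSize_contents_le hc₂.moves (by simp) hmoves hfam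
  rw [tableCodeSize_constAsg] at hsize
  have := h₁.init_le _ (Code.mem_ini he').2
  have := h₁.numRegs_le
  have := h₂.numRegs_le
  refine hsize.trans (le_add_right ?_)
  gcongr

theorem tableCodeSize_le_of_mem_composeStep (hc₂ : c₂.WellFormed) {s : State}
    (hs : s ∈ states c₁ c₂) {t : ℕ × Asg ℕ × State} (ht : t ∈ composeStep c₁ c₂ s) :
    tableCodeSize t.2.1 ≤ entryBound m := by
  obtain ⟨t', ht', A, fam, hfam, rfl⟩ := mem_composeStep ht
  have hs := (mem_states.1 hs).2
  have hsize := tableCodeSize_contents_le hc₂.liftedMoves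
    (fun X b hb => wellFormed_of_mem_symbolicBlocks hs.wellFormed hb)
    (h₂.length_letters_le_of_mem_moves_symbolicBlocks hs) hfam
  have := h₁.asg_le _ (Code.mem_step ht')
  have := h₁.numRegs_le
  have := h₂.numRegs_le
  refine hsize.trans (le_add_right ?_)
  gcongr

theorem length_le_of_mem_composeFin (hc₂ : c₂.WellFormed) {s : State} (hs : s ∈ states c₁ c₂)
    {y : Word ℕ} (hy : y ∈ composeFin c₁ c₂ s) : y.length ≤ entryBound m := by
  obtain ⟨u, hu, hy⟩ := mem_composeFin hy
  have hs := (mem_states.1 hs).2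
  have hstarts : ∀ d ∈ c₂.liftedStarts, (letters (flat d.2)).length ≤ m :=
    List.forall_mem_map.2 <| List.forall_mem_map.2 fun e he => by
      rw [Prod.map_snd, flat_liftAsg, letters_liftWord, List.length_map]
      refine (length_letters_le _).trans ((length_flat_le _).trans ?_)
      exact (tableCodeSize_constAsg e.2).trans_le (h₂.init_le _ (Code.mem_ini he).2)
  have hfin (p) : ∀ v ∈ c₂.liftedFin p, (letters v).length ≤ m :=
    List.forall_mem_map.2 fun v hv => by
      rw [letters_liftWord, List.length_map]
      exact (length_letters_le _).trans (h₂.final_le v (Code.mem_fin hv))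
  have hcount := countP_le_of_mem_runOutputs (q := fun _ => true) (B := fun _ => m * (m + 1))
    hc₂.liftedMoves (fun X b hb => wellFormed_of_mem_symbolicBlocks hs.wellFormed hb)
    hc₂.count_registers_liftedFin_le
    (by simpa using h₂.length_letters_le_of_mem_moves_symbolicBlocks hs) (by simpa using hstarts)
    (by simpa using hfin) hy
  simp only [List.countP_true, List.map_const', List.sum_replicate, smul_eq_mul] at hcount
  have := Nat.mul_le_mul_right (m * (m + 1)) (h₁.final_le u (Code.mem_fin hu))
  rw [entryBound]
  lia

/-- A bound on the size of the composition of transducers of size at most `m`. -/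
def sizeBound (m : ℕ) : ℕ :=
  Machine.copyBound (branchBound m) (outputBound m) (stateBound m) + m * m * (m + 1) + m + m +
    Machine.tableBound (branchBound m) (outputBound m) (stateBound m) (entryBound m)

theorem codeSize_composeCode_le (hc₂ : c₂.WellFormed) (hm : 1 ≤ m) :
    codeSize (composeCode c₁ c₂) ≤ sizeBound m := by
  have hsize := Machine.codeSize_toCode_le (M := compose c₁ c₂) (inA := c₁.inAlph)
    (outA := c₂.outAlph) (r := c₁.numRegs * c₂.numRegs * (c₂.numRegs + 1))
    (length_states_le h₁ h₂) (length_composeIni_le h₁ h₂ hm)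
    (fun s _ => length_composeStep_le h₁ h₂ hm s) (fun s _ => length_composeFin_le h₁ h₂ hm s)
    (fun _ he => tableCodeSize_le_of_mem_composeIni h₁ h₂ hc₂ he)
    (fun _ hs _ ht => tableCodeSize_le_of_mem_composeStep h₁ h₂ hc₂ hs ht)
    (fun _ hs _ hu => length_le_of_mem_composeFin h₁ h₂ hc₂ hs hu)
  have := h₁.numRegs_le
  have := h₂.numRegs_le
  have := h₁.length_inAlph_le
  have := h₂.length_outAlph_le
  refine hsize.trans ?_
  rw [sizeBound]
  gcongr

end ComposeBounds

/-! ### Exponential bounds -/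

section ExpBounded

/-- A function is bounded by an exponential of a polynomial. -/
def ExpBounded (f : ℕ → ℕ) : Prop := ∃ P : Polynomial ℕ, ∀ m, f m ≤ 2 ^ P.eval m

theorem ExpBounded.const (k : ℕ) : ExpBounded fun _ => k :=
  ⟨Polynomial.C k, fun m => by simpa using k.lt_two_pow_self.le⟩

theorem ExpBounded.id : ExpBounded fun m => m :=
  ⟨Polynomial.X, fun m => by simpa using m.lt_two_pow_self.le⟩

variable {f g : ℕ → ℕ}

theorem ExpBounded.mul (hf : ExpBounded f) (hg : ExpBounded g) :
    ExpBounded fun m => f m * g m := by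
  obtain ⟨P, hP⟩ := hf
  obtain ⟨Q, hQ⟩ := hg
  refine ⟨P + Q, fun m => ?_⟩
  rw [Polynomial.eval_add, pow_add]
  exact Nat.mul_le_mul (hP m) (hQ m)

theorem ExpBounded.add (hf : ExpBounded f) (hg : ExpBounded g) :
    ExpBounded fun m => f m + g m := by
  obtain ⟨P, hP⟩ := hf
  obtain ⟨Q, hQ⟩ := hg
  refine ⟨P + Q + 1, fun m => ?_⟩
  calc f m + g m
      ≤ 2 ^ (P + Q).eval m + 2 ^ (P + Q).eval m := by
        rw [Polynomial.eval_add]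
        exact Nat.add_le_add ((hP m).trans (Nat.pow_le_pow_right two_pos (Nat.le_add_right _ _)))
          ((hQ m).trans (Nat.pow_le_pow_right two_pos (Nat.le_add_left _ _)))
    _ = 2 ^ (P + Q + 1).eval m := by simp [pow_succ, mul_two]

theorem ExpBounded.pow_self (hf : ExpBounded f) : ExpBounded fun m => f m ^ m := by
  obtain ⟨P, hP⟩ := hf
  refine ⟨P * Polynomial.X, fun m => ?_⟩
  rw [Polynomial.eval_mul, Polynomial.eval_X, pow_mul]
  exact Nat.pow_le_pow_left (hP m) m

theorem expBounded_sizeBound : ExpBounded sizeBound := by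
  have succ {f : ℕ → ℕ} (hf : ExpBounded f) : ExpBounded fun m => f m + 1 := hf.add (.const 1)
  have hstate : ExpBounded stateBound :=
    .mul .id <| .pow_self <| succ <| .mul .id <| .mul .id <| .pow_self <| succ <|
      .mul (succ .id) <| .pow_self <| succ .id
  have hbranch : ExpBounded branchBound :=
    .mul .id <| .mul (.pow_self <| .const 2) <| .pow_self <| succ <| .mul .id <| .pow_self .id
  have houtput : ExpBounded outputBound := .mul .id <| .pow_self .id
  have hreg : ExpBounded fun m => m * m * (m + 1) := .mul (.mul .id .id) (succ .id)
  have hentry : ExpBounded fun m => entryBound m + 1 :=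
    succ <| (hreg.add <| .mul .id <| .mul .id <| succ .id).add <| .mul (.const 2) .id
  have hfin : ExpBounded fun m => stateBound m * outputBound m + 1 := succ (hstate.mul houtput)
  have hcopy : ExpBounded fun m =>
      Machine.copyBound (branchBound m) (outputBound m) (stateBound m) :=
    (succ hbranch).mul (hfin.mul hstate)
  have htable : ExpBounded fun m =>
      Machine.tableBound (branchBound m) (outputBound m) (stateBound m) (entryBound m) :=
    (((hcopy.mul (hbranch.mul hfin)).mul hentry).add (hcopy.mul hentry)).add (hcopy.mul hentry)
  exact (((hcopy.add hreg).add .id).add .id).add htable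

end ExpBounded

/-! ### Computability -/

section Primrec

variable {α β γ Γ Δ S : Type} [Primcodable α] [Primcodable β] [Primcodable γ] [Primcodable Γ]
  [Primcodable Δ] [Primcodable S]

/-- Blocks as triples. -/
def Block.equivProd : Block Γ ≃ ℕ × ℕ × Asg Γ where
  toFun b := (b.src, b.dst, b.asg)
  invFun b := ⟨b.1, b.2.1, b.2.2⟩

instance : Primcodable (Block Γ) := Primcodable.ofEquiv _ Block.equivProd

/-- Summaries as triples. -/
def Summary.equivProd : Summary ≃ ℕ × ℕ × List (Option (List ℕ)) where
  toFun b := (b.src, b.dst, b.shape)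
  invFun b := ⟨b.1, b.2.1, b.2.2⟩

instance : Primcodable Summary := Primcodable.ofEquiv _ Summary.equivProd

@[fun_prop]
theorem primrec_block_src {f : α → Block Γ} (hf : Primrec f) : Primrec fun a => (f a).src :=
  Primrec.fst.comp (Primrec.of_equiv.comp hf)

@[fun_prop]
theorem primrec_block_dst {f : α → Block Γ} (hf : Primrec f) : Primrec fun a => (f a).dst :=
  Primrec.fst.comp (Primrec.snd.comp (Primrec.of_equiv.comp hf))

@[fun_prop]
theorem primrec_block_asg {f : α → Block Γ} (hf : Primrec f) : Primrec fun a => (f a).asg :=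
  Primrec.snd.comp (Primrec.snd.comp (Primrec.of_equiv.comp hf))

@[fun_prop]
theorem primrec_block_mk {p q : α → ℕ} {σ : α → Asg Γ} (hp : Primrec p) (hq : Primrec q)
    (hσ : Primrec σ) : Primrec fun a => Block.mk (p a) (q a) (σ a) :=
  Primrec.of_equiv_symm.comp (hp.pair (hq.pair hσ))

@[fun_prop]
theorem primrec_summary_src {f : α → Summary} (hf : Primrec f) : Primrec fun a => (f a).src :=
  Primrec.fst.comp (Primrec.of_equiv.comp hf)

@[fun_prop]
theorem primrec_summary_dst {f : α → Summary} (hf : Primrec f) : Primrec fun a => (f a).dst :=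
  Primrec.fst.comp (Primrec.snd.comp (Primrec.of_equiv.comp hf))

@[fun_prop]
theorem primrec_summary_shape {f : α → Summary} (hf : Primrec f) : Primrec fun a => (f a).shape :=
  Primrec.snd.comp (Primrec.snd.comp (Primrec.of_equiv.comp hf))

@[fun_prop]
theorem primrec_summary_mk {p q : α → ℕ} {h : α → List (Option (List ℕ))} (hp : Primrec p)
    (hq : Primrec q) (hh : Primrec h) : Primrec fun a => Summary.mk (p a) (q a) (h a) :=
  Primrec.of_equiv_symm.comp (hp.pair (hq.pair hh))

@[fun_prop]
theorem primrec_subst {σ : α → Asg Γ} {u : α → Word Γ} (hσ : Primrec σ) (hu : Primrec u) :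
    Primrec fun a => subst (σ a) (u a) := by
  unfold subst
  fun_prop

@[fun_prop]
theorem primrec_compAsg {σ τ : α → Asg Γ} (hσ : Primrec σ) (hτ : Primrec τ) :
    Primrec fun a => compAsg (σ a) (τ a) := by
  unfold compAsg
  fun_prop

@[fun_prop]
theorem primrec_idAsg {r : α → ℕ} (hr : Primrec r) : Primrec fun a => (idAsg (r a) : Asg Γ) := by
  unfold idAsg
  fun_prop

@[fun_prop]
theorem primrec_segments {u : α → Word Γ} (hu : Primrec u) : Primrec fun a => segments (u a) := by
  unfold segments
  fun_prop

@[fun_prop]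
theorem primrec_registers {u : α → Word Γ} (hu : Primrec u) :
    Primrec fun a => registers (u a) := by
  have heq : (Sum.getLeft? : ℕ ⊕ Γ → Option ℕ) = Sum.elim some fun _ => none := by
    funext x; cases x <;> rfl
  simp only [registers, heq, List.filterMap_eq_flatMap_toList]
  fun_prop

@[fun_prop]
theorem primrec_letters {u : α → Word Γ} (hu : Primrec u) : Primrec fun a => letters (u a) := by
  have heq : (Sum.getRight? : ℕ ⊕ Γ → Option Γ) = Sum.elim (fun _ => none) some := by
    funext x; cases x <;> rfl
  simp only [letters, heq, List.filterMap_eq_flatMap_toList]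
  fun_prop

section Machine

variable [DecidableEq S]

@[fun_prop]
theorem primrec_numberedCode {S₀ : α → List S} {r : α → ℕ} {inA outA : α → List ℕ}
    {step : α → S → List (ℕ × Asg ℕ × S)} {init : α → S → Option ValTable}
    {final : α → S → Option (Word ℕ)} (hS : Primrec S₀) (hr : Primrec r) (hinA : Primrec inA)
    (houtA : Primrec outA) (hstep : Primrec fun p : α × S => step p.1 p.2)
    (hinit : Primrec fun p : α × S => init p.1 p.2)
    (hfinal : Primrec fun p : α × S => final p.1 p.2) :
    Primrec fun a =>
      numberedCode (S₀ a) (r a) (inA a) (outA a) (step a) (init a) (final a) := by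
  unfold numberedCode
  fun_prop

theorem primrec_toCode {ini : α → List (S × ValTable)} {step : α → S → List (ℕ × Asg ℕ × S)}
    {fin : α → S → List (Word ℕ)} {S₀ : α → List S} {r : α → ℕ} {inA outA : α → List ℕ}
    (hini : Primrec ini) (hstep : Primrec fun p : α × S => step p.1 p.2)
    (hfin : Primrec fun p : α × S => fin p.1 p.2) (hS : Primrec S₀) (hr : Primrec r)
    (hinA : Primrec inA) (houtA : Primrec outA) :
    Primrec fun a =>
      (Machine.mk (ini a) (step a) (fin a)).toCode (S₀ a) (r a) (inA a) (outA a) := by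
  unfold Machine.toCode Machine.copies Machine.copyStep Machine.copyInit Machine.copyFinal
    Machine.finBound
  fun_prop

end Machine

@[fun_prop]
theorem primrec_moves {δ : α → ℕ → ℕ → List (ℕ × Asg Γ)} {J : α → ℕ → List (Block Γ)} {p : α → ℕ}
    {x : α → ℕ ⊕ ℕ} (hδ : Primrec fun q : α × ℕ × ℕ => δ q.1 q.2.1 q.2.2)
    (hJ : Primrec fun q : α × ℕ => J q.1 q.2) (hp : Primrec p) (hx : Primrec x) :
    Primrec fun a => moves (δ a) (J a) (p a) (x a) := by
  have heq : ∀ a, moves (δ a) (J a) (p a) (x a) = Sum.elim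
      (fun X => ((J a X).filter fun b => decide (b.src = p a)).map fun b => (b.dst, b.asg))
      (fun o => δ a (p a) o) (x a) := fun a => by cases x a <;> rfl
  simp only [heq]
  fun_prop

omit [Primcodable Γ] in
theorem flatMap_tokenRuns (δ : ℕ → ℕ → List (ℕ × Asg Γ)) (J : ℕ → List (Block Γ)) (u : Word ℕ)
    (L : List (ℕ × Asg Γ)) :
    L.flatMap (tokenRuns δ J u) = u.foldl (fun L x => L.flatMap fun c =>
      (moves δ J c.1 x).map fun d => (d.1, compAsg c.2 d.2)) L := by
  induction u generalizing L with
  | nil => simp [tokenRuns]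
  | cons x u ih =>
    simp only [List.foldl_cons, ← ih, List.flatMap_assoc, List.flatMap_map, tokenRuns]

@[fun_prop]
theorem primrec_tokenRuns {δ : α → ℕ → ℕ → List (ℕ × Asg Γ)} {J : α → ℕ → List (Block Γ)}
    {u : α → Word ℕ} {c : α → ℕ × Asg Γ} (hδ : Primrec fun q : α × ℕ × ℕ => δ q.1 q.2.1 q.2.2)
    (hJ : Primrec fun q : α × ℕ => J q.1 q.2) (hu : Primrec u) (hc : Primrec c) :
    Primrec fun a => tokenRuns (δ a) (J a) (u a) (c a) := by
  have heq : ∀ a, tokenRuns (δ a) (J a) (u a) (c a) = _ := fun a =>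
    (List.flatMap_singleton _ _).symm.trans (flatMap_tokenRuns (δ a) (J a) (u a) [c a])
  simp only [heq]
  fun_prop

@[fun_prop]
theorem primrec_blocks {δ : α → ℕ → ℕ → List (ℕ × Asg Γ)} {J : α → ℕ → List (Block Γ)}
    {n r : α → ℕ} {u : α → Word ℕ} (hδ : Primrec fun q : α × ℕ × ℕ => δ q.1 q.2.1 q.2.2)
    (hJ : Primrec fun q : α × ℕ => J q.1 q.2) (hn : Primrec n) (hr : Primrec r) (hu : Primrec u) :
    Primrec fun a => blocks (δ a) (J a) (n a) (r a) (u a) := by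
  unfold blocks
  fun_prop

@[fun_prop]
theorem primrec_pick {b : α → Bool} {l : α → List β} (hb : Primrec b) (hl : Primrec l) :
    Primrec fun a => pick (b a) (l a) := by
  unfold pick
  fun_prop

@[fun_prop]
theorem primrec_families {δ : α → ℕ → ℕ → List (ℕ × Asg Γ)} {J : α → ℕ → List (Block Γ)}
    {n r m : α → ℕ} {A : α → List Bool} {σ : α → ℕ → Option (Word ℕ)}
    (hδ : Primrec fun q : α × ℕ × ℕ => δ q.1 q.2.1 q.2.2)
    (hJ : Primrec fun q : α × ℕ => J q.1 q.2) (hn : Primrec n) (hr : Primrec r) (hm : Primrec m)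
    (hA : Primrec A) (hσ : Primrec fun q : α × ℕ => σ q.1 q.2) :
    Primrec fun a => families (δ a) (J a) (n a) (r a) (m a) (A a) (σ a) := by
  unfold families
  fun_prop

@[fun_prop]
theorem primrec_selected {m : α → ℕ} {A : α → List Bool} {σ : α → ℕ → Option (Word ℕ)}
    (hm : Primrec m) (hA : Primrec A) (hσ : Primrec fun q : α × ℕ => σ q.1 q.2) :
    Primrec fun a => selected (m a) (A a) (σ a) := by
  unfold selected
  fun_prop

@[fun_prop]
theorem primrec_summaries {fam : α → List (Option (Block Γ))} (hfam : Primrec fam) :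
    Primrec fun a => summaries (fam a) := by
  unfold summaries Block.summary shapeOf
  fun_prop

@[fun_prop]
theorem primrec_contents {m r : α → ℕ} {fam : α → List (Option (Block Γ))} (hm : Primrec m)
    (hr : Primrec r) (hfam : Primrec fam) :
    Primrec fun a => contents (m a) (r a) (fam a) := by
  unfold contents content segment
  fun_prop

@[fun_prop]
theorem primrec_symbolicBlocks {r X : α → ℕ} {s : α → List (Option Summary)} (hr : Primrec r)
    (hs : Primrec s) (hX : Primrec X) : Primrec fun a => symbolicBlocks (r a) (s a) (X a) := by
  unfold symbolicBlocks familyChoices symbolicBlock unfoldShape interleave regIndex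
  fun_prop

@[fun_prop]
theorem primrec_liftWord {u : α → Word ℕ} (hu : Primrec u) : Primrec fun a => liftWord (u a) := by
  have heq : (Sum.map id Sum.inr : ℕ ⊕ ℕ → ℕ ⊕ ℕ ⊕ ℕ) =
      Sum.elim Sum.inl fun o => Sum.inr (Sum.inr o) := by
    funext x; cases x <;> rfl
  simp only [liftWord, heq]
  fun_prop

@[fun_prop]
theorem primrec_liftAsg {σ : α → Asg ℕ} (hσ : Primrec σ) : Primrec fun a => liftAsg (σ a) := by
  unfold liftAsg
  fun_prop

@[fun_prop]
theorem primrec_boolVectors {m : α → ℕ} (hm : Primrec m) :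
    Primrec fun a => boolVectors (m a) := by
  unfold boolVectors
  fun_prop

@[fun_prop]
theorem primrec_occurring {m : α → ℕ} {u : α → Word ℕ} (hm : Primrec m) (hu : Primrec u) :
    Primrec fun a => occurring (m a) (u a) := by
  unfold occurring
  fun_prop

@[fun_prop]
theorem primrec_runOutputs {δ : α → ℕ → ℕ → List (ℕ × Asg Γ)} {J : α → ℕ → List (Block Γ)}
    {ini : α → List (ℕ × Asg Γ)} {fin : α → ℕ → List (Word Γ)} {u : α → Word ℕ}
    (hδ : Primrec fun q : α × ℕ × ℕ => δ q.1 q.2.1 q.2.2)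
    (hJ : Primrec fun q : α × ℕ => J q.1 q.2) (hini : Primrec ini)
    (hfin : Primrec fun q : α × ℕ => fin q.1 q.2) (hu : Primrec u) :
    Primrec fun a => runOutputs (δ a) (J a) (ini a) (fin a) (u a) := by
  unfold runOutputs
  fun_prop

@[fun_prop]
theorem primrec_optionVectors {m : α → ℕ} {l : α → List β} (hm : Primrec m) (hl : Primrec l) :
    Primrec fun a => optionVectors (m a) (l a) := by
  unfold optionVectors
  fun_prop

section Code

variable {c c₁ c₂ : α → Code} (hc : Primrec c) (h₁ : Primrec c₁) (h₂ : Primrec c₂)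

include hc in
@[fun_prop]
theorem primrec_machine_ini : Primrec fun a => (c a).machine.ini := by
  unfold Code.machine
  fun_prop

include hc in
@[fun_prop]
theorem primrec_machine_step {p : α → ℕ} (hp : Primrec p) :
    Primrec fun a => (c a).machine.step (p a) := by
  unfold Code.machine
  fun_prop

include hc in
@[fun_prop]
theorem primrec_machine_fin {p : α → ℕ} (hp : Primrec p) :
    Primrec fun a => (c a).machine.fin (p a) := by
  unfold Code.machine
  fun_prop

include hc in
@[fun_prop]
theorem primrec_code_moves {p o : α → ℕ} (hp : Primrec p) (ho : Primrec o) :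
    Primrec fun a => (c a).moves (p a) (o a) := by
  unfold Code.moves
  fun_prop

include hc in
@[fun_prop]
theorem primrec_liftedMoves {p o : α → ℕ} (hp : Primrec p) (ho : Primrec o) :
    Primrec fun a => (c a).liftedMoves (p a) (o a) := by
  unfold Code.liftedMoves Prod.map id
  fun_prop

include hc in
@[fun_prop]
theorem primrec_symbolicOutputs {s : α → List (Option Summary)} {u : α → Word ℕ}
    (hs : Primrec s) (hu : Primrec u) :
    Primrec fun a => (c a).symbolicOutputs (s a) (u a) := by
  unfold Code.symbolicOutputs Code.liftedStarts Code.liftedFin Code.starts constAsg Prod.map id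
  fun_prop

include h₁ h₂

theorem primrec_composeIni : Primrec fun a => composeIni (c₁ a) (c₂ a) := by
  unfold composeIni contentWord tableVal
  fun_prop

theorem primrec_composeStep {s : α → State} (hs : Primrec s) :
    Primrec fun a => composeStep (c₁ a) (c₂ a) (s a) := by
  unfold composeStep
  fun_prop

theorem primrec_composeFin {s : α → State} (hs : Primrec s) :
    Primrec fun a => composeFin (c₁ a) (c₂ a) (s a) := by
  unfold composeFin
  fun_prop

theorem primrec_states : Primrec fun a => states (c₁ a) (c₂ a) := by
  unfold states allSummaries shapes registerWords
  fun_prop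

end Code

end Primrec

theorem computable_composeCode : Computable₂ composeCode := by
  have h₁ : Primrec fun p : Code × Code => p.1 := Primrec.fst
  have h₂ : Primrec fun p : Code × Code => p.2 := Primrec.snd
  have hcompose : Primrec fun p : Code × Code => composeCode p.1 p.2 :=
    primrec_toCode (primrec_composeIni h₁ h₂)
      (primrec_composeStep (h₁.comp Primrec.fst) (h₂.comp Primrec.fst) Primrec.snd)
      (primrec_composeFin (h₁.comp Primrec.fst) (h₂.comp Primrec.fst) Primrec.snd)
      (primrec_states h₁ h₂) (by fun_prop) (by fun_prop) (by fun_prop)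
  exact hcompose.to_comp

theorem exists_code_eq_composeCode {P : Polynomial ℕ} (hP : ∀ m, sizeBound m ≤ 2 ^ P.eval m)
    (T₁ T₂ : NSST) :
    ∃ T : NSST, composeCode T₁.code T₂.code = T.code ∧ T.inAlph = T₁.inAlph ∧
      T.outAlph = T₂.outAlph ∧ (∀ D, T.sem D = compSem T₁ T₂ D) ∧
      T.size ≤ 2 ^ P.eval (T₁.size + T₂.size + 1) := by
  have hc₁ := wellFormed_code T₁
  have hc₂ := wellFormed_code T₂
  obtain ⟨T, hT, hin, hout⟩ :=
    exists_code_eq (wellFormed_composeCode hc₁ hc₂) (A := T₁.inAlph) (B := T₂.outAlph) rfl rfl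
  refine ⟨T, hT.symm, hin, hout, fun D => ?_, ?_⟩
  · simp only [compSem, sem_eq_sem_machine, hT, sem_composeCode hc₁ hc₂]
  · have h₁ : Bounded (T₁.size + T₂.size + 1) T₁.code :=
      bounded_of_codeSize_le (by rw [codeSize_code]; omega)
    have h₂ : Bounded (T₁.size + T₂.size + 1) T₂.code :=
      bounded_of_codeSize_le (by rw [codeSize_code]; omega)
    rw [← codeSize_code, hT]
    exact (codeSize_composeCode_le h₁ h₂ hc₂ (Nat.le_add_left 1 _)).trans (hP _)

theorem eval_aeval_add_add_one (P : Polynomial ℕ) (a b : ℕ) :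
    MvPolynomial.eval ![a, b]
      (Polynomial.aeval (MvPolynomial.X 0 + MvPolynomial.X 1 + 1 : MvPolynomial (Fin 2) ℕ) P) =
      P.eval (a + b + 1) := by
  rw [← MvPolynomial.coe_aeval_eq_eval, Polynomial.aeval_def, Polynomial.eval₂_eq_sum_range]
  simp [Polynomial.eval_eq_sum_range]

end NSST

theorem theorem4_general :
    ∃ (f : NSST.Code → NSST.Code → NSST.Code) (P : MvPolynomial (Fin 2) ℕ) (C : ℕ), Computable₂ f ∧
      ∀ T₁ T₂ : NSST, ∃ T : NSST, f T₁.code T₂.code = T.code ∧ T.inAlph = T₁.inAlph ∧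
        T.outAlph = T₂.outAlph ∧ (∀ D : List ℕ, T.sem D = NSST.compSem T₁ T₂ D) ∧
        T.size ≤ C * 2 ^ MvPolynomial.eval ![T₁.size, T₂.size] P := by
  obtain ⟨P, hP⟩ := NSST.expBounded_sizeBound
  refine ⟨NSST.composeCode, Polynomial.aeval (MvPolynomial.X 0 + MvPolynomial.X 1 + 1) P, 1,
    NSST.computable_composeCode, fun T₁ T₂ => ?_⟩
  rw [one_mul, NSST.eval_aeval_add_add_one]
  exact NSST.exists_code_eq_composeCode hP T₁ T₂

theorem theorem4 :
    ∃ (f : NSST.Code → NSST.Code → NSST.Code) (P : MvPolynomial (Fin 2) ℕ) (C : ℕ),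
      Computable₂ f ∧
      ∀ T₁ T₂ : NSST, T₁.outAlph ⊆ T₂.inAlph →
        ∃ T : NSST,
          f T₁.code T₂.code = T.code ∧
          T.inAlph = T₁.inAlph ∧
          T.outAlph = T₂.outAlph ∧
          (∀ D : List ℕ, (∀ a ∈ D, a ∈ T₁.inAlph) → T.sem D = NSST.compSem T₁ T₂ D) ∧
          T.size ≤ C * 2 ^ MvPolynomial.eval ![T₁.size, T₂.size] P := by
  obtain ⟨f, P, C, hf, h⟩ := theorem4_general
  exact ⟨f, P, C, hf, fun T₁ T₂ _ =>
    let ⟨T, hT, hin, hout, hsem, hsize⟩ := h T₁ T₂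
    ⟨T, hT, hin, hout, fun D _ => hsem D, hsize⟩⟩
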